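/- **Theorem 4.2.** Let $\lambda$ be a partition with $L=\ell(\lambda)$ nonzero parts and largest part $K=\lambda_1$, let $S(\lambda)=\{(i,j):\ j\ge 1,\ 1\le i\le\lambda_j\}$ be its shape, and let $P_0=(0,L),P_1,\dots,P_{K+L}=(K,0)$ be the right/down lattice path along the boundary of $S(\lambda)$ (it steps right by $(1,0)$ as long as it stays in $S(\lambda)$, and otherwise down by $(0,-1)$). Let $0\le a_i<1$ $(1\le i\le K)$ and $0\le b_j<1$ $(1\le j\le L)$, and let $W(\lambda)=(w(i,j))_{(i,j)\in S(\lambda)}$ consist of independent geometric random variables, $$\mathbb P[w(i,j)=m]=(1-a_ib_j)(a_ib_j)^m,\qquad m\ge 0 .$$ Put $w^{(0)}=w$ (extended by $0$ outside $S(\lambda)$) and, for $k\ge 0$ and $i,j\ge 1$, $$G^{(k)}(i,j)=\max\big(G^{(k)}(i-1,j),G^{(k)}(i,j-1)\big)+w^{(k)}(i,j),\qquad G^{(k)}(i,0)=G^{(k)}(0,j)=0,$$ $$w^{(k+1)}(i,j)=\min\big(G^{(k)}(i-1,j),G^{(k)}(i,j-1)\big)-G^{(k)}(i-1,j-1),$$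 so that $G=G^{(0)}$ is the last-passage array. For $-L<r<K$ and $k\ge 1$ set $$x^r_k=G^{(k-1)}(P_{r+L})-k+1 ,$$ so that $x^r_1=G(P_{r+L})$. Then the image of the law of $W(\lambda)$ under the map $$W(\lambda)\longmapsto \sum_{r=-L+1}^{K-1}\ \sum_{k\ge 1}\delta_{(r,x^r_k)}$$ is a determinantal point process on $\{-L+1,\dots,K-1\}\times\mathbb Z$ (with counting measure as reference measure): it is a point process all of whose correlation functions $\rho_n$ exist, and $$\rho_n\big((s_1,x_1),\dots,(s_n,x_n)\big)=\det\big(K_\lambda(s_i,x_i;s_j,x_j)\big)_{i,j=1}^n,\qquad n\ge 1 .$$ The correlation kernel $K_\lambda$ is given as follows. For $-L\le t<K$ set $$f_t^+(z)=\frac{1-a_i}{1-a_iz},\quad f_t^-(z)=1\qquad\text{if } P_{t+L}=(i-1,y),\ P_{t+L+1}=(i,y)\ \text{for some } y \quad(\text{right-step}),$$ $$f_t^+(z)=1,\quad f_t^-(z)=\frac{1-b_i}{1-b_i/z}\qquad\text{if } P_{t+L}=(x,i),\ P_{t+L+1}=(x,i-1)\ \text{for some } x\quad(\text{down-step}).$$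 For $-L<r,s<K$ let $$F_\lambda(z,w)=\prod_{t=r}^{K-1}f_t^-\!\Big(\frac1z\Big)\prod_{t=-L}^{s-1}f_t^+\!\Big(\frac1w\Big)\prod_{t=-L}^{r-1}f_t^+\!\Big(\frac1z\Big)^{-1}\prod_{t=s}^{K-1}f_t^-\!\Big(\frac1w\Big)^{-1},$$ let $\phi_{r,s}\equiv 0$ if $r\ge s$, and $$\phi_{r,s}(x,y)=\frac1{2\pi}\int_{-\pi}^{\pi}e^{i(y-x)\theta}F_\lambda(e^{i\theta},e^{i\theta})\,d\theta\qquad\text{if } r<s .$$ Then $$K_\lambda(r,x;s,y)=-\phi_{r,s}(x,y)+\frac1{(2\pi i)^2}\int_{\gamma_{r_2}}\frac{dz}{z}\int_{\gamma_{r_1}}\frac{dw}{w}\,\frac{w^y}{z^x}\,\frac{z}{z-w}\,F_\lambda(z,w),$$ where $\gamma_\rho$ is the positively oriented circle of radius $\rho$ about $0$, and $r_1,r_2$ are any radii with $0<r_1<r_2$, $\max_{i\le K} a_i<r_1$ and $b_jr_2<1$ for all $j\le L$. -/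

import Mathlib

open MeasureTheory ProbabilityTheory
open scoped ENNReal NNReal Real

/-! ## Point processes, correlation functions, determinantal processes -/

namespace PointProcess

variable {Λ : Type*} [MetricSpace Λ] [MeasurableSpace Λ]

/-- A (boundedly finite) counting measure: every bounded Borel set has a mass in `ℕ`. -/
def IsCountingMeasure (ξ : Measure Λ) : Prop :=
  ∀ B : Set Λ, MeasurableSet B → Bornology.IsBounded B → ∃ n : ℕ, ξ B = n

/-- A point process on `Λ`: a probability measure on the space of counting measures. The space
`Measure Λ` carries the `σ`-algebra generated by the evaluations `ξ ↦ ξ A`, `A` Borel. -/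
structure IsPointProcess (P : Measure (Measure Λ)) : Prop where
  isProbabilityMeasure : IsProbabilityMeasure P
  ae_isCountingMeasure : ∀ᵐ ξ ∂P, IsCountingMeasure ξ

/-- The falling factorial `t (t - 1) ⋯ (t - k + 1) = t! / (t - k)!`; the subtraction is truncated,
so the value is `0` when `t` is a natural number smaller than `k`. -/
noncomputable def fallingFactorial (t : ℝ≥0∞) (k : ℕ) : ℝ≥0∞ :=
  ∏ l ∈ Finset.range k, (t - (l : ℝ≥0∞))

/-- The number of `k ∈ {0, …, n - 1}` with `c k = j`. -/
def multiplicity {n m : ℕ} (c : Fin n → Fin m) (j : Fin m) : ℕ :=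
  (Finset.univ.filter fun k => c k = j).card

/-- The factorial moment measure `M_n` of `P` evaluated at the product set
`A (c 0) × ⋯ × A (c (n - 1))`, where `A 0, …, A (m - 1)` are disjoint:
`E [∏ⱼ ξ(A j)! / (ξ(A j) - nⱼ)!]` with `nⱼ` the multiplicity of `j` in `c`. -/
noncomputable def factorialMoment (P : Measure (Measure Λ)) {n m : ℕ}
    (A : Fin m → Set Λ) (c : Fin n → Fin m) : ℝ≥0∞ :=
  ∫⁻ ξ, ∏ j, fallingFactorial (ξ (A j)) (multiplicity c j) ∂P

/-- `ρ` is the `n`-th correlation function of `P` with respect to the reference measure `ν`: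
the `n`-th factorial moment measure is finite on bounded sets and has density `ρ` with respect
to `ν ⊗ ⋯ ⊗ ν`. -/
structure IsCorrelationFunction (P : Measure (Measure Λ)) (ν : Measure Λ) (n : ℕ)
    (ρ : (Fin n → Λ) → ℝ≥0) : Prop where
  measurable : Measurable ρ
  factorialMoment_lt_top : ∀ (m : ℕ) (A : Fin m → Set Λ) (c : Fin n → Fin m),
    (∀ j, MeasurableSet (A j)) → (∀ j, Bornology.IsBounded (A j)) →
    Pairwise (fun i j => Disjoint (A i) (A j)) → factorialMoment P A c < ∞
  factorialMoment_eq : ∀ (m : ℕ) (A : Fin m → Set Λ) (c : Fin n → Fin m),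
    (∀ j, MeasurableSet (A j)) → (∀ j, Bornology.IsBounded (A j)) →
    Pairwise (fun i j => Disjoint (A i) (A j)) →
    factorialMoment P A c =
      ∫⁻ z in {z : Fin n → Λ | ∀ k, z k ∈ A (c k)}, (ρ z : ℝ≥0∞) ∂(Measure.pi fun _ => ν)

/-- `P` is a determinantal point process with correlation kernel `K` (with respect to the
reference measure `ν`): all correlation functions exist and are given by
`ρ_n(z_1, …, z_n) = det (K(z_i, z_j))`. -/
structure IsDeterminantal (P : Measure (Measure Λ)) (ν : Measure Λ) (K : Λ → Λ → ℂ) : Prop where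
  isPointProcess : IsPointProcess P
  exists_correlationFunction : ∀ n : ℕ, 1 ≤ n → ∃ ρ : (Fin n → Λ) → ℝ≥0,
    IsCorrelationFunction P ν n ρ ∧
    ∀ z : Fin n → Λ, ((ρ z : ℝ) : ℂ) = Matrix.det (Matrix.of fun i j => K (z i) (z j))

end PointProcess

/-! ## Last passage along the right/down path of a partition -/

namespace LastPassage

/-- The part `λ_j`, `j ≥ 1`, of the partition with Young diagram `lam`. -/
def part (lam : YoungDiagram) (j : ℕ) : ℕ := lam.rowLen (j - 1)

/-- The number of (nonzero) parts, `L = ℓ(λ)`. -/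
def len (lam : YoungDiagram) : ℕ := lam.colLen 0

/-- The largest part, `K = λ_1`. -/
def width (lam : YoungDiagram) : ℕ := part lam 1

/-- The shape `S(λ) = {(i, j) : 1 ≤ i ≤ λ_j, j ≥ 1}`. -/
def shape (lam : YoungDiagram) : Finset (ℕ × ℕ) :=
  (Finset.Icc 1 (width lam) ×ˢ Finset.Icc 1 (len lam)).filter fun p => p.1 ≤ part lam p.2

/-- The right/down path `P_0 = (0, L), …, P_{K+L} = (K, 0)` along the boundary of `S(λ)`: it steps
to the right as long as it stays in the shape, and down otherwise. (Values with an index larger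
than `K + L` are irrelevant.) -/
def path (lam : YoungDiagram) : ℕ → ℕ × ℕ
  | 0 => (0, len lam)
  | n + 1 =>
    if ((path lam n).1 + 1, (path lam n).2) ∈ shape lam then
      ((path lam n).1 + 1, (path lam n).2)
    else ((path lam n).1, (path lam n).2 - 1)

/-- Arrays `W(λ) = (w(i, j))_{(i, j) ∈ S(λ)}` of natural numbers. -/
abbrev Arrays (lam : YoungDiagram) : Type := shape lam → ℕ

/-- The probability measure on `W(λ)` under which the `w(i, j)` are independent and geometric,
`P(w(i, j) = m) = (1 - a_i b_j) (a_i b_j) ^ m`. -/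
noncomputable def arrayMeasure (lam : YoungDiagram) (a b : ℕ → ℝ) : Measure (Arrays lam) :=
  Measure.pi fun p : shape lam =>
    geometricMeasure (Set.projIcc (0 : ℝ) 1 zero_le_one (1 - a p.1.1 * b p.1.2))

/-- The array as a function on `ℕ × ℕ`, extended by `0` outside of the shape. -/
def extend {lam : YoungDiagram} (W : Arrays lam) (i j : ℕ) : ℕ :=
  if h : (i, j) ∈ shape lam then W ⟨(i, j), h⟩ else 0

/-- Last-passage values: `G(i, j) = max (G(i - 1, j), G(i, j - 1)) + w(i, j)` for `i, j ≥ 1`, and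
`G(i, 0) = G(0, j) = 0`. -/
def passage (w : ℕ → ℕ → ℕ) : ℕ → ℕ → ℕ
  | 0, _ => 0
  | _ + 1, 0 => 0
  | i + 1, j + 1 => max (passage w i (j + 1)) (passage w (i + 1) j) + w (i + 1) (j + 1)

/-- The derived array `w'(i, j) = min (G(i - 1, j), G(i, j - 1)) - G(i - 1, j - 1)` for `i, j ≥ 1`,
and `0` on the axes. The difference is never negative, as `G` is monotone. -/
def derived (w : ℕ → ℕ → ℕ) : ℕ → ℕ → ℕ
  | 0, _ => 0
  | _ + 1, 0 => 0
  | i + 1, j + 1 => min (passage w i (j + 1)) (passage w (i + 1) j) - passage w i j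

/-- `G^{(k)}`: the last-passage values of the `k`-th derived array. -/
def passageIter {lam : YoungDiagram} (W : Arrays lam) (k : ℕ) : ℕ → ℕ → ℕ :=
  passage (derived^[k] (extend W))

/-- The vertical lines `{-L + 1, …, K - 1}`. -/
abbrev Lines (lam : YoungDiagram) : Type := Set.Ioo (-(len lam : ℤ)) (width lam : ℤ)

/-- The index `r + L` of the point of the right/down path that belongs to the line `r ≥ -L`. -/
def pathIndex (lam : YoungDiagram) (r : ℤ) : ℕ := (r + len lam).toNat

/-- The height at which the `(k + 1)`-st non-intersecting path (`k = 0` being the top path) leaves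
the line `r`: `G^{(k)}(P_{r + L}(λ)) - k`. The heights on the line `r` are
`x^r_1 > x^r_2 > ⋯`, and `x^r_1 = G(P_{r + L}(λ))`. -/
def height {lam : YoungDiagram} (W : Arrays lam) (r : ℤ) (k : ℕ) : ℤ :=
  (passageIter W k (path lam (pathIndex lam r)).1 (path lam (pathIndex lam r)).2 : ℤ) - k

/-- The point configuration `∑_r ∑_{k ≥ 1} δ_{(r, x^r_k)}` on `{-L + 1, …, K - 1} × ℤ`. -/
noncomputable def configuration {lam : YoungDiagram} (W : Arrays lam) :
    Measure (Lines lam × ℤ) :=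
  Measure.sum fun q : Lines lam × ℕ => Measure.dirac (q.1, height W q.1 q.2)

/-! ## The kernel -/

/-- The step `P_n P_{n+1}` is a right-step, so that it stays in the same row and the vertical edges
on the line `-L + n + 1` are up-edges; otherwise they are down-edges. -/
def IsRightStep (lam : YoungDiagram) (n : ℕ) : Prop :=
  path lam (n + 1) = ((path lam n).1 + 1, (path lam n).2)

instance (lam : YoungDiagram) (n : ℕ) : Decidable (IsRightStep lam n) :=
  inferInstanceAs (Decidable (path lam (n + 1) = ((path lam n).1 + 1, (path lam n).2)))

/-- `f⁺_t`, `-L ≤ t < K`: equal to `(1 - a_i) / (1 - a_i z)` if the edges on the line `t + 1` are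
up-edges of weight `a_i`, i.e. if `P_{t+L} = (i - 1, y)` and `P_{t+L+1} = (i, y)`; equal to `1`
if they are down-edges. -/
noncomputable def fPlus (lam : YoungDiagram) (a : ℕ → ℝ) (t : ℤ) (z : ℂ) : ℂ :=
  if IsRightStep lam (pathIndex lam t) then
    (1 - (a (path lam (pathIndex lam t + 1)).1 : ℂ)) /
      (1 - (a (path lam (pathIndex lam t + 1)).1 : ℂ) * z)
  else 1

/-- `f⁻_t`, `-L ≤ t < K`: equal to `1` if the edges on the line `t + 1` are up-edges; equal to
`(1 - b_i) / (1 - b_i / z)` if they are down-edges of weight `b_i`, i.e. if `P_{t+L} = (x, i)` and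
`P_{t+L+1} = (x, i - 1)`. -/
noncomputable def fMinus (lam : YoungDiagram) (b : ℕ → ℝ) (t : ℤ) (z : ℂ) : ℂ :=
  if IsRightStep lam (pathIndex lam t) then 1
  else
    (1 - (b (path lam (pathIndex lam t)).2 : ℂ)) /
      (1 - (b (path lam (pathIndex lam t)).2 : ℂ) / z)

/-- The product `F_λ(z, w)`, for the lines `r` and `s`. -/
noncomputable def bigF (lam : YoungDiagram) (a b : ℕ → ℝ) (r s : ℤ) (z w : ℂ) : ℂ :=
  (∏ t ∈ Finset.Ico r (width lam : ℤ), fMinus lam b t (1 / z)) *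
  (∏ t ∈ Finset.Ico (-(len lam : ℤ)) s, fPlus lam a t (1 / w)) *
  (∏ t ∈ Finset.Ico (-(len lam : ℤ)) r, (fPlus lam a t (1 / z))⁻¹) *
  (∏ t ∈ Finset.Ico s (width lam : ℤ), (fMinus lam b t (1 / w))⁻¹)

/-- The transition term `φ_{r,s}(x, y)`. -/
noncomputable def phi (lam : YoungDiagram) (a b : ℕ → ℝ) (r s x y : ℤ) : ℂ :=
  if r < s then
    (1 / (2 * (π : ℂ))) * ∫ θ in (-π)..π,
      Complex.exp (Complex.I * ((y - x : ℤ) : ℂ) * (θ : ℂ)) *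
        bigF lam a b r s (Complex.exp (Complex.I * θ)) (Complex.exp (Complex.I * θ))
  else 0

/-- The kernel `K_λ(r, x; s, y)`, with `z` on the circle of radius `r₂` and `w` on the circle of
radius `r₁`. -/
noncomputable def kernel (lam : YoungDiagram) (a b : ℕ → ℝ) (r₁ r₂ : ℝ)
    (p q : Lines lam × ℤ) : ℂ :=
  -phi lam a b p.1 q.1 p.2 q.2 +
    (1 / (2 * (π : ℂ) * Complex.I) ^ 2) *
      ∮ z in C(0, r₂), (1 / z) * ∮ w in C(0, r₁), (1 / w) *
        (w ^ q.2 / z ^ p.2 * (z / (z - w)) * bigF lam a b p.1 q.1 z w)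

end LastPassage

/-! For a fixed point of the boundary path the numbers G^(k) decrease in k, so they form a
partition, and consecutive partitions along the path interlace, increasing at right-steps and
decreasing at down-steps. Around a cell, with γ at the lower left, α and β at the two neighbours and
ν at the upper right corner, they obey ν_0 = max(α_0, β_0) + w and ν_{k+1} = max(α_{k+1}, β_{k+1}) +
min(α_k, β_k) - γ_k. This is the local form of RSK, and it can be solved for w and γ. Removing
corners one at a time therefore gives a bijection between arrays on the shape and interlacing
sequences that are empty at both ends (`exists_iterPassage_eq`, `eq_on_cells_of_iterPassage_eq`).
Summed over k the rule reads |ν| + |γ| = |α| + |β| + w, which turns the geometric weight of an array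
into a product of powers of the a_i and b_j over the steps of the path (`prod_stepWeight`).

After the shift to the heights σ_k - k, the weight of one interlacing step is a determinant of
geometric one-particle jumps (`det_geometric_step`). To work with finitely many particles only the
top m + x are kept at a point (x, y) of the path; all others sit at their packed positions -k. A
right-step lets in one particle from just below the packed configuration. Since m is arbitrary, any
finite set of points can be brought into the range where the truncation is invisible. Cauchy–Binet
then sums all configurations, with weight 1 + q at prescribed test points, into one determinant of
one-particle kernels (`configForm_eq_det`). A Duhamel expansion in q makes it a block determinant in
the free kernels (`det_pathKernel_pointWeight`), in which the spatial window can be removed, and the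
free kernels on ℤ are Fourier coefficients of products of symbols (`convKernel_stepCoef`).

The Eynard–Mehta theorem would now call for the inverse of the matrix A of kernels from the births
to the final packed sites. It is avoided by two properties of the double contour integral. As a
function of the target (s, y) it is a combination of the kernels of the entering particles, with
coefficients that depend on the source only (`exists_doubleKernel_expansion`): a function analytic
inside the outer circle is divided successively at 0 and at the poles of the up-symbols. At the
final packed sites it equals the transition kernel from the source (`doubleKernel_final`), by
Cauchy's formula at infinity. So the coefficients form a matrix Q with Q A = C, and block
elimination leaves det A · det(1 + qK) (`det_fromBlocks_eq_det_stepKernel`).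

Hence E ∏(1 + q 1_occupied) = det(1 + qK), the constant being fixed by q = 0. Setting q = 1/u,
multiplying by u for every point and letting u tend to 0 gives det K as the probability that all
points are occupied (`measureReal_occupied`). The heights on a line are strictly decreasing, so the
process is simple, and on a countable space these probabilities are its correlation functions
(`isCorrelationFunction_simple`). -/

namespace LastPassage

/-! ## Cauchy–Binet and one-step determinants -/

/-- The elements of a finite set of integers in increasing order (padded by `0`). -/
def sortedTuple (n : ℕ) (s : Finset ℤ) : Fin n → ℤ := fun i => (s.sort (· ≤ ·)).getD i 0

theorem sortedTuple_eq_orderEmbOfFin {n : ℕ} {s : Finset ℤ} (h : s.card = n) :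
    sortedTuple n s = s.orderEmbOfFin h := by
  funext i
  have hi : (i : ℕ) < (s.sort (· ≤ ·)).length := by rw [Finset.length_sort, h]; exact i.2
  rw [Finset.orderEmbOfFin_apply, sortedTuple, List.getD_eq_getElem _ _ hi]
  rfl

theorem sortedTuple_eq {n : ℕ} {s : Finset ℤ} (h : s.card = n) {y : Fin n → ℤ}
    (hy : StrictMono y) (hys : ∀ i, y i ∈ s) : sortedTuple n s = y := by
  rw [sortedTuple_eq_orderEmbOfFin h, ← Finset.orderEmbOfFin_unique h hys hy]

theorem sortedTuple_strictMono {n : ℕ} {s : Finset ℤ} (h : s.card = n) :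
    StrictMono (sortedTuple n s) := by
  rw [sortedTuple_eq_orderEmbOfFin h]
  exact (s.orderEmbOfFin h).strictMono

theorem sortedTuple_mem {n : ℕ} {s : Finset ℤ} (h : s.card = n) (i : Fin n) :
    sortedTuple n s i ∈ s := by
  rw [sortedTuple_eq_orderEmbOfFin h]
  exact s.orderEmbOfFin_mem h i

theorem exists_sortedTuple_eq {n : ℕ} {s : Finset ℤ} (h : s.card = n) {x : ℤ} (hx : x ∈ s) :
    ∃ i, sortedTuple n s i = x := by
  rw [sortedTuple_eq_orderEmbOfFin h]
  have := s.range_orderEmbOfFin h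
  have hx' : x ∈ Set.range (s.orderEmbOfFin h) := by rw [this]; exact hx
  exact hx'

theorem alternatingMap_eq_sum_pi {n : ℕ} (G : (ℤ → ℝ) [⋀^Fin n]→ₗ[ℝ] ℝ) (X : Finset ℤ)
    (u : Fin n → ℤ → ℝ) (hu : ∀ i, ∀ z ∉ X, u i z = 0) :
    G u = ∑ r ∈ Fintype.piFinset (fun _ : Fin n => X),
      (∏ i, u i (r i)) * G (fun i => Pi.single (r i) 1) := by
  have hui : u = fun i => ∑ z ∈ X, u i z • (Pi.single z 1 : ℤ → ℝ) := by
    funext i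
    ext z
    rw [Finset.sum_apply]
    simp only [Pi.smul_apply, Pi.single_apply, smul_eq_mul, mul_ite, mul_one, mul_zero]
    rw [Finset.sum_ite_eq]
    split_ifs with h
    · rfl
    · exact hu i z h
  conv_lhs => rw [hui]
  have := MultilinearMap.map_sum_finset G.toMultilinearMap
    (fun i z => u i z • (Pi.single z 1 : ℤ → ℝ)) (fun _ => X)
  simp only [AlternatingMap.coe_multilinearMap] at this
  rw [this]
  refine Finset.sum_congr rfl fun r _ => ?_
  have h2 := MultilinearMap.map_smul_univ G.toMultilinearMap (fun i => u i (r i))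
    (fun i => (Pi.single (r i) 1 : ℤ → ℝ))
  simpa using h2

/-- The Cauchy–Binet formula, for an arbitrary alternating form. -/
theorem alternatingMap_eq_sum_powersetCard {n : ℕ} (G : (ℤ → ℝ) [⋀^Fin n]→ₗ[ℝ] ℝ) (X : Finset ℤ)
    (u : Fin n → ℤ → ℝ) (hu : ∀ i, ∀ z ∉ X, u i z = 0) :
    G u = ∑ s ∈ X.powersetCard n, Matrix.det (Matrix.of fun i j => u i (sortedTuple n s j)) *
      G (fun j => Pi.single (sortedTuple n s j) 1) := by
  classical
  rw [alternatingMap_eq_sum_pi G X u hu]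
  have key : ∀ s ∈ X.powersetCard n,
      Matrix.det (Matrix.of fun i j => u i (sortedTuple n s j)) *
        G (fun j => Pi.single (sortedTuple n s j) 1) =
      ∑ σ : Equiv.Perm (Fin n), (∏ i, u i (sortedTuple n s (σ i))) *
        G (fun i => Pi.single (sortedTuple n s (σ i)) 1) := by
    intro s _
    rw [← Matrix.det_transpose, Matrix.det_apply, Finset.sum_mul]
    refine Finset.sum_congr rfl fun σ _ => ?_
    have hp := G.map_perm (fun j => (Pi.single (sortedTuple n s j) 1 : ℤ → ℝ)) σ
    have hp' : G (fun i => Pi.single (sortedTuple n s (σ i)) 1) =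
      Equiv.Perm.sign σ • G (fun j => Pi.single (sortedTuple n s j) 1) := hp
    rw [hp']
    simp only [Matrix.transpose_apply, Matrix.of_apply, Units.smul_def, zsmul_eq_mul]
    ring
  rw [Finset.sum_congr rfl key, Finset.sum_sigma' _ (fun _ => Finset.univ)
    (fun (s : Finset ℤ) (σ : Equiv.Perm (Fin n)) => (∏ i, u i (sortedTuple n s (σ i))) *
        G (fun i => Pi.single (sortedTuple n s (σ i)) 1))]
  symm
  -- Tuples with a repetition drop out because `G` is alternating; an injective tuple amounts to its
  -- image together with a permutation.
  rw [← Finset.sum_filter_of_ne (p := fun r : Fin n → ℤ => Function.Injective r)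
    (s := Fintype.piFinset fun _ => X)]
  · refine Finset.sum_bij (fun p _ => fun i => sortedTuple n p.1 (p.2 i)) ?_ ?_ ?_ ?_
    · rintro ⟨s, σ⟩ hp
      simp only [Finset.mem_sigma, Finset.mem_powersetCard, Finset.mem_univ, and_true] at hp
      simp only [Finset.mem_filter, Fintype.mem_piFinset]
      exact ⟨fun i => hp.1 (sortedTuple_mem hp.2 _),
        (sortedTuple_strictMono hp.2).injective.comp σ.injective⟩
    · rintro ⟨s, σ⟩ hp ⟨s', σ'⟩ hp' heq
      simp only [Finset.mem_sigma, Finset.mem_powersetCard, Finset.mem_univ, and_true] at hp hp'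
      have hs : ∀ {s : Finset ℤ} (hs : s.card = n) (σ : Equiv.Perm (Fin n)) (x : ℤ), x ∈ s ↔
          ∃ i, sortedTuple n s (σ i) = x := by
        intro s hs σ x
        constructor
        · intro hx
          obtain ⟨i, hi⟩ := exists_sortedTuple_eq hs hx
          exact ⟨σ.symm i, by simpa using hi⟩
        · rintro ⟨i, rfl⟩
          exact sortedTuple_mem hs _
      have hss : s = s' := by
        ext x
        rw [hs hp.2 σ, hs hp'.2 σ']
        have := fun i => congrFun heq i
        simp only at this
        simp only [this]
      subst hss
      have : σ = σ' := by
        ext i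
        have := (sortedTuple_strictMono hp.2).injective (congrFun heq i)
        rw [this]
      rw [this]
    · intro r hr
      simp only [Finset.mem_filter, Fintype.mem_piFinset] at hr
      obtain ⟨hrX, hinj⟩ := hr
      have hcard : (Finset.univ.image r).card = n := by
        rw [Finset.card_image_of_injective _ hinj, Finset.card_univ, Fintype.card_fin]
      choose g hg using fun i => exists_sortedTuple_eq hcard (x := r i) (by simp)
      have hginj : Function.Injective g := by
        intro i j hij
        apply hinj
        rw [← hg i, ← hg j, hij]
      refine ⟨⟨Finset.univ.image r, Equiv.ofBijective g (Finite.injective_iff_bijective.1 hginj)⟩,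
        ?_, ?_⟩
      · simp only [Finset.mem_sigma, Finset.mem_powersetCard, Finset.mem_univ, and_true]
        refine ⟨?_, hcard⟩
        intro x hx
        simp only [Finset.mem_image, Finset.mem_univ, true_and] at hx
        obtain ⟨i, rfl⟩ := hx
        exact hrX i
      · funext i
        exact hg i
    · intro p _
      rfl
  · intro r _ hne
    by_contra hinj
    apply hne
    rw [Function.Injective] at hinj
    push Not at hinj
    obtain ⟨i, j, hij, hne'⟩ := hinj
    rw [G.map_eq_zero_of_eq _ (i := i) (j := j) (by simp [hij]) hne', mul_zero]

/-- The one-step determinant: geometric jumps to the right give the indicator of interlacing. -/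
theorem det_geometric_step (q : ℝ) : ∀ (n : ℕ) (x y : Fin n → ℤ), StrictMono x → StrictMono y →
    Matrix.det (Matrix.of fun i j => if x i ≤ y j then q ^ (y j - x i).toNat else (0 : ℝ)) =
      if (∀ i, x i ≤ y i) ∧ (∀ i j : Fin n, i < j → y i < x j) then
        ∏ i, q ^ (y i - x i).toNat else 0 := by
  intro n
  induction n with
  | zero => intro x y _ _; simp
  | succ n ih =>
    intro x y hx hy
    by_cases h1 : x (Fin.last n) ≤ y (Fin.last n)
    · by_cases h2 : ∀ i : Fin n, y i.castSucc < x (Fin.last n)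
      -- The last row vanishes off the diagonal, so the last row and column split off.
      · have hrow : ∀ j : Fin n, ¬ (x (Fin.last n) ≤ y j.castSucc) := fun j => not_le.2 (h2 j)
        rw [Matrix.det_succ_row _ (Fin.last n), Finset.sum_eq_single (Fin.last n)]
        · have hih := ih (fun i => x i.castSucc) (fun i => y i.castSucc)
            (fun i j hij => hx (by simpa using hij)) (fun i j hij => hy (by simpa using hij))
          have hsub : ((Matrix.of fun i j => if x i ≤ y j then q ^ (y j - x i).toNat
              else (0 : ℝ)).submatrix (Fin.last n).succAbove (Fin.last n).succAbove) =
              Matrix.of fun i j : Fin n => if x i.castSucc ≤ y j.castSucc then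
                q ^ (y j.castSucc - x i.castSucc).toNat else (0 : ℝ) := by
            ext i j
            simp
          rw [hsub, hih]
          have hcond : ((∀ i, x i ≤ y i) ∧ (∀ i j : Fin (n + 1), i < j → y i < x j)) ↔
              ((∀ i : Fin n, x i.castSucc ≤ y i.castSucc) ∧
                (∀ i j : Fin n, i < j → y i.castSucc < x j.castSucc)) := by
            constructor
            · rintro ⟨ha, hb⟩
              exact ⟨fun i => ha _, fun i j hij => hb _ _ (by simpa using hij)⟩
            · rintro ⟨ha, hb⟩
              refine ⟨fun i => ?_, fun i j hij => ?_⟩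
              · induction i using Fin.lastCases with
                | last => exact h1
                | cast i => exact ha i
              · induction j using Fin.lastCases with
                | last =>
                  induction i using Fin.lastCases with
                  | last => exact absurd hij (lt_irrefl _)
                  | cast i => exact h2 i
                | cast j =>
                  induction i using Fin.lastCases with
                  | last => exact absurd (Fin.castSucc_lt_last j) (not_lt.2 hij.le)
                  | cast i => exact hb i j (by simpa using hij)
          rw [if_congr hcond rfl rfl, Fin.prod_univ_castSucc]
          simp only [Matrix.of_apply, if_pos h1, Fin.val_last]
          rw [← two_mul, pow_mul]
          split_ifs
          · ring
          · ring
        · intro j _ hj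
          induction j using Fin.lastCases with
          | last => exact absurd rfl hj
          | cast j => simp [hrow j]
        · simp
      · push Not at h2
        obtain ⟨i, hi⟩ := h2
        have hlt : y i.castSucc < y (Fin.last n) := hy (Fin.castSucc_lt_last i)
        have hxl : ∀ k, x k ≤ x (Fin.last n) := fun k => hx.monotone (Fin.le_last k)
        rw [if_neg (fun h => absurd (h.2 i.castSucc (Fin.last n) (Fin.castSucc_lt_last i))
          (not_lt.2 hi))]
        -- Every `x k` lies at or below `y i.castSucc`, so this column and the last one are
        -- proportional, with ratio a power of `q`.
        have hcol := Matrix.det_updateCol_add_smul_self (Matrix.of fun i j =>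
          if x i ≤ y j then q ^ (y j - x i).toNat else (0 : ℝ)) (i := Fin.last n)
          (j := i.castSucc) (ne_of_gt (Fin.castSucc_lt_last i))
          (-q ^ (y (Fin.last n) - y i.castSucc).toNat)
        rw [← hcol]
        refine Matrix.det_eq_zero_of_column_eq_zero (Fin.last n) fun k => ?_
        have e1 : x k ≤ y i.castSucc := (hxl k).trans hi
        have e2 : x k ≤ y (Fin.last n) := e1.trans hlt.le
        simp only [Matrix.updateCol_self, Matrix.of_apply, if_pos e1, if_pos e2, smul_eq_mul]
        have : (y (Fin.last n) - x k).toNat =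
            (y (Fin.last n) - y i.castSucc).toNat + (y i.castSucc - x k).toNat := by omega
        rw [this, pow_add]
        ring
    · rw [if_neg (fun h => h1 (h.1 _))]
      refine Matrix.det_eq_zero_of_row_eq_zero (Fin.last n) fun j => ?_
      have : ¬ x (Fin.last n) ≤ y j :=
        fun h => h1 (h.trans (hy.monotone (Fin.le_last j)))
      simp [this]


/-! ## Sums over non-intersecting configurations as determinants -/

/-- One step of a one-particle transfer operator with kernel `φ t`, weighted by `h (t + 1)`, in the
window `X`. -/
def stepMap (φ : ℕ → ℤ → ℤ → ℝ) (h : ℕ → ℤ → ℝ) (X : Finset ℤ) (t : ℕ) :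
    (ℤ → ℝ) →ₗ[ℝ] (ℤ → ℝ) where
  toFun v z := if z ∈ X then (∑ x ∈ X, v x * φ t x z) * h (t + 1) z else 0
  map_add' u v := by
    funext z
    simp only [Pi.add_apply]
    split_ifs
    · simp only [add_mul, Finset.sum_add_distrib]
    · simp
  map_smul' r v := by
    funext z
    simp only [Pi.smul_apply, smul_eq_mul, RingHom.id_apply]
    split_ifs
    · simp only [mul_assoc, ← Finset.mul_sum]
    · simp

theorem stepMap_apply_of_notMem (φ : ℕ → ℤ → ℤ → ℝ) (h : ℕ → ℤ → ℝ) (X : Finset ℤ) (t : ℕ)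
    (v : ℤ → ℝ) {z : ℤ} (hz : z ∉ X) : stepMap φ h X t v z = 0 := if_neg hz

theorem stepMap_apply (φ : ℕ → ℤ → ℤ → ℝ) (h : ℕ → ℤ → ℝ) (X : Finset ℤ) (t : ℕ)
    (v : ℤ → ℝ) {z : ℤ} (hz : z ∈ X) :
    stepMap φ h X t v z = (∑ x ∈ X, v x * φ t x z) * h (t + 1) z := if_pos hz

theorem stepMap_single (φ : ℕ → ℤ → ℤ → ℝ) (h : ℕ → ℤ → ℝ) {X : Finset ℤ} (t : ℕ)
    {x z : ℤ} (hx : x ∈ X) (hz : z ∈ X) :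
    stepMap φ h X t (Pi.single x 1) z = φ t x z * h (t + 1) z := by
  rw [stepMap_apply _ _ _ _ _ hz]
  congr 1
  simp [Pi.single_apply, hx]

/-- The densely packed configuration of `n` particles with top particle at `0`. -/
def packed (n : ℕ) (j : Fin n) : ℤ := (j : ℤ) - ((n : ℤ) - 1)

/-- The number of particles after the step `t`, if there are `n` particles before it. -/
def nextCount (up : ℕ → Prop) [DecidablePred up] (t n : ℕ) : ℕ := if up t then n + 1 else n

section Forms

variable (up : ℕ → Prop) [DecidablePred up] (φ : ℕ → ℤ → ℤ → ℝ) (h : ℕ → ℤ → ℝ) (X : Finset ℤ)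

/-- The total weight of non-intersecting configurations, as an alternating form in the initial
condition; an up-step adds a particle at the bottom. -/
noncomputable def configForm : ℕ → ℕ → (n : ℕ) → (ℤ → ℝ) [⋀^Fin n]→ₗ[ℝ] ℝ
  | 0, _, n => Matrix.detRowAlternating.compLinearMap (LinearMap.funLeft ℝ ℝ (packed n))
  | rem + 1, t, n =>
    -- The entering particle is argument 0, the lowest one: it starts at `-n`, one site below the
    -- packed configuration of `n` particles, and takes part in the step.
    if up t then
      ((configForm rem (t + 1) (n + 1)).compLinearMap (stepMap φ h X t)).curryLeft
        (Pi.single (-(n : ℤ)) 1)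
    else (configForm rem (t + 1) n).compLinearMap (stepMap φ h X t)

/-- The one-step transition weight between two configurations. -/
noncomputable def stepDet (t n : ℕ) (s s' : Finset ℤ) : ℝ :=
  if up t then
    Matrix.det (Matrix.of fun i j : Fin (n + 1) => stepMap φ h X t
      (Matrix.vecCons (Pi.single (-(n : ℤ)) 1) (fun i => Pi.single (sortedTuple n s i) 1) i)
      (sortedTuple (n + 1) s' j))
  else
    Matrix.det (Matrix.of fun i j : Fin n => stepMap φ h X t
      (Pi.single (sortedTuple n s i) 1) (sortedTuple n s' j))

/-- One application of Cauchy–Binet: images under `stepMap` are supported in the window, so the form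
at the next time is summed over subsets of it. -/
theorem configForm_succ (rem t n : ℕ) (s : Finset ℤ) :
    configForm up φ h X (rem + 1) t n (fun i => Pi.single (sortedTuple n s i) 1) =
      ∑ s' ∈ X.powersetCard (nextCount up t n), stepDet up φ h X t n s s' *
        configForm up φ h X rem (t + 1) (nextCount up t n)
          (fun i => Pi.single (sortedTuple (nextCount up t n) s' i) 1) := by
  generalize hn : nextCount up t n = n'
  by_cases hu : up t
  · obtain rfl : n + 1 = n' := by rw [← hn]; exact (if_pos hu).symm
    simp only [configForm, stepDet, if_pos hu]
    rw [AlternatingMap.curryLeft_apply_apply, AlternatingMap.compLinearMap_apply,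
      alternatingMap_eq_sum_powersetCard _ X]
    intro i z hz
    exact stepMap_apply_of_notMem _ _ _ _ _ hz
  · obtain rfl : n = n' := by rw [← hn]; exact (if_neg hu).symm
    simp only [configForm, stepDet, if_neg hu]
    rw [AlternatingMap.compLinearMap_apply, alternatingMap_eq_sum_powersetCard _ X]
    intro i z hz
    exact stepMap_apply_of_notMem _ _ _ _ _ hz

/-- The weight of the final configuration. -/
noncomputable def finalWeight (n : ℕ) (s : Finset ℤ) : ℝ :=
  Matrix.det (Matrix.of fun i j : Fin n =>
    (Pi.single (sortedTuple n s i) 1 : ℤ → ℝ) (packed n j))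

variable {nn : ℕ → ℕ} (hnn : ∀ t, nn (t + 1) = nextCount up t (nn t))

include hnn in
theorem configForm_eq_sum (rem t : ℕ) (s : Finset ℤ) :
    configForm up φ h X rem t (nn t) (fun i => Pi.single (sortedTuple (nn t) s i) 1) =
      ∑ f ∈ Fintype.piFinset (fun i : Fin rem => X.powersetCard (nn (t + i + 1))),
        (∏ i : Fin rem, stepDet up φ h X (t + i) (nn (t + i))
          (Fin.cons (α := fun _ => Finset ℤ) s f i.castSucc) (f i)) *
        finalWeight (nn (t + rem)) (Fin.cons (α := fun _ => Finset ℤ) s f (Fin.last rem)) := by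
  induction rem generalizing t s with
  | zero =>
    simp only [Finset.univ_eq_empty, Finset.prod_empty, one_mul]
    rw [Finset.sum_eq_single (fun i : Fin 0 => i.elim0)]
    · rfl
    · intro b _ hb
      exact absurd (Subsingleton.elim _ _) hb
    · intro hb
      exact absurd (Fintype.mem_piFinset.2 fun i => i.elim0) hb
  | succ rem ih =>
    rw [configForm_succ, ← hnn]
    simp_rw [ih, Finset.mul_sum]
    rw [Finset.sum_sigma']
    refine Finset.sum_bij' (fun p _ => Fin.cons (α := fun _ => Finset ℤ) p.1 p.2)
      (fun f _ => ⟨f 0, Fin.tail f⟩) ?_ ?_ ?_ ?_ ?_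
    · rintro ⟨s', f⟩ hp
      simp only [Finset.mem_sigma, Fintype.mem_piFinset] at hp ⊢
      intro i
      refine Fin.cases ?_ (fun i => ?_) i
      · simpa using hp.1
      · have := hp.2 i
        simp only [Fin.cons_succ, Fin.val_succ]
        rwa [show t + (i + 1) + 1 = t + 1 + i + 1 by omega]
    · intro f hf
      simp only [Finset.mem_sigma, Fintype.mem_piFinset] at hf ⊢
      refine ⟨by simpa using hf 0, fun i => ?_⟩
      have := hf i.succ
      simp only [Fin.val_succ] at this
      rwa [show t + 1 + i + 1 = t + (i + 1) + 1 by omega]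
    · rintro ⟨s', f⟩ _
      simp
    · intro f _
      simp
    · rintro ⟨s', f⟩ _
      rw [Fin.prod_univ_succ]
      have e1 : ∀ i : Fin rem, t + 1 + (i : ℕ) = t + ((i.succ : Fin (rem + 1)) : ℕ) := by
        intro i; rw [Fin.val_succ]; omega
      have e2 : t + 1 + rem = t + (rem + 1) := by omega
      simp only [e1, e2]
      have e3 : (Fin.last (rem + 1)) = (Fin.last rem).succ := rfl
      simp only [e3, Fin.cons_succ, Fin.castSucc_zero, Fin.cons_zero, ← Fin.succ_castSucc,
        Fin.val_zero, Nat.add_zero, mul_assoc]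

/-- The one-particle kernel of `rem` steps from time `t`, weighted at the intermediate times and at
the final time. -/
noncomputable def pathKernel : ℕ → ℕ → ℤ → ℤ → ℝ
  | 0, _, x, y => if x = y then 1 else 0
  | rem + 1, t, x, y => ∑ z ∈ X, φ t x z * h (t + 1) z * pathKernel rem (t + 1) z y

/-- A step applied to the initial condition amounts to one more step in the kernel; this drives the
induction for `configForm_eq_det`. -/
theorem sum_stepMap_mul_pathKernel (rem t : ℕ) (v : ℤ → ℝ) (y : ℤ) :
    ∑ z ∈ X, stepMap φ h X t v z * pathKernel φ h X rem (t + 1) z y =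
      ∑ x ∈ X, v x * pathKernel φ h X (rem + 1) t x y := by
  simp only [pathKernel, Finset.mul_sum]
  rw [Finset.sum_comm]
  refine Finset.sum_congr rfl fun z hz => ?_
  rw [stepMap_apply _ _ _ _ _ hz, Finset.sum_mul, Finset.sum_mul]
  exact Finset.sum_congr rfl fun x _ => by ring

include hnn in
theorem le_count_add (t rem : ℕ) : nn t ≤ nn (t + rem) := by
  induction rem with
  | zero => exact le_rfl
  | succ rem ih =>
    rw [← add_assoc, hnn, nextCount]
    split_ifs <;> omega

include hnn in
/-- The total weight of the non-intersecting configurations is a determinant of one-particle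
kernels. Here `τ i` is the time at which the `i`-th particle from the top is born. -/
theorem configForm_eq_det (τ : ℕ → ℕ) (N : ℕ) (hX : ∀ j : Fin N, packed N j ∈ X) (rem t : ℕ)
    (hN : N = nn (t + rem)) (hτ : ∀ s, t ≤ s → s < t + rem → up s → τ (nn s) = s)
    (n : ℕ) (hn : n = nn t) (v : Fin n → ℤ → ℝ) :
    configForm up φ h X rem t n v =
      Matrix.det (Matrix.of fun k j : Fin N =>
        -- Row `k` belongs to particle `N - 1 - k`, counted from 0 at the top. It is present at time
        -- `t` exactly if this number is less than `n`.
        if hk : N ≤ k + n then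
          ∑ x ∈ X, v ⟨k + n - N, by have := k.2; omega⟩ x *
            pathKernel φ h X rem t x (packed N j)
        else pathKernel φ h X (t + rem - τ (N - 1 - k)) (τ (N - 1 - k)) (packed N k)
          (packed N j)) := by
  induction rem generalizing t n with
  | zero =>
    obtain rfl : N = n := by rw [hN, hn]; rfl
    simp only [configForm]
    rw [AlternatingMap.compLinearMap_apply]
    change Matrix.det _ = _
    congr 1
    ext k j
    simp only [Matrix.of_apply]
    rw [dif_pos (by omega)]
    simp only [pathKernel, mul_ite, mul_one, mul_zero]
    rw [Finset.sum_ite_eq' X, if_pos (hX j)]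
    simp [LinearMap.funLeft]
  | succ rem ih =>
    have hle : n ≤ N := by rw [hn, hN]; exact le_count_add up hnn t (rem + 1)
    have hN' : N = nn (t + 1 + rem) := by rw [hN]; congr 1; omega
    have hle' : nn (t + 1) ≤ N := hN' ▸ le_count_add up hnn (t + 1) rem
    have hτ' : ∀ s, t + 1 ≤ s → s < t + 1 + rem → up s → τ (nn s) = s :=
      fun s hs hs' hup => hτ s (by omega) (by omega) hup
    by_cases hu : up t
    · have hn1 : n + 1 = nn (t + 1) := by rw [hnn, nextCount, if_pos hu, hn]
      simp only [configForm, if_pos hu]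
      rw [AlternatingMap.curryLeft_apply_apply, AlternatingMap.compLinearMap_apply,
        ih (t + 1) hN' hτ' (n + 1) hn1]
      congr 1
      ext k j
      simp only [Matrix.of_apply]
      have hk2 := k.2
      by_cases hk : N ≤ k + n
      · rw [dif_pos hk, dif_pos (by omega), ← sum_stepMap_mul_pathKernel]
        refine Finset.sum_congr rfl fun x _ => ?_
        congr 2
        have : (⟨k + (n + 1) - N, by omega⟩ : Fin (n + 1)) =
            (⟨k + n - N, by omega⟩ : Fin n).succ := by
          ext; simp; omega
        rw [this]
        rfl
      · rw [dif_neg hk]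
        -- The borderline row is the particle entering at time `t`: its number is `nn t` and its
        -- starting point `-n` is `packed N k`.
        by_cases hk1 : N ≤ k + (n + 1)
        · rw [dif_pos hk1, sum_stepMap_mul_pathKernel]
          have e0 : (⟨k + (n + 1) - N, by omega⟩ : Fin (n + 1)) = 0 := by
            ext; simp; omega
          rw [e0]
          have e1 : N - 1 - k = nn t := by omega
          have e2 : packed N k = -(n : ℤ) := by rw [packed]; omega
          have e3 : -(n : ℤ) ∈ X := by rw [← e2]; exact hX k
          rw [e1, hτ t le_rfl (by omega) hu, e2, show t + (rem + 1) - t = rem + 1 by omega]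
          simp [Pi.single_apply, e3]
        · rw [dif_neg hk1, show t + 1 + rem = t + (rem + 1) by omega]
    · have hn1 : n = nn (t + 1) := by rw [hnn, nextCount, if_neg hu, hn]
      simp only [configForm, if_neg hu]
      rw [AlternatingMap.compLinearMap_apply, ih (t + 1) hN' hτ' n hn1]
      congr 1
      ext k j
      simp only [Matrix.of_apply]
      by_cases hk : N ≤ k + n
      · rw [dif_pos hk, dif_pos hk, ← sum_stepMap_mul_pathKernel]
      · rw [dif_neg hk, dif_neg hk, show t + 1 + rem = t + (rem + 1) by omega]

end Forms


/-! ## The Eynard–Mehta identity -/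

section EynardMehta

/-- Multiplication by a unipotent block matrix; a solution of `D * q = C` takes the place of an
inverse of `D`. -/
theorem det_fromBlocks_of_mul_eq {m n R : Type*} [Fintype m] [Fintype n] [DecidableEq m]
    [DecidableEq n] [CommRing R] (A A' : Matrix m m R) (B : Matrix m n R) (C q : Matrix n m R)
    (D : Matrix n n R) (hA : A' = A - B * q) (hq : D * q = C) :
    (Matrix.fromBlocks A B C D).det = A'.det * D.det := by
  have h : Matrix.fromBlocks A B C D * Matrix.fromBlocks 1 0 (-q) 1 =
      Matrix.fromBlocks A' B 0 D := by
    rw [Matrix.fromBlocks_multiply]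
    congr 1
    · rw [hA]; simp [sub_eq_add_neg]
    · simp
    · simp [hq]
    · simp
  have := congrArg Matrix.det h
  rw [Matrix.det_mul, Matrix.det_fromBlocks_zero₁₂, Matrix.det_one, Matrix.det_one, mul_one,
    mul_one, Matrix.det_fromBlocks_zero₂₁] at this
  exact this

/-- The same elimination from the left. Only a solution of `Q * A = C` is used, so invertibility of
`A` need not be known. -/
theorem det_fromBlocks_of_eq_mul {m n R : Type*} [Fintype m] [Fintype n] [DecidableEq m]
    [DecidableEq n] [CommRing R] (A : Matrix m m R) (B : Matrix m n R) (C Q : Matrix n m R)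
    (D : Matrix n n R) (hC : Q * A = C) :
    (Matrix.fromBlocks A B C D).det = A.det * (D - Q * B).det := by
  have h : Matrix.fromBlocks 1 0 (-Q) 1 * Matrix.fromBlocks A B C D =
      Matrix.fromBlocks A B 0 (D - Q * B) := by
    rw [Matrix.fromBlocks_multiply]
    congr 1
    · simp
    · simp
    · simp [hC]
    · simp [sub_eq_add_neg, add_comm]
  have := congrArg Matrix.det h
  rw [Matrix.det_mul, Matrix.det_fromBlocks_zero₁₂, Matrix.det_one, Matrix.det_one, mul_one,
    one_mul, Matrix.det_fromBlocks_zero₂₁] at this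
  exact this

/-- Ordering the indices by time makes `T` strictly block triangular, so the diagonal blocks of `1 -
T` are identities. -/
theorem det_one_sub_of_time_ordered {ι R : Type*} [Fintype ι] [DecidableEq ι] [CommRing R]
    (T : Matrix ι ι R) (time : ι → ℕ) (hT : ∀ i j, ¬ time i < time j → T i j = 0) :
    (1 - T).det = 1 := by
  have hb : Matrix.BlockTriangular (1 - T) time := by
    intro i j hij
    have hne : i ≠ j := by rintro rfl; exact lt_irrefl _ hij
    rw [Matrix.sub_apply, Matrix.one_apply_ne hne, hT i j (by omega), sub_zero]
  rw [hb.det]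
  refine Finset.prod_eq_one fun a _ => ?_
  have : (1 - T).toSquareBlock time a = 1 := by
    ext i j
    simp only [Matrix.toSquareBlock_def, Matrix.of_apply, Matrix.sub_apply]
    rw [hT i j (by rw [i.2, j.2]; exact lt_irrefl _), sub_zero]
    simp only [Matrix.one_apply, Subtype.ext_iff]
  rw [this, Matrix.det_one]

variable (φ : ℕ → ℤ → ℤ → ℝ) (X : Finset ℤ) {ι : Type*} [Fintype ι] (z : ι → ℕ × ℤ) (c : ℝ)

/-- The weight `1 + c` at the points `z i`, and `1` elsewhere. -/
noncomputable def pointWeight (t : ℕ) (y : ℤ) : ℝ :=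
  1 + c * ∑ i, if z i = (t, y) then 1 else 0

/-- The kernel of the free evolution from time `s` to time `t`, zero unless `s < t`. -/
noncomputable def freeKernel (s t : ℕ) (x y : ℤ) : ℝ :=
  if s < t then pathKernel φ 1 X (t - s) s x y else 0

theorem pathKernel_one_step {X : Finset ℤ} (t : ℕ) (x : ℤ) {y : ℤ} (hy : y ∈ X) :
    pathKernel φ 1 X 1 t x y = φ t x y := by
  simp only [pathKernel, Pi.one_apply, mul_one, mul_ite, mul_zero]
  rw [Finset.sum_ite_eq' X, if_pos hy]

/-- Decomposition at the first step. A target at time `t + 1` is reached by that step alone, because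
`freeKernel` vanishes unless time strictly increases. -/
theorem freeKernel_succ {X : Finset ℤ} (t s : ℕ) (x : ℤ) {y : ℤ} (hy : y ∈ X) :
    freeKernel φ X t s x y = (if s = t + 1 then φ t x y else 0) +
      ∑ w ∈ X, φ t x w * freeKernel φ X (t + 1) s w y := by
  rcases lt_trichotomy s (t + 1) with h | h | h
  · have h1 : ¬ t < s := by omega
    have h2 : ¬ t + 1 < s := by omega
    simp [freeKernel, h1, h2, h.ne]
  · subst h
    simp [freeKernel, pathKernel_one_step φ t x hy]
  · have h1 : t < s := by omega
    simp only [freeKernel, if_pos h, if_pos h1, if_neg h.ne', zero_add]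
    obtain ⟨k, rfl⟩ : ∃ k, s = t + 1 + (k + 1) := ⟨s - t - 2, by omega⟩
    rw [show t + 1 + (k + 1) - t = (k + 1) + 1 by omega, Nat.add_sub_cancel_left]
    conv_lhs => rw [pathKernel]
    simp

/-- The Duhamel expansion of the weighted kernel. -/
theorem pathKernel_pointWeight (hX : ∀ i, (z i).2 ∈ X) (rem t : ℕ)
    (hz : ∀ i, (z i).1 ≤ t + rem) (x y : ℤ) :
    pathKernel φ (pointWeight z c) X rem t x y = pathKernel φ 1 X rem t x y +
      c * ∑ i, freeKernel φ X t (z i).1 x (z i).2 *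
        pathKernel φ (pointWeight z c) X (t + rem - (z i).1) (z i).1 (z i).2 y := by
  induction rem generalizing t x with
  | zero =>
    have : ∀ i, freeKernel φ X t (z i).1 x (z i).2 = 0 := fun i => by
      have := hz i
      exact if_neg (by omega)
    simp [this, pathKernel]
  | succ rem ih =>
    have hz' : ∀ i, (z i).1 ≤ t + 1 + rem := fun i => by have := hz i; omega
    have hT : t + (rem + 1) = t + 1 + rem := by omega
    rw [hT]
    set Q := fun (s : ℕ) (x : ℤ) => pathKernel φ (pointWeight z c) X (t + 1 + rem - s) s x y
      with hQ
    -- The weight at time `t + 1` is 1 plus `c` times indicators of test points; the second part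
    -- singles out the test points reached in one step.
    have e1 : pathKernel φ (pointWeight z c) X (rem + 1) t x y =
        ∑ w ∈ X, φ t x w * pathKernel φ (pointWeight z c) X rem (t + 1) w y +
        c * ∑ i, (if (z i).1 = t + 1 then φ t x (z i).2 else 0) * Q (z i).1 (z i).2 := by
      rw [pathKernel]
      have : ∀ w, φ t x w * pointWeight z c (t + 1) w *
          pathKernel φ (pointWeight z c) X rem (t + 1) w y =
          φ t x w * pathKernel φ (pointWeight z c) X rem (t + 1) w y +
          c * ∑ i, (if z i = (t + 1, w) then φ t x w *
            pathKernel φ (pointWeight z c) X rem (t + 1) w y else 0) := by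
        intro w
        have e : ∀ i, (if z i = (t + 1, w) then φ t x w *
            pathKernel φ (pointWeight z c) X rem (t + 1) w y else 0) =
            (φ t x w * pathKernel φ (pointWeight z c) X rem (t + 1) w y) *
              if z i = (t + 1, w) then 1 else 0 := by
          intro i; split_ifs <;> simp
        simp only [e, ← Finset.mul_sum]
        conv_lhs => rw [pointWeight]
        ring
      simp only [this, Finset.sum_add_distrib, ← Finset.mul_sum]
      congr 2
      rw [Finset.sum_comm]
      refine Finset.sum_congr rfl fun i _ => ?_
      by_cases hi : (z i).1 = t + 1
      · rw [if_pos hi, Finset.sum_eq_single (z i).2]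
        · rw [if_pos (by rw [← hi]), hQ]
          simp only [hi, Nat.add_sub_cancel_left]
        · intro w _ hw
          rw [if_neg]
          intro h
          exact hw (by rw [h])
        · intro h
          exact absurd (hX i) h
      · rw [if_neg hi, zero_mul]
        refine Finset.sum_eq_zero fun w _ => if_neg fun h => hi (by rw [h])
    rw [e1]
    have e2 : ∀ w, pathKernel φ (pointWeight z c) X rem (t + 1) w y =
        pathKernel φ 1 X rem (t + 1) w y + c * ∑ i, freeKernel φ X (t + 1) (z i).1 w (z i).2 *
          Q (z i).1 (z i).2 := fun w => ih (t + 1) hz' w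
    simp only [e2, mul_add, Finset.sum_add_distrib]
    rw [add_assoc]
    congr 1
    · simp [pathKernel]
    · have e3 : ∀ i, freeKernel φ X t (z i).1 x (z i).2 = (if (z i).1 = t + 1 then
          φ t x (z i).2 else 0) + ∑ w ∈ X, φ t x w * freeKernel φ X (t + 1) (z i).1 w (z i).2 :=
        fun i => freeKernel_succ φ t _ x (hX i)
      simp only [e3, add_mul, Finset.sum_add_distrib, mul_add, Finset.mul_sum, Finset.sum_mul]
      rw [add_comm]
      congr 1
      rw [Finset.sum_comm]
      refine Finset.sum_congr rfl fun i _ => Finset.sum_congr rfl fun w _ => by ring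

variable {φ X z c}

/-- The generating function of the occupation numbers as the determinant of a block matrix which
is polynomial in the free kernels. -/
theorem det_pathKernel_pointWeight [DecidableEq ι] {N : ℕ} (p : Fin N → ℤ) (birth : Fin N → ℕ) (T : ℕ)
    (hbirth : ∀ k, birth k ≤ T) (hX : ∀ i, (z i).2 ∈ X) (hz : ∀ i, (z i).1 < T) :
    Matrix.det (Matrix.of fun k j : Fin N =>
      pathKernel φ (pointWeight z c) X (T - birth k) (birth k) (p k) (p j)) =
    Matrix.det (Matrix.fromBlocks
      (Matrix.of fun k j : Fin N => pathKernel φ 1 X (T - birth k) (birth k) (p k) (p j))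
      (Matrix.of fun k i => -c * freeKernel φ X (birth k) (z i).1 (p k) (z i).2)
      (Matrix.of fun i j => freeKernel φ X (z i).1 T (z i).2 (p j))
      (1 - Matrix.of fun i i' => c * freeKernel φ X (z i).1 (z i').1 (z i).2 (z i').2)) := by
  symm
  have h1 := det_one_sub_of_time_ordered
    (Matrix.of fun i i' => c * freeKernel φ X (z i).1 (z i').1 (z i).2 (z i').2)
    (fun i => (z i).1) (fun i j hij => by simp [freeKernel, hij])
  -- The weighted kernels from the test points to the end solve the linear system. Both required
  -- identities are Duhamel expansions, one started at the births and one at the test points.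
  rw [det_fromBlocks_of_mul_eq _ (Matrix.of fun k j : Fin N =>
      pathKernel φ (pointWeight z c) X (T - birth k) (birth k) (p k) (p j)) _ _
    (Matrix.of fun i j => pathKernel φ (pointWeight z c) X (T - (z i).1) (z i).1 (z i).2 (p j)),
    h1, mul_one]
  · ext k j
    have hk : birth k + (T - birth k) = T := by have := hbirth k; omega
    have := pathKernel_pointWeight φ X z c hX (T - birth k) (birth k)
      (fun i => by rw [hk]; exact (hz i).le) (p k) (p j)
    rw [hk] at this
    simp only [Matrix.of_apply, Matrix.sub_apply, Matrix.mul_apply]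
    rw [this, Finset.mul_sum]
    simp only [neg_mul, Finset.sum_neg_distrib, sub_neg_eq_add, mul_assoc]
  · rw [Matrix.sub_mul, Matrix.one_mul]
    ext i j
    have hk : (z i).1 + (T - (z i).1) = T := by have := hz i; omega
    have := pathKernel_pointWeight φ X z c hX (T - (z i).1) (z i).1
      (fun i => by rw [hk]; exact (hz i).le) (z i).2 (p j)
    rw [hk] at this
    simp only [Matrix.of_apply, Matrix.sub_apply, Matrix.mul_apply]
    rw [this, Finset.mul_sum, freeKernel, if_pos (hz i)]
    simp only [mul_assoc, add_sub_cancel_right]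

end EynardMehta


/-! ## Removing the window -/

section Window

/-- The window `{-M, …, M}`. -/
noncomputable def window (M : ℕ) : Finset ℤ := Finset.Icc (-(M : ℤ)) M

theorem eventually_mem_window (x : ℤ) : ∀ᶠ M in Filter.atTop, x ∈ window M := by
  filter_upwards [Filter.eventually_ge_atTop x.natAbs] with M hM
  rw [window, Finset.mem_Icc]
  omega

/-- The translation invariant kernel of `rem` steps from time `t`, as a function of the
displacement. -/
noncomputable def convKernel (g : ℕ → ℤ → ℝ) : ℕ → ℕ → ℤ → ℝ
  | 0, _, k => if k = 0 then 1 else 0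
  | rem + 1, t, k => ∑' j, g t j * convKernel g rem (t + 1) (k - j)

variable {g : ℕ → ℤ → ℝ} (hg : ∀ t j, 0 ≤ g t j)

include hg in
theorem convKernel_nonneg (rem t : ℕ) (k : ℤ) : 0 ≤ convKernel g rem t k := by
  induction rem generalizing t k with
  | zero => rw [convKernel]; split_ifs <;> norm_num
  | succ rem ih => exact tsum_nonneg fun j => mul_nonneg (hg _ _) (ih _ _)

include hg in
theorem pathKernel_nonneg (X : Finset ℤ) (rem t : ℕ) (x y : ℤ) :
    0 ≤ pathKernel (fun t x y => g t (y - x)) 1 X rem t x y := by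
  induction rem generalizing t x with
  | zero => rw [pathKernel]; split_ifs <;> norm_num
  | succ rem ih =>
    rw [pathKernel]
    exact Finset.sum_nonneg fun w _ =>
      mul_nonneg (mul_nonneg (hg _ _) zero_le_one) (ih _ _)

variable (hsum : ∀ rem t k, Summable fun j => g t j * convKernel g rem (t + 1) (k - j))

include hsum in
theorem summable_shift (rem t : ℕ) (x y : ℤ) :
    Summable fun w => g t (w - x) * convKernel g rem (t + 1) (y - w) := by
  have := (Equiv.subRight x).summable_iff.2 (hsum rem t (y - x))
  refine this.congr fun w => ?_
  simp

theorem tsum_shift (rem t : ℕ) (x y : ℤ) :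
    ∑' w, g t (w - x) * convKernel g rem (t + 1) (y - w) = convKernel g (rem + 1) t (y - x) := by
  rw [convKernel, ←
    (Equiv.subRight x).tsum_eq (fun j => g t j * convKernel g rem (t + 1) (y - x - j))]
  refine tsum_congr fun w => ?_
  simp

include hg hsum in
theorem pathKernel_le_convKernel (X : Finset ℤ) (rem t : ℕ) (x y : ℤ) :
    pathKernel (fun t x y => g t (y - x)) 1 X rem t x y ≤ convKernel g rem t (y - x) := by
  induction rem generalizing t x with
  | zero => simp only [pathKernel, convKernel, sub_eq_zero, eq_comm, le_refl]
  | succ rem ih =>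
    rw [pathKernel, ← tsum_shift]
    refine le_trans (Finset.sum_le_sum fun w _ => ?_)
      ((summable_shift hsum rem t x y).sum_le_tsum X
        fun w _ => mul_nonneg (hg _ _) (convKernel_nonneg hg _ _ _))
    simpa using mul_le_mul_of_nonneg_left (ih (t + 1) w) (hg t (w - x))

include hg hsum in
-- Dominated convergence, one step at a time: the windowed kernel omits nonnegative terms, so the
-- full convolution dominates it.
theorem tendsto_pathKernel (rem t : ℕ) (x y : ℤ) :
    Filter.Tendsto (fun M => pathKernel (fun t x y => g t (y - x)) 1 (window M) rem t x y)
      Filter.atTop (nhds (convKernel g rem t (y - x))) := by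
  induction rem generalizing t x with
  | zero =>
    simp only [pathKernel, convKernel, sub_eq_zero, eq_comm]
    exact tendsto_const_nhds
  | succ rem ih =>
    rw [← tsum_shift]
    have : ∀ M, pathKernel (fun t x y => g t (y - x)) 1 (window M) (rem + 1) t x y =
        ∑' w, if w ∈ window M then g t (w - x) *
          pathKernel (fun t x y => g t (y - x)) 1 (window M) rem (t + 1) w y else 0 := by
      intro M
      rw [pathKernel, tsum_eq_sum (s := window M)]
      · refine Finset.sum_congr rfl fun w hw => ?_
        rw [if_pos hw]
        simp
      · intro w hw
        exact if_neg hw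
    simp only [this]
    refine tendsto_tsum_of_dominated_convergence (summable_shift hsum rem t x y) ?_ ?_
    · intro w
      refine ((ih (t + 1) w).const_mul (g t (w - x))).congr' ?_
      filter_upwards [eventually_mem_window w] with M hM
      rw [if_pos hM]
    · refine Filter.Eventually.of_forall fun M w => ?_
      split_ifs
      · rw [Real.norm_of_nonneg (mul_nonneg (hg _ _) (pathKernel_nonneg hg _ _ _ _ _))]
        exact mul_le_mul_of_nonneg_left (pathKernel_le_convKernel hg hsum _ _ _ _ _) (hg _ _)
      · rw [norm_zero]
        exact mul_nonneg (hg _ _) (convKernel_nonneg hg _ _ _)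

/-- The transition kernel from time `s` to time `t`, zero unless `s < t`. -/
noncomputable def transKernel (g : ℕ → ℤ → ℝ) (s t : ℕ) (x y : ℤ) : ℝ :=
  if s < t then convKernel g (t - s) s (y - x) else 0

include hg hsum in
theorem tendsto_freeKernel (s t : ℕ) (x y : ℤ) :
    Filter.Tendsto (fun M => freeKernel (fun t x y => g t (y - x)) (window M) s t x y)
      Filter.atTop (nhds (transKernel g s t x y)) := by
  simp only [freeKernel, transKernel]
  split_ifs
  · exact tendsto_pathKernel hg hsum _ _ _ _
  · exact tendsto_const_nhds

include hg hsum in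
-- As soon as the window contains the test points, the determinant equals a block determinant of
-- fixed size, and each entry of that converges.
theorem tendsto_det_pathKernel_pointWeight {ι : Type*} [Fintype ι] [DecidableEq ι]
    (z : ι → ℕ × ℤ) (c : ℝ) {N : ℕ} (p : Fin N → ℤ) (birth : Fin N → ℕ) (T : ℕ)
    (hbirth : ∀ k, birth k ≤ T) (hz : ∀ i, (z i).1 < T) :
    Filter.Tendsto (fun M => Matrix.det (Matrix.of fun k j : Fin N =>
      pathKernel (fun t x y => g t (y - x)) (pointWeight z c) (window M) (T - birth k) (birth k)
        (p k) (p j))) Filter.atTop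
    (nhds (Matrix.det (Matrix.fromBlocks
      (Matrix.of fun k j : Fin N => convKernel g (T - birth k) (birth k) (p j - p k))
      (Matrix.of fun k i => -c * transKernel g (birth k) (z i).1 (p k) (z i).2)
      (Matrix.of fun i j => transKernel g (z i).1 T (z i).2 (p j))
      (1 - Matrix.of fun i i' => c * transKernel g (z i).1 (z i').1 (z i).2 (z i').2)))) := by
  have hev : ∀ᶠ M in Filter.atTop, ∀ i, (z i).2 ∈ window M :=
    Filter.eventually_all.2 fun i => eventually_mem_window _
  have hfree := fun s t x y => tendsto_freeKernel hg hsum s t x y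
  refine Filter.Tendsto.congr' (f₁ := fun M => Matrix.det (Matrix.fromBlocks
      (Matrix.of fun k j : Fin N => pathKernel (fun t x y => g t (y - x)) 1 (window M)
        (T - birth k) (birth k) (p k) (p j))
      (Matrix.of fun k i => -c * freeKernel (fun t x y => g t (y - x)) (window M) (birth k)
        (z i).1 (p k) (z i).2)
      (Matrix.of fun i j => freeKernel (fun t x y => g t (y - x)) (window M) (z i).1 T
        (z i).2 (p j))
      (1 - Matrix.of fun i i' => c * freeKernel (fun t x y => g t (y - x)) (window M) (z i).1
        (z i').1 (z i).2 (z i').2))) ?_ ?_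
  · filter_upwards [hev] with M hM
    rw [det_pathKernel_pointWeight p birth T hbirth hM hz]
  · refine ((Continuous.matrix_det continuous_id).tendsto _).comp ?_
    refine tendsto_pi_nhds.2 fun a => tendsto_pi_nhds.2 fun b => ?_
    rcases a with k | i <;> rcases b with j | i'
    · simpa using tendsto_pathKernel hg hsum _ _ _ _
    · simpa using (hfree _ _ _ _).const_mul c |>.neg
    · simpa using hfree _ _ _ _
    · simpa using ((hfree _ _ _ _).const_mul c).const_sub _

end Window


/-! ## Circle averages -/

section CircleAverages

open Real Metric

theorem circleAverage_comp_inv (f : ℂ → ℂ) (ρ : ℝ) :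
    circleAverage (fun z => f z⁻¹) 0 ρ⁻¹ = circleAverage f 0 ρ := by
  rw [circleAverage_eq_circleAverage_zero_one, circleAverage_eq_circleAverage_zero_one (R := ρ),
    ← circleAverage_zero_one_congr_inv (f := fun z => f (ρ * z + 0))]
  congr 1
  funext z
  simp [mul_comm]

/-- A circle average is (2πi)⁻¹ ∮ f(z) dz/z, so the circle may be moved through a region where `f`
is analytic. -/
theorem circleAverage_eq_of_annulus {f : ℂ → ℂ} {ρ ρ' : ℝ} (h0 : 0 < ρ) (hle : ρ ≤ ρ')
    (hf : ∀ z : ℂ, ρ ≤ ‖z‖ → ‖z‖ ≤ ρ' → DifferentiableAt ℂ f z) :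
    circleAverage f 0 ρ' = circleAverage f 0 ρ := by
  rw [circleAverage_eq_circleIntegral h0.ne', circleAverage_eq_circleIntegral (h0.trans_le hle).ne']
  congr 1
  refine Complex.circleIntegral_sub_center_inv_smul_eq_of_differentiable_on_annulus_off_countable
    h0 hle Set.countable_empty ?_ ?_
  · intro z hz
    simp only [Set.mem_sdiff, mem_closedBall, dist_zero_right, mem_ball, not_lt] at hz
    exact (hf z hz.2 hz.1).continuousAt.continuousWithinAt
  · intro z hz
    simp only [Set.mem_sdiff, mem_closedBall, dist_zero_right, mem_ball, not_le] at hz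
    exact hf z hz.1.2.le hz.1.1.le

theorem circleAverage_zpow (k : ℤ) {ρ : ℝ} (hρ : 0 < ρ) :
    circleAverage (fun z : ℂ => z ^ k) 0 ρ = if k = 0 then 1 else 0 := by
  split_ifs with h
  · subst h
    simp [circleAverage_const]
  · rw [circleAverage_eq_circleIntegral hρ.ne']
    have := circleIntegral.integral_sub_zpow_of_ne (n := k - 1) (by omega) 0 0 ρ
    rw [circleIntegral.integral_congr hρ.le (g := fun z : ℂ => (z - 0) ^ (k - 1)), this, smul_zero]
    intro z hz
    have hz0 : z ≠ 0 := by
      rintro rfl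
      simp at hz
      exact hρ.ne hz
    simp only [sub_zero, smul_eq_mul]
    rw [zpow_sub_one₀ hz0, mul_comm]

/-- Mean value property: the average is the value at 0, which the positive power of `z` annihilates.
-/
theorem circleAverage_eq_zero_of_differentiableOn {g : ℂ → ℂ} {ρ R : ℝ} (h0 : 0 < ρ) (hR : ρ < R)
    (hg : DifferentiableOn ℂ g (ball 0 R)) {k : ℤ} (hk : 1 ≤ k) :
    circleAverage (fun z => z ^ k * g z) 0 ρ = 0 := by
  obtain ⟨n, rfl⟩ : ∃ n : ℕ, k = n + 1 := ⟨(k - 1).toNat, by omega⟩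
  have hd : DifferentiableOn ℂ (fun z : ℂ => z ^ ((n : ℤ) + 1) * g z) (ball 0 R) := by
    refine DifferentiableOn.mul ?_ hg
    have : (fun z : ℂ => z ^ ((n : ℤ) + 1)) = fun z => z ^ (n + 1) := by
      funext z; exact_mod_cast zpow_natCast z (n + 1)
    rw [this]
    fun_prop
  have h1 : DiffContOnCl ℂ (fun z : ℂ => z ^ ((n : ℤ) + 1) * g z) (ball 0 |ρ|) :=
    hd.diffContOnCl_ball (by rw [abs_of_pos h0]; exact closedBall_subset_ball hR)
  rw [h1.circleAverage]
  have : ((n : ℤ) + 1) ≠ 0 := by omega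
  simp [zero_zpow _ this]

theorem hasSum_circleAverage {ι : Type*} [Countable ι] {F : ι → ℂ → ℂ} {f : ℂ → ℂ} {ρ : ℝ}
    (hρ : 0 ≤ ρ) (u : ι → ℝ) (hu : Summable u) (hF : ∀ i, ContinuousOn (F i) (sphere 0 ρ))
    (hb : ∀ i, ∀ z ∈ sphere (0 : ℂ) ρ, ‖F i z‖ ≤ u i)
    (hs : ∀ z ∈ sphere (0 : ℂ) ρ, HasSum (fun i => F i z) (f z)) :
    HasSum (fun i => circleAverage (F i) 0 ρ) (circleAverage f 0 ρ) := by
  have hm : ∀ θ, circleMap 0 ρ θ ∈ sphere (0 : ℂ) ρ := fun θ => circleMap_mem_sphere 0 hρ θ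
  refine HasSum.const_smul _ ?_
  refine intervalIntegral.hasSum_integral_of_dominated_convergence (fun i _ => u i) ?_ ?_ ?_ ?_ ?_
  · intro i
    have : Continuous fun θ => F i (circleMap 0 ρ θ) :=
      (hF i).comp_continuous (continuous_circleMap 0 ρ) hm
    exact this.aestronglyMeasurable
  · exact fun i => Filter.Eventually.of_forall fun θ _ => hb i _ (hm θ)
  · exact Filter.Eventually.of_forall fun θ _ => hu
  · exact intervalIntegrable_const
  · exact Filter.Eventually.of_forall fun θ _ => hs _ (hm θ)

theorem circleAverage_swap {H : ℂ → ℂ → ℂ} {ρ ρ' : ℝ} (hρ : 0 ≤ ρ) (hρ' : 0 ≤ ρ')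
    (hH : ContinuousOn (fun p : ℂ × ℂ => H p.1 p.2) (sphere 0 ρ ×ˢ sphere 0 ρ')) :
    circleAverage (fun z => circleAverage (fun w => H z w) 0 ρ') 0 ρ =
      circleAverage (fun w => circleAverage (fun z => H z w) 0 ρ) 0 ρ' := by
  have hcont : Continuous fun p : ℝ × ℝ => H (circleMap 0 ρ p.1) (circleMap 0 ρ' p.2) := by
    refine hH.comp_continuous (f := fun p : ℝ × ℝ => (circleMap 0 ρ p.1, circleMap 0 ρ' p.2))
      (by fun_prop) fun p => ⟨circleMap_mem_sphere 0 hρ _, circleMap_mem_sphere 0 hρ' _⟩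
  simp only [circleAverage]
  rw [intervalIntegral.integral_smul, intervalIntegral.integral_smul]
  congr 2
  have hpi : (0 : ℝ) ≤ 2 * π := by positivity
  simp only [intervalIntegral.integral_of_le hpi]
  refine integral_integral_swap (f := fun θ θ' => H (circleMap 0 ρ θ) (circleMap 0 ρ' θ')) ?_
  rw [Measure.prod_restrict]
  have hK : IsCompact (Set.Icc (0 : ℝ) (2 * π) ×ˢ Set.Icc (0 : ℝ) (2 * π)) :=
    isCompact_Icc.prod isCompact_Icc
  exact (hcont.continuousOn.integrableOn_compact hK).mono_set
    (Set.prod_mono Set.Ioc_subset_Icc_self Set.Ioc_subset_Icc_self)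

/-- This average is the Cauchy integral of `f`, which has a power series in the disc even if `f` is
merely continuous on the circle. -/
theorem differentiableOn_cauchy_transform {f : ℂ → ℂ} {R : ℝ} (hR : 0 < R)
    (hf : ContinuousOn f (sphere 0 R)) :
    DifferentiableOn ℂ (fun w => circleAverage (fun z => f z * (z / (z - w))) 0 R) (ball 0 R) := by
  lift R to ℝ≥0 using hR.le
  have h := hasFPowerSeriesOn_cauchy_integral (hf.circleIntegrable hR.le) (by exact_mod_cast hR)
  have hd := h.differentiableOn
  rw [eball_coe] at hd
  refine hd.congr fun w hw => ?_
  rw [circleAverage_eq_circleIntegral hR.ne']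
  congr 1
  refine circleIntegral.integral_congr hR.le fun z hz => ?_
  have hz0 : z ≠ 0 := by
    rintro rfl
    simp at hz
    exact hR.ne hz
  simp only [smul_eq_mul, sub_zero]
  field_simp

end CircleAverages


/-! ## Symbols of the transition kernels -/

section Symbols

open Real Metric

variable (up : ℕ → Prop) (c : ℕ → ℝ)

/-- The radii of the circles on which all the symbols are analytic. -/
structure Admissible (ρ : ℝ) : Prop where
  pos : 0 < ρ
  up_lt : ∀ t, up t → c t < ρ
  down_lt : ∀ t, ¬ up t → c t * ρ < 1

variable {up c}

theorem Admissible.between {ρ ρ' σ : ℝ} (hc : ∀ t, 0 ≤ c t) (h : Admissible up c ρ)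
    (h' : Admissible up c ρ') (h1 : ρ ≤ σ) (h2 : σ ≤ ρ') : Admissible up c σ where
  pos := h.pos.trans_le h1
  up_lt t ht := (h.up_lt t ht).trans_le h1
  down_lt t ht := (mul_le_mul_of_nonneg_left h2 (hc t)).trans_lt (h'.down_lt t ht)

theorem Admissible.norm_div_lt (hc : ∀ t, 0 ≤ c t) {z : ℂ} (hz : Admissible up c ‖z‖) {t : ℕ}
    (ht : up t) : ‖(c t : ℂ) / z‖ < 1 := by
  rw [norm_div, Complex.norm_of_nonneg (hc t), div_lt_one hz.pos]
  exact hz.up_lt t ht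

theorem Admissible.norm_mul_lt (hc : ∀ t, 0 ≤ c t) {z : ℂ} (hz : Admissible up c ‖z‖) {t : ℕ}
    (ht : ¬ up t) : ‖(c t : ℂ) * z‖ < 1 := by
  rw [norm_mul, Complex.norm_of_nonneg (hc t)]
  exact hz.down_lt t ht

theorem Admissible.ne_zero {z : ℂ} (hz : Admissible up c ‖z‖) : z ≠ 0 := norm_pos_iff.1 hz.pos

theorem admissible_one (hc1 : ∀ t, c t < 1) : Admissible up c 1 where
  pos := one_pos
  up_lt t _ := hc1 t
  down_lt t _ := by rw [mul_one]; exact hc1 t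

variable [DecidablePred up]

variable (up c) in
/-- The distribution of the displacement in the step `t`: geometric with parameter `c t`, to the
right in an up-step and to the left otherwise. -/
noncomputable def stepCoef (t : ℕ) (j : ℤ) : ℝ :=
  if up t then if 0 ≤ j then (1 - c t) * c t ^ j.toNat else 0
  else if j ≤ 0 then (1 - c t) * c t ^ (-j).toNat else 0

variable (up c) in
/-- The symbol of the step `t`. -/
noncomputable def symb (t : ℕ) (z : ℂ) : ℂ :=
  if up t then (1 - c t) / (1 - c t / z) else (1 - c t) / (1 - c t * z)

variable (up c) in
/-- The symbol of the transition from time `s` to time `t`. -/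
noncomputable def symbProd (s t : ℕ) (z : ℂ) : ℂ := ∏ u ∈ Finset.Ico s t, symb up c u z

theorem stepCoef_nonneg (hc : ∀ t, 0 ≤ c t) (hc1 : ∀ t, c t < 1) (t : ℕ) (j : ℤ) :
    0 ≤ stepCoef up c t j := by
  have h1 := sub_nonneg.2 (hc1 t).le
  have h2 := hc t
  rw [stepCoef]
  split_ifs <;> positivity

theorem one_sub_ne_zero_of_norm_lt {w : ℂ} (h : ‖w‖ < 1) : 1 - w ≠ 0 := by
  intro h0
  rw [sub_eq_zero] at h0
  rw [← h0, norm_one] at h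
  exact lt_irrefl _ h

theorem one_sub_ofReal_ne_zero (hc1 : ∀ t, c t < 1) (t : ℕ) : (1 - c t : ℂ) ≠ 0 := by
  have := hc1 t
  exact_mod_cast (sub_pos.2 this).ne'

theorem differentiableAt_symb (hc : ∀ t, 0 ≤ c t) {z : ℂ} (hz : Admissible up c ‖z‖) (t : ℕ) :
    DifferentiableAt ℂ (symb up c t) z := by
  have h0 := hz.ne_zero
  by_cases ht : up t
  · have h1 := one_sub_ne_zero_of_norm_lt (hz.norm_div_lt hc ht)
    have : symb up c t = fun z => (1 - c t : ℂ) / (1 - c t / z) := by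
      funext z; exact if_pos ht
    rw [this]
    fun_prop (disch := assumption)
  · have h1 := one_sub_ne_zero_of_norm_lt (hz.norm_mul_lt hc ht)
    have : symb up c t = fun z => (1 - c t : ℂ) / (1 - c t * z) := by
      funext z; exact if_neg ht
    rw [this]
    fun_prop (disch := assumption)

theorem symb_ne_zero (hc : ∀ t, 0 ≤ c t) (hc1 : ∀ t, c t < 1) {z : ℂ}
    (hz : Admissible up c ‖z‖) (t : ℕ) : symb up c t z ≠ 0 := by
  rw [symb]
  split_ifs with ht
  · exact div_ne_zero (one_sub_ofReal_ne_zero hc1 t)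
      (one_sub_ne_zero_of_norm_lt (hz.norm_div_lt hc ht))
  · exact div_ne_zero (one_sub_ofReal_ne_zero hc1 t)
      (one_sub_ne_zero_of_norm_lt (hz.norm_mul_lt hc ht))

theorem differentiableAt_symbProd (hc : ∀ t, 0 ≤ c t) {z : ℂ} (hz : Admissible up c ‖z‖)
    (s t : ℕ) : DifferentiableAt ℂ (symbProd up c s t) z := by
  have : symbProd up c s t = fun z => ∏ u ∈ Finset.Ico s t, symb up c u z := rfl
  rw [this]
  exact DifferentiableAt.fun_finsetProd fun u _ => differentiableAt_symb hc hz u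

theorem continuousOn_zpow_mul_symbProd (hc : ∀ t, 0 ≤ c t) {ρ : ℝ} (hρ : Admissible up c ρ)
    (k : ℤ) (s t : ℕ) :
    ContinuousOn (fun z => z ^ k * symbProd up c s t z) (sphere 0 ρ) := by
  intro z hz
  have hz' : Admissible up c ‖z‖ := by rwa [mem_sphere_zero_iff_norm.1 hz]
  exact ((differentiableAt_zpow.2 (Or.inl hz'.ne_zero)).continuousAt.mul
    (differentiableAt_symbProd hc hz' s t).continuousAt).continuousWithinAt

theorem circleAverage_symbProd_eq (hc : ∀ t, 0 ≤ c t) {ρ ρ' : ℝ} (hρ : Admissible up c ρ)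
    (hρ' : Admissible up c ρ') (k : ℤ) (s t : ℕ) :
    circleAverage (fun z => z ^ k * symbProd up c s t z) 0 ρ =
      circleAverage (fun z => z ^ k * symbProd up c s t z) 0 ρ' := by
  have key : ∀ {ρ ρ' : ℝ}, Admissible up c ρ → Admissible up c ρ' → ρ ≤ ρ' →
      circleAverage (fun z => z ^ k * symbProd up c s t z) 0 ρ' =
        circleAverage (fun z => z ^ k * symbProd up c s t z) 0 ρ := by
    intro ρ ρ' hρ hρ' hle
    refine circleAverage_eq_of_annulus hρ.pos hle fun z h1 h2 => ?_
    have hz := hρ.between hc hρ' h1 h2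
    exact (differentiableAt_zpow.2 (Or.inl hz.ne_zero)).mul (differentiableAt_symbProd hc hz s t)
  rcases le_total ρ ρ' with h | h
  · exact (key hρ hρ' h).symm
  · exact key hρ' hρ h

theorem symbProd_succ_left {s t : ℕ} (h : s < t) (z : ℂ) :
    symbProd up c s t z = symb up c s z * symbProd up c (s + 1) t z := by
  rw [symbProd, Finset.prod_eq_prod_Ico_succ_bot h]
  rfl

theorem symbProd_self (s : ℕ) (z : ℂ) : symbProd up c s s z = 1 := by simp [symbProd]

theorem hasSum_int_of_nat {f : ℤ → ℂ} {a : ℂ} {e : ℕ → ℤ} (he : Function.Injective e)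
    (h0 : ∀ j, j ∉ Set.range e → f j = 0) (h : HasSum (fun n => f (e n)) a) : HasSum f a :=
  (he.hasSum_iff h0).1 h

theorem hasSum_stepCoef (hc : ∀ t, 0 ≤ c t) {z : ℂ} (hz : Admissible up c ‖z‖) (t : ℕ) :
    HasSum (fun j : ℤ => (stepCoef up c t j : ℂ) * z ^ (-j)) (symb up c t z) := by
  by_cases ht : up t
  · have hsum := (hasSum_geometric_of_norm_lt_one (hz.norm_div_lt hc ht)).mul_left (1 - c t : ℂ)
    have e : symb up c t z = (1 - c t : ℂ) * (1 - c t / z)⁻¹ := by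
      rw [symb, if_pos ht, div_eq_mul_inv]
    rw [e]
    refine hasSum_int_of_nat (e := fun n : ℕ => (n : ℤ)) Nat.cast_injective ?_ ?_
    · intro j hj
      have : ¬ 0 ≤ j := fun h => hj ⟨j.toNat, by simp [h]⟩
      simp [stepCoef, ht, this]
    · refine Eq.subst (motive := fun f => HasSum f _) (funext fun n => ?_) hsum
      simp only [stepCoef, if_pos ht, if_pos (Int.natCast_nonneg n), Int.toNat_natCast, zpow_neg,
        zpow_natCast]
      push_cast
      rw [div_pow, div_eq_mul_inv, mul_assoc]
  · have hsum := (hasSum_geometric_of_norm_lt_one (hz.norm_mul_lt hc ht)).mul_left (1 - c t : ℂ)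
    have e : symb up c t z = (1 - c t : ℂ) * (1 - c t * z)⁻¹ := by
      rw [symb, if_neg ht, div_eq_mul_inv]
    rw [e]
    refine hasSum_int_of_nat (e := fun n : ℕ => -(n : ℤ))
      (neg_injective.comp Nat.cast_injective) ?_ ?_
    · intro j hj
      have : ¬ j ≤ 0 := fun h => hj ⟨(-j).toNat, by simp only; omega⟩
      simp [stepCoef, ht, this]
    · refine Eq.subst (motive := fun f => HasSum f _) (funext fun n => ?_) hsum
      have h0 : -(n : ℤ) ≤ 0 := by omega
      simp only [stepCoef, if_neg ht, if_pos h0, neg_neg, Int.toNat_natCast, zpow_natCast]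
      push_cast
      rw [mul_pow, mul_assoc]

theorem summable_stepCoef (hc : ∀ t, 0 ≤ c t) (hc1 : ∀ t, c t < 1) (t : ℕ) :
    Summable (stepCoef up c t) := by
  have h := (hasSum_stepCoef (up := up) hc (z := 1) (by rw [norm_one]; exact admissible_one hc1)
    t).summable
  simp only [one_zpow, mul_one] at h
  exact_mod_cast h

/-- On the unit circle the first symbol is an absolutely convergent Laurent series whose
coefficients are the jump probabilities; it is integrated termwise. -/
theorem hasSum_circleAverage_symbProd (hc : ∀ t, 0 ≤ c t) (hc1 : ∀ t, c t < 1) {s t : ℕ}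
    (hst : s < t) (k : ℤ) :
    HasSum (fun j : ℤ => (stepCoef up c s j : ℂ) *
      circleAverage (fun z => z ^ (k - j) * symbProd up c (s + 1) t z) 0 1)
      (circleAverage (fun z => z ^ k * symbProd up c s t z) 0 1) := by
  have hadm : ∀ z ∈ sphere (0 : ℂ) 1, Admissible up c ‖z‖ := fun z hz => by
    rw [mem_sphere_zero_iff_norm.1 hz]; exact admissible_one hc1
  have hcont := continuousOn_zpow_mul_symbProd hc (admissible_one (up := up) hc1) 0 (s + 1) t
  obtain ⟨C, hC⟩ := (isCompact_sphere (0 : ℂ) 1).exists_bound_of_continuousOn hcont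
  have hmul : ∀ j : ℤ, (stepCoef up c s j : ℂ) *
      circleAverage (fun z => z ^ (k - j) * symbProd up c (s + 1) t z) 0 1 =
      circleAverage (fun z => (stepCoef up c s j : ℂ) *
        (z ^ (k - j) * symbProd up c (s + 1) t z)) 0 1 := fun j =>
    (circleAverage_fun_smul (𝕜 := ℂ) (a := (stepCoef up c s j : ℂ))).symm
  simp only [hmul]
  refine hasSum_circleAverage zero_le_one (fun j => stepCoef up c s j * C)
    ((summable_stepCoef hc hc1 s).mul_right C) ?_ ?_ ?_
  · exact fun j => continuousOn_const.mul
      (continuousOn_zpow_mul_symbProd hc (admissible_one hc1) _ _ _)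
  · intro j z hz
    have h1 := hC z hz
    rw [zpow_zero, one_mul] at h1
    rw [norm_mul, norm_mul, norm_zpow, mem_sphere_zero_iff_norm.1 hz, one_zpow, one_mul,
      Complex.norm_of_nonneg (stepCoef_nonneg hc hc1 _ _)]
    exact mul_le_mul_of_nonneg_left h1 (stepCoef_nonneg hc hc1 _ _)
  · intro z hz
    have h1 := (hasSum_stepCoef hc (hadm z hz) s).mul_right (z ^ k * symbProd up c (s + 1) t z)
    rw [symbProd_succ_left hst]
    rw [mul_left_comm]
    refine Eq.subst (motive := fun f => HasSum f _) (funext fun j => ?_) h1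
    rw [sub_eq_neg_add, zpow_add₀ (hadm z hz).ne_zero]
    ring

/-- Convolution of jump laws is multiplication of symbols, and the kernel is read off as a Fourier
coefficient. -/
theorem convKernel_stepCoef (hc : ∀ t, 0 ≤ c t) (hc1 : ∀ t, c t < 1) (rem t : ℕ) (k : ℤ) :
    (convKernel (stepCoef up c) rem t k : ℂ) =
      circleAverage (fun z => z ^ k * symbProd up c t (t + rem) z) 0 1 := by
  induction rem generalizing t k with
  | zero =>
    simp only [convKernel, Nat.add_zero, symbProd_self, mul_one]
    rw [circleAverage_zpow k one_pos]
    split_ifs <;> simp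
  | succ rem ih =>
    have h := hasSum_circleAverage_symbProd (up := up) hc hc1
      (show t < t + (rem + 1) by omega) k
    rw [← h.tsum_eq, convKernel, Complex.ofReal_tsum]
    refine tsum_congr fun j => ?_
    rw [Complex.ofReal_mul, ih, show t + 1 + rem = t + (rem + 1) by omega]

theorem summable_convKernel_stepCoef (hc : ∀ t, 0 ≤ c t) (hc1 : ∀ t, c t < 1) (rem t : ℕ) (k : ℤ) :
    Summable fun j => stepCoef up c t j * convKernel (stepCoef up c) rem (t + 1) (k - j) := by
  have h := (hasSum_circleAverage_symbProd (up := up) hc hc1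
      (show t < t + (rem + 1) by omega) k).summable
  rw [← Complex.summable_ofReal]
  refine h.congr fun j => ?_
  rw [Complex.ofReal_mul, convKernel_stepCoef hc hc1, show t + 1 + rem = t + (rem + 1) by omega]

end Symbols


/-! ## The double contour integral -/

section DoubleContour

open Real Metric

theorem exists_dslope {g : ℂ → ℂ} {R : ℝ} {a : ℂ} (ha : ‖a‖ < R)
    (hg : DifferentiableOn ℂ g (ball 0 R)) :
    ∃ h : ℂ → ℂ, DifferentiableOn ℂ h (ball 0 R) ∧ ∀ w, g w = g a + (w - a) * h w := by
  refine ⟨dslope g a, (Complex.differentiableOn_dslope (isOpen_ball.mem_nhds (by simpa))).2 hg,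
    fun w => ?_⟩
  have := sub_smul_dslope g a w
  rw [smul_eq_mul] at this
  rw [this]
  ring

theorem exists_taylor {g : ℂ → ℂ} {R : ℝ} (hR : 0 < R) (hg : DifferentiableOn ℂ g (ball 0 R))
    (m : ℕ) : ∃ (d : ℕ → ℂ) (h : ℂ → ℂ), DifferentiableOn ℂ h (ball 0 R) ∧
      ∀ w, g w = ∑ i ∈ Finset.range m, d i * w ^ i + w ^ m * h w := by
  induction m with
  | zero => exact ⟨0, g, hg, fun w => by simp⟩
  | succ m ih =>
    obtain ⟨d, h, hh, hd⟩ := ih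
    obtain ⟨h', hh', hd'⟩ := exists_dslope (a := 0) (by simpa) hh
    refine ⟨Function.update d m (h 0), h', hh', fun w => ?_⟩
    rw [hd, Finset.sum_range_succ, Function.update_self, hd' w]
    have : ∑ i ∈ Finset.range m, Function.update d m (h 0) i * w ^ i =
        ∑ i ∈ Finset.range m, d i * w ^ i := by
      refine Finset.sum_congr rfl fun i hi => ?_
      rw [Function.update_of_ne (Finset.mem_range.1 hi).ne]
    rw [this]
    ring

variable {up : ℕ → Prop} [DecidablePred up] {c : ℕ → ℝ}

theorem continuousOn_zpow_mul_symbProd_mul (hc : ∀ t, 0 ≤ c t) {ρ R : ℝ} (hρ : Admissible up c ρ)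
    (hR : ρ < R) {g : ℂ → ℂ} (hg : DifferentiableOn ℂ g (ball 0 R)) (k : ℤ) (s t : ℕ) :
    ContinuousOn (fun z => z ^ k * (symbProd up c s t z * g z)) (sphere 0 ρ) := by
  simp only [← mul_assoc]
  refine (continuousOn_zpow_mul_symbProd hc hρ k s t).mul (hg.continuousOn.mono ?_)
  intro z hz
  rw [mem_ball_zero_iff, mem_sphere_zero_iff_norm.1 hz]
  exact hR

/-- Expansion of the moments of an analytic function along the transition kernels of the particles
born at the times `τ i`. -/
theorem exists_moment_expansion (hc : ∀ t, 0 ≤ c t) {ρ R : ℝ}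
    (hρ : Admissible up c ρ) (hR : Admissible up c R) (hρR : ρ < R) {nn : ℕ → ℕ}
    (hnn : ∀ t, nn (t + 1) = nextCount up t (nn t)) {τ : ℕ → ℕ} (hτ0 : ∀ i < nn 0, τ i = 0)
    (hτ : ∀ t, up t → τ (nn t) = t) {g : ℂ → ℂ} (hg : DifferentiableOn ℂ g (ball 0 R)) (T : ℕ) :
    ∃ d : ℕ → ℂ, ∀ s ≤ T, ∀ y : ℤ, 1 ≤ y + nn s →
      circleAverage (fun w => w ^ y * (symbProd up c 0 s w * g w)) 0 ρ =
        ∑ i ∈ Finset.range (nn s), d i *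
          circleAverage (fun w => w ^ (y + i) * symbProd up c (τ i) s w) 0 ρ := by
  have hint : ∀ {h : ℂ → ℂ}, DifferentiableOn ℂ h (ball 0 R) → ∀ (k : ℤ) (s t : ℕ),
      CircleIntegrable (fun z => z ^ k * (symbProd up c s t z * h z)) 0 ρ := fun hh k s t =>
    (continuousOn_zpow_mul_symbProd_mul hc hρ hρR hh k s t).circleIntegrable hρ.pos.le
  have hint' : ∀ (k : ℤ) (s t : ℕ), CircleIntegrable (fun z => z ^ k * symbProd up c s t z) 0 ρ :=
    fun k s t => (continuousOn_zpow_mul_symbProd hc hρ k s t).circleIntegrable hρ.pos.le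
  have hconst : ∀ (a : ℂ) (k : ℤ) (s t : ℕ),
      CircleIntegrable (fun z => a * (z ^ k * symbProd up c s t z)) 0 ρ := fun a k s t =>
    (hint' k s t).const_fun_smul (a := a)
  have hsphere : ∀ z ∈ sphere (0 : ℂ) |ρ|, Admissible up c ‖z‖ := fun z hz => by
    rw [abs_of_pos hρ.pos] at hz
    rwa [mem_sphere_zero_iff_norm.1 hz]
  -- Induction on time with a remainder: after the particles born before `t` have been split off, an
  -- analytic function times `w ^ nn t` and the symbols from `t` on is left.
  suffices H : ∀ t, ∃ (d : ℕ → ℂ) (h : ℂ → ℂ), DifferentiableOn ℂ h (ball 0 R) ∧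
      (∀ s < t, ∀ y : ℤ, 1 ≤ y + nn s →
        circleAverage (fun w => w ^ y * (symbProd up c 0 s w * g w)) 0 ρ =
        ∑ i ∈ Finset.range (nn s), d i *
          circleAverage (fun w => w ^ (y + i) * symbProd up c (τ i) s w) 0 ρ) ∧
      ∀ s ≥ t, ∀ y : ℤ,
        circleAverage (fun w => w ^ y * (symbProd up c 0 s w * g w)) 0 ρ =
        ∑ i ∈ Finset.range (nn t), d i *
          circleAverage (fun w => w ^ (y + i) * symbProd up c (τ i) s w) 0 ρ +
        circleAverage (fun w => w ^ (y + nn t) * (symbProd up c t s w * h w)) 0 ρ by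
    obtain ⟨d, h, _, hd, _⟩ := H (T + 1)
    exact ⟨d, fun s hs => hd s (by omega)⟩
  intro t
  induction t with
  | zero =>
    -- The first `nn 0` Taylor coefficients of `g` belong to the particles present from the
    -- beginning, particle `i` starting at `-i`.
    obtain ⟨d, h, hh, hd⟩ := exists_taylor hR.pos hg (nn 0)
    refine ⟨d, h, hh, fun s hs => absurd hs (Nat.not_lt_zero s), fun s _ y => ?_⟩
    have e : ∀ i ∈ Finset.range (nn 0), d i *
        circleAverage (fun w => w ^ (y + i) * symbProd up c (τ i) s w) 0 ρ =
        circleAverage (fun w => d i * (w ^ (y + i) * symbProd up c 0 s w)) 0 ρ := by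
      intro i hi
      rw [hτ0 i (Finset.mem_range.1 hi)]
      exact (circleAverage_fun_smul (𝕜 := ℂ) (a := d i)).symm
    rw [Finset.sum_congr rfl e, ← circleAverage_fun_sum
      (fun i _ => hconst _ _ _ _), ← circleAverage_fun_add
      (CircleIntegrable.fun_sum _ fun i _ => hconst _ _ _ _) (hint hh _ _ _)]
    refine circleAverage_congr_sphere fun w hw => ?_
    have hw0 := (hsphere w hw).ne_zero
    simp only [hd w, mul_add, Finset.mul_sum]
    congr 1
    · refine Finset.sum_congr rfl fun i _ => ?_
      rw [zpow_add₀ hw0, zpow_natCast]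
      ring
    · rw [zpow_add₀ hw0, zpow_natCast]
      ring
  | succ t ih =>
    obtain ⟨d, h, hh, hd1, hd2⟩ := ih
    -- At `s = t` no symbol is left in the remainder, and a positive power of `w` times an analytic
    -- function averages to zero. This is where the lower bound on `y` enters.
    have hrem : ∀ y : ℤ, 1 ≤ y + nn t →
        circleAverage (fun w => w ^ (y + nn t) * (symbProd up c t t w * h w)) 0 ρ = 0 := by
      intro y hy
      simp only [symbProd_self, one_mul]
      exact circleAverage_eq_zero_of_differentiableOn hρ.pos hρR hh hy
    have hd1' : ∀ s < t + 1, ∀ y : ℤ, 1 ≤ y + nn s →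
        circleAverage (fun w => w ^ y * (symbProd up c 0 s w * g w)) 0 ρ =
        ∑ i ∈ Finset.range (nn s), d i *
          circleAverage (fun w => w ^ (y + i) * symbProd up c (τ i) s w) 0 ρ := by
      intro s hs y hy
      rcases Nat.lt_succ_iff_lt_or_eq.1 hs with hs | rfl
      · exact hd1 s hs y hy
      · rw [hd2 s le_rfl y, hrem y hy, add_zero]
    by_cases hu : up t
    · have hn : nn (t + 1) = nn t + 1 := by rw [hnn, nextCount, if_pos hu]
      have hca : ‖(c t : ℂ)‖ < R := by
        rw [Complex.norm_of_nonneg (hc t)]; exact hR.up_lt t hu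
      -- The symbol of an up-step has a pole at `c t`. The value of `h` there is the coefficient of
      -- the particle born now; in the rest the factor `w - c t` cancels the pole and leaves one
      -- more power of `w`, matching the growth of `nn`.
      obtain ⟨k, hk, hhk⟩ := exists_dslope hca hh
      have hup : ∀ i < nn t, Function.update d (nn t) (h (c t)) i = d i := fun i hi =>
        Function.update_of_ne hi.ne _ _
      have hmono : ∀ s ≤ t, nn s ≤ nn t := fun s hs => by
        obtain ⟨j, rfl⟩ := Nat.exists_eq_add_of_le hs
        exact le_count_add up hnn s j
      refine ⟨Function.update d (nn t) (h (c t)), fun w => (1 - c t) * k w,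
        hk.const_mul _, fun s hs y hy => ?_, fun s hs y => ?_⟩
      · rw [hd1' s hs y hy]
        refine Finset.sum_congr rfl fun i hi => ?_
        rw [hup i ((Finset.mem_range.1 hi).trans_le (hmono s (by omega)))]
      · rw [hd2 s (by omega) y, hn, Finset.sum_range_succ, Function.update_self, hτ t hu, add_assoc]
        congr 1
        · refine Finset.sum_congr rfl fun i hi => ?_
          rw [hup i (Finset.mem_range.1 hi)]
        · have e : h (c t) * circleAverage (fun w => w ^ (y + nn t) * symbProd up c t s w) 0 ρ =
              circleAverage (fun w => h (c t) * (w ^ (y + nn t) * symbProd up c t s w)) 0 ρ :=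
            (circleAverage_fun_smul (𝕜 := ℂ) (a := h (c t))).symm
          beta_reduce
          rw [e, ← circleAverage_fun_add (hconst _ _ _ _)
            (hint (h := fun w => (1 - c t) * k w) (hk.const_mul _) _ _ _)]
          refine circleAverage_congr_sphere fun w hw => ?_
          have hadm := hsphere w hw
          have hw0 := hadm.ne_zero
          have hden := one_sub_ne_zero_of_norm_lt (hadm.norm_div_lt hc hu)
          have hsy : symb up c t w * (w - c t) = w * (1 - c t) := by
            have h2 : w - c t ≠ 0 := by
              intro h0
              apply hden
              rw [sub_eq_zero] at h0
              rw [← h0, div_self hw0, sub_self]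
            rw [symb, if_pos hu]
            field_simp
          have h3 : h w = h (c t) + (w - c t) * k w := hhk w
          have e1 : symbProd up c t s w * h w = h (c t) * symbProd up c t s w +
              symb up c t w * (w - c t) * symbProd up c (t + 1) s w * k w := by
            rw [h3, symbProd_succ_left (by omega : t < s)]
            ring
          rw [e1, hsy]
          push_cast
          rw [← add_assoc, zpow_add_one₀ hw0]
          ring
    · have hn : nn (t + 1) = nn t := by rw [hnn, nextCount, if_neg hu]
      refine ⟨d, fun w => symb up c t w * h w, ?_, hd1', fun s hs y => ?_⟩
      -- The symbol of a down-step is analytic in the whole disc and is absorbed into the remainder.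
      · have hs : DifferentiableOn ℂ (symb up c t) (ball 0 R) := by
          have : symb up c t = fun z => (1 - c t : ℂ) / (1 - c t * z) := by
            funext z; exact if_neg hu
          rw [this]
          intro z hz
          have hz1 : ‖(c t : ℂ) * z‖ < 1 := by
            rw [norm_mul, Complex.norm_of_nonneg (hc t)]
            exact (mul_le_mul_of_nonneg_left (mem_ball_zero_iff.1 hz).le (hc t)).trans_lt
              (hR.down_lt t hu)
          have h1 := one_sub_ne_zero_of_norm_lt hz1
          refine DifferentiableAt.differentiableWithinAt ?_
          fun_prop (disch := assumption)
        exact hs.mul hh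
      · rw [hd2 s (by omega) y, hn]
        congr 1
        congr 1
        funext w
        rw [symbProd_succ_left (by omega : t < s)]
        ring

end DoubleContour


/-! ### The double contour kernel: expansion in particle kernels and value at the final time -/

section DoubleKernel

open Real Metric

variable (up : ℕ → Prop) [DecidablePred up] (c : ℕ → ℝ)

/-- The symbol of the step `t` if it is an up-step, and `1` otherwise. -/
noncomputable def upSymb (t : ℕ) (z : ℂ) : ℂ := if up t then (1 - c t) / (1 - c t / z) else 1

/-- The symbol of the step `t` if it is not an up-step, and `1` otherwise. -/
noncomputable def downSymb (t : ℕ) (z : ℂ) : ℂ := if up t then 1 else (1 - c t) / (1 - c t * z)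

/-- The factor of the double contour integrand that depends on the outer variable. -/
noncomputable def outerSymb (T r : ℕ) (z : ℂ) : ℂ :=
  (∏ t ∈ Finset.Ico r T, downSymb up c t z) * ∏ t ∈ Finset.Ico 0 r, (upSymb up c t z)⁻¹

/-- The factor of the double contour integrand that depends on the inner variable. -/
noncomputable def innerSymb (T s : ℕ) (w : ℂ) : ℂ :=
  (∏ t ∈ Finset.Ico 0 s, upSymb up c t w) * ∏ t ∈ Finset.Ico s T, (downSymb up c t w)⁻¹

/-- The double contour part of the correlation kernel. -/
noncomputable def doubleKernel (T : ℕ) (r₁ r₂ : ℝ) (r s : ℕ) (x y : ℤ) : ℂ :=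
  circleAverage (fun z => circleAverage (fun w =>
    w ^ y / z ^ x * (z / (z - w)) * (outerSymb up c T r z * innerSymb up c T s w)) 0 r₁) 0 r₂

variable {up c}

theorem symb_eq_mul (t : ℕ) (z : ℂ) : symb up c t z = upSymb up c t z * downSymb up c t z := by
  rw [symb, upSymb, downSymb]
  split_ifs <;> simp

theorem upSymb_ne_zero (hc : ∀ t, 0 ≤ c t) (hc1 : ∀ t, c t < 1) {z : ℂ}
    (hz : Admissible up c ‖z‖) (t : ℕ) : upSymb up c t z ≠ 0 := by
  have := symb_ne_zero hc hc1 hz t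
  rw [symb_eq_mul] at this
  exact left_ne_zero_of_mul this

theorem downSymb_ne_zero (hc : ∀ t, 0 ≤ c t) (hc1 : ∀ t, c t < 1) {z : ℂ}
    (hz : Admissible up c ‖z‖) (t : ℕ) : downSymb up c t z ≠ 0 := by
  have := symb_ne_zero hc hc1 hz t
  rw [symb_eq_mul] at this
  exact right_ne_zero_of_mul this

theorem differentiableAt_upSymb (hc : ∀ t, 0 ≤ c t) {z : ℂ}
    (hz : Admissible up c ‖z‖) (t : ℕ) : DifferentiableAt ℂ (upSymb up c t) z := by
  by_cases ht : up t
  · have : upSymb up c t = symb up c t := by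
      funext z; rw [symb_eq_mul, downSymb, if_pos ht, mul_one]
    rw [this]
    exact differentiableAt_symb hc hz t
  · have : upSymb up c t = fun _ => 1 := by funext z; exact if_neg ht
    rw [this]
    fun_prop

theorem differentiableAt_downSymb (hc : ∀ t, 0 ≤ c t) {z : ℂ}
    (hz : Admissible up c ‖z‖) (t : ℕ) : DifferentiableAt ℂ (downSymb up c t) z := by
  by_cases ht : up t
  · have : downSymb up c t = fun _ => 1 := by funext z; exact if_pos ht
    rw [this]
    fun_prop
  · have : downSymb up c t = symb up c t := by
      funext z; rw [symb_eq_mul, upSymb, if_neg ht, one_mul]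
    rw [this]
    exact differentiableAt_symb hc hz t

theorem differentiable_downSymb_inv (t : ℕ) :
    Differentiable ℂ fun z => (downSymb up c t z)⁻¹ := by
  by_cases ht : up t
  · simp [downSymb, ht]
  · simp only [downSymb, ht, if_false, inv_div]
    fun_prop

theorem continuousOn_outerSymb (hc : ∀ t, 0 ≤ c t) (hc1 : ∀ t, c t < 1) {ρ : ℝ}
    (hρ : Admissible up c ρ) (T r : ℕ) : ContinuousOn (outerSymb up c T r) (sphere 0 ρ) := by
  intro z hz
  have hz' : Admissible up c ‖z‖ := by rwa [mem_sphere_zero_iff_norm.1 hz]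
  have e : outerSymb up c T r = fun z => (∏ t ∈ Finset.Ico r T, downSymb up c t z) *
    ∏ t ∈ Finset.Ico 0 r, (upSymb up c t z)⁻¹ := rfl
  rw [e]
  refine DifferentiableAt.continuousAt (𝕜 := ℂ) ?_ |>.continuousWithinAt
  exact (DifferentiableAt.fun_finsetProd fun u _ => differentiableAt_downSymb hc hz' u).mul
    (DifferentiableAt.fun_finsetProd fun u _ =>
      (differentiableAt_upSymb hc hz' u).inv (upSymb_ne_zero hc hc1 hz' u))

theorem continuousOn_innerSymb (hc : ∀ t, 0 ≤ c t) {ρ : ℝ}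
    (hρ : Admissible up c ρ) (T s : ℕ) : ContinuousOn (innerSymb up c T s) (sphere 0 ρ) := by
  intro z hz
  have hz' : Admissible up c ‖z‖ := by rwa [mem_sphere_zero_iff_norm.1 hz]
  have e : innerSymb up c T s = fun w => (∏ t ∈ Finset.Ico 0 s, upSymb up c t w) *
    ∏ t ∈ Finset.Ico s T, (downSymb up c t w)⁻¹ := rfl
  rw [e]
  refine DifferentiableAt.continuousAt (𝕜 := ℂ) ?_ |>.continuousWithinAt
  exact (DifferentiableAt.fun_finsetProd fun u _ => differentiableAt_upSymb hc hz' u).mul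
    (DifferentiableAt.fun_finsetProd fun u _ => differentiable_downSymb_inv u z)

/-- On the diagonal the up-factors before `r` and the down-factors from `s` on cancel. This is why φ
is a transition kernel. -/
theorem outerSymb_mul_innerSymb (hc : ∀ t, 0 ≤ c t) (hc1 : ∀ t, c t < 1) {z : ℂ}
    (hz : Admissible up c ‖z‖) {T r s : ℕ} (hr : r ≤ s) (hs : s ≤ T) :
    outerSymb up c T r z * innerSymb up c T s z = symbProd up c r s z := by
  have hd : ∏ t ∈ Finset.Ico s T, downSymb up c t z ≠ 0 :=
    Finset.prod_ne_zero_iff.2 fun u _ => downSymb_ne_zero hc hc1 hz u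
  have hu : ∏ t ∈ Finset.Ico 0 r, upSymb up c t z ≠ 0 :=
    Finset.prod_ne_zero_iff.2 fun u _ => upSymb_ne_zero hc hc1 hz u
  rw [outerSymb, innerSymb, symbProd, ← Finset.prod_Ico_consecutive _ hr hs,
    ← Finset.prod_Ico_consecutive (fun t => upSymb up c t z) (Nat.zero_le r) hr,
    Finset.prod_inv_distrib, Finset.prod_inv_distrib]
  simp only [symb_eq_mul, Finset.prod_mul_distrib]
  field_simp

/-- The second factor is entire and does not depend on `s`. Hence the coefficients of the expansion
below are the same for all target points. -/
theorem innerSymb_eq (hc : ∀ t, 0 ≤ c t) (hc1 : ∀ t, c t < 1) {z : ℂ}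
    (hz : Admissible up c ‖z‖) {T s : ℕ} (hs : s ≤ T) :
    innerSymb up c T s z = symbProd up c 0 s z * ∏ t ∈ Finset.Ico 0 T, (downSymb up c t z)⁻¹ := by
  have hd : ∏ t ∈ Finset.Ico 0 s, downSymb up c t z ≠ 0 :=
    Finset.prod_ne_zero_iff.2 fun u _ => downSymb_ne_zero hc hc1 hz u
  rw [innerSymb, symbProd, ← Finset.prod_Ico_consecutive (fun t => (downSymb up c t z)⁻¹)
    (Nat.zero_le s) hs, Finset.prod_inv_distrib (s := Finset.Ico 0 s)]
  simp only [symb_eq_mul, Finset.prod_mul_distrib]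
  field_simp

variable {r₁ r₂ : ℝ}

/-- With the integrals exchanged, the average over `z` is a Cauchy transform, analytic for |w| < r₂
because the circle of `z` is the outer one. Multiplied by the entire factor from `innerSymb_eq` it
becomes the function `g` of the moment expansion, and it depends on the source `(r, x)` only. -/
theorem exists_doubleKernel_expansion (hc : ∀ t, 0 ≤ c t) (hc1 : ∀ t, c t < 1)
    (h₁ : Admissible up c r₁) (h₂ : Admissible up c r₂) (h12 : r₁ < r₂) {nn : ℕ → ℕ}
    (hnn : ∀ t, nn (t + 1) = nextCount up t (nn t)) {τ : ℕ → ℕ} (hτ0 : ∀ i < nn 0, τ i = 0)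
    (hτ : ∀ t, up t → τ (nn t) = t) (T r : ℕ) (x : ℤ) :
    ∃ d : ℕ → ℂ, ∀ s ≤ T, ∀ y : ℤ, 1 ≤ y + nn s →
      doubleKernel up c T r₁ r₂ r s x y =
        ∑ i ∈ Finset.range (nn s), d i *
          circleAverage (fun w => w ^ (y + i) * symbProd up c (τ i) s w) 0 r₁ := by
  set Γ : ℂ → ℂ := fun w => circleAverage (fun z => (outerSymb up c T r z / z ^ x) *
    (z / (z - w))) 0 r₂ with hΓ
  have hcz : ∀ k : ℤ, ∀ {ρ : ℝ}, 0 < ρ → ContinuousOn (fun z : ℂ => z ^ k) (sphere 0 ρ) := by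
    intro k ρ hρ z hz
    have hz0 : z ≠ 0 := norm_pos_iff.1 (by rwa [mem_sphere_zero_iff_norm.1 hz])
    exact (continuousAt_zpow₀ z k (Or.inl hz0)).continuousWithinAt
  have hne : ∀ {ρ : ℝ}, 0 < ρ → ∀ z ∈ sphere (0 : ℂ) ρ, z ≠ 0 := fun hρ z hz =>
    norm_pos_iff.1 (by rwa [mem_sphere_zero_iff_norm.1 hz])
  have hcont : ContinuousOn (fun z => outerSymb up c T r z / z ^ x) (sphere 0 r₂) :=
    (continuousOn_outerSymb hc hc1 h₂ T r).div (hcz x h₂.pos)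
      fun z hz => zpow_ne_zero _ (hne h₂.pos z hz)
  have hΓd : DifferentiableOn ℂ Γ (ball 0 r₂) := differentiableOn_cauchy_transform h₂.pos hcont
  have hg : DifferentiableOn ℂ (fun w => (∏ t ∈ Finset.Ico 0 T, (downSymb up c t w)⁻¹) * Γ w)
      (ball 0 r₂) := by
    refine DifferentiableOn.mul ?_ hΓd
    exact (Differentiable.fun_finsetProd fun u _ => differentiable_downSymb_inv u).differentiableOn
  obtain ⟨d, hd⟩ := exists_moment_expansion hc h₁ h₂ h12 hnn hτ0 hτ hg T
  refine ⟨d, fun s hs y hy => ?_⟩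
  rw [← hd s hs y hy, doubleKernel, circleAverage_swap h₂.pos.le h₁.pos.le]
  · refine circleAverage_congr_sphere fun w hw => ?_
    rw [abs_of_pos h₁.pos] at hw
    have hw' : Admissible up c ‖w‖ := by rwa [mem_sphere_zero_iff_norm.1 hw]
    rw [← mul_assoc (symbProd up c 0 s w), ← innerSymb_eq hc hc1 hw' hs, hΓ, ← mul_assoc,
      ← smul_eq_mul (w ^ y * innerSymb up c T s w), ← circleAverage_fun_smul]
    congr 1
    funext z
    rw [smul_eq_mul]
    ring
  · have hsub : ∀ p ∈ sphere (0 : ℂ) r₂ ×ˢ sphere (0 : ℂ) r₁, p.1 - p.2 ≠ 0 := by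
      rintro ⟨z, w⟩ ⟨hz, hw⟩ h0
      rw [mem_sphere_zero_iff_norm] at hz hw
      simp only [sub_eq_zero] at h0
      simp only at hz hw
      rw [h0] at hz
      exact absurd (hw.symm.trans hz) h12.ne
    have hm1 : Set.MapsTo Prod.fst (sphere (0 : ℂ) r₂ ×ˢ sphere (0 : ℂ) r₁) (sphere 0 r₂) :=
      fun p hp => hp.1
    have hm2 : Set.MapsTo Prod.snd (sphere (0 : ℂ) r₂ ×ˢ sphere (0 : ℂ) r₁) (sphere 0 r₁) :=
      fun p hp => hp.2
    refine ((((hcz y h₁.pos).comp continuousOn_snd hm2).div ((hcz x h₂.pos).comp continuousOn_fst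
      hm1) fun p hp => zpow_ne_zero _ (hne h₂.pos _ hp.1)).mul
      (continuousOn_fst.div (continuousOn_fst.sub continuousOn_snd) hsub)).mul
      (((continuousOn_outerSymb hc hc1 h₂ T r).comp continuousOn_fst hm1).mul
      ((continuousOn_innerSymb hc h₁ T s).comp continuousOn_snd hm2))

/-- Cauchy's formula at infinity. In the variable u = 1/w the function w^y ∏ upSymb is analytic on
the closed disc of radius 1/r₁, thanks to y ≤ 0, and z/(z - w) becomes the Cauchy kernel u/(u - 1/z)
with 1/z inside the disc. -/
theorem circleAverage_upSymb (hc : ∀ t, 0 ≤ c t) (h₁ : Admissible up c r₁) {z : ℂ}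
    (hz : r₁ < ‖z‖) (T : ℕ) {y : ℤ} (hy : y ≤ 0) :
    circleAverage (fun w => w ^ y * (z / (z - w)) * ∏ t ∈ Finset.Ico 0 T, upSymb up c t w) 0 r₁ =
      z ^ y * ∏ t ∈ Finset.Ico 0 T, upSymb up c t z := by
  have hz0 : z ≠ 0 := norm_pos_iff.1 (h₁.pos.trans hz)
  set f : ℂ → ℂ := fun u => u ^ (-y).toNat *
    ∏ t ∈ Finset.Ico 0 T, if up t then (1 - c t : ℂ) / (1 - c t * u) else 1 with hf
  have hfz : ∀ v : ℂ, f v⁻¹ = v ^ y * ∏ t ∈ Finset.Ico 0 T, upSymb up c t v := by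
    intro v
    rw [hf]
    beta_reduce
    congr 1
    rw [← zpow_natCast, Int.toNat_of_nonneg (by omega), inv_zpow', neg_neg]
  rw [← circleAverage_comp_inv, ← hfz]
  have hd : DiffContOnCl ℂ f (ball 0 |r₁⁻¹|) := by
    rw [abs_of_pos (inv_pos.2 h₁.pos)]
    have hcl : closedBall (0 : ℂ) r₁⁻¹ = closure (ball 0 r₁⁻¹) :=
      (closure_ball _ (inv_pos.2 h₁.pos).ne').symm
    have : ∀ u ∈ closedBall (0 : ℂ) r₁⁻¹, DifferentiableAt ℂ f u := by
      intro u hu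
      rw [mem_closedBall_zero_iff] at hu
      refine DifferentiableAt.mul (by fun_prop) (DifferentiableAt.fun_finsetProd fun t _ => ?_)
      by_cases ht : up t
      · simp only [if_pos ht]
        have h1 : ‖(c t : ℂ) * u‖ < 1 := by
          rw [norm_mul, Complex.norm_of_nonneg (hc t)]
          calc c t * ‖u‖ ≤ c t * r₁⁻¹ := mul_le_mul_of_nonneg_left hu (hc t)
            _ < 1 := by rw [← div_eq_mul_inv, div_lt_one h₁.pos]; exact h₁.up_lt t ht
        have h2 := one_sub_ne_zero_of_norm_lt h1
        fun_prop (disch := assumption)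
      · simp only [if_neg ht]
        fun_prop
    refine ⟨fun u hu => (this u (ball_subset_closedBall hu)).differentiableWithinAt, ?_⟩
    rw [← hcl]
    exact fun u hu => (this u hu).continuousAt.continuousWithinAt
  have hw : z⁻¹ ∈ ball (0 : ℂ) |r₁⁻¹| := by
    rw [abs_of_pos (inv_pos.2 h₁.pos), mem_ball_zero_iff, norm_inv]
    exact inv_strictAnti₀ h₁.pos hz
  rw [← hd.circleAverage_smul_div hw]
  refine circleAverage_congr_sphere fun u hu => ?_
  rw [abs_of_pos (inv_pos.2 h₁.pos), mem_sphere_zero_iff_norm] at hu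
  have hu0 : u ≠ 0 := norm_pos_iff.1 (by rw [hu]; exact inv_pos.2 h₁.pos)
  have h3 : u - z⁻¹ ≠ 0 := by
    intro h0
    rw [sub_eq_zero] at h0
    rw [h0, norm_inv] at hu
    exact hz.ne (inv_injective hu).symm
  have hfu := hfz u⁻¹
  rw [inv_inv] at hfu
  have h5 : z / (z - u⁻¹) = (u - 0) / (u - z⁻¹) := by
    have h4 : z - u⁻¹ ≠ 0 := by
      intro h0
      apply h3
      rw [sub_eq_zero] at h0 ⊢
      rw [h0, inv_inv]
    rw [div_eq_div_iff h4 h3]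
    field_simp
    ring
  rw [hfu, h5, smul_eq_mul]
  ring

/-- At the final time the inner factor contains no down-symbols, so the average over `w` is Cauchy's
formula at infinity and only the average over `z` remains. -/
theorem doubleKernel_final (hc : ∀ t, 0 ≤ c t) (hc1 : ∀ t, c t < 1)
    (h₁ : Admissible up c r₁) (h₂ : Admissible up c r₂) (h12 : r₁ < r₂) {T r : ℕ} (hr : r ≤ T)
    (x : ℤ) {y : ℤ} (hy : y ≤ 0) :
    doubleKernel up c T r₁ r₂ r T x y =
      circleAverage (fun z => z ^ (y - x) * symbProd up c r T z) 0 r₂ := by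
  refine circleAverage_congr_sphere fun z hz => ?_
  rw [abs_of_pos h₂.pos, mem_sphere_zero_iff_norm] at hz
  have hz' : Admissible up c ‖z‖ := by rwa [hz]
  have hin : ∀ w, innerSymb up c T T w = ∏ t ∈ Finset.Ico 0 T, upSymb up c t w := fun w => by
    simp [innerSymb]
  rw [← outerSymb_mul_innerSymb hc hc1 hz' hr le_rfl, hin z]
  have e : (fun w => w ^ y / z ^ x * (z / (z - w)) *
      (outerSymb up c T r z * innerSymb up c T T w)) = fun w =>
      (outerSymb up c T r z / z ^ x) • (w ^ y * (z / (z - w)) *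
        ∏ t ∈ Finset.Ico 0 T, upSymb up c t w) := by
    funext w
    rw [hin, smul_eq_mul]
    ring
  rw [e, circleAverage_fun_smul, circleAverage_upSymb hc h₁ (by rwa [hz]) T hy, smul_eq_mul,
    zpow_sub₀ hz'.ne_zero]
  ring

end DoubleKernel


/-! ## The kernel identity -/

section KernelIdentity

open Real Metric

variable {up : ℕ → Prop} [DecidablePred up] {c : ℕ → ℝ} {r₁ r₂ : ℝ}

theorem transKernel_stepCoef (hc : ∀ t, 0 ≤ c t) (hc1 : ∀ t, c t < 1) {ρ : ℝ}
    (hρ : Admissible up c ρ) {s t : ℕ} (hst : s < t) (x y : ℤ) :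
    (transKernel (stepCoef up c) s t x y : ℂ) =
      circleAverage (fun z => z ^ (y - x) * symbProd up c s t z) 0 ρ := by
  rw [transKernel, if_pos hst, convKernel_stepCoef hc hc1, Nat.add_sub_cancel' hst.le]
  exact circleAverage_symbProd_eq hc (admissible_one hc1) hρ _ _ _

/-- Rows are numbered from the bottom particle, birth times and expansion coefficients from the top
one. -/
theorem sum_fin_reflect {M : Type*} [AddCommMonoid M] (N : ℕ) (F : ℕ → M) :
    ∑ k : Fin N, F (N - 1 - k) = ∑ i ∈ Finset.range N, F i := by
  rw [Fin.sum_univ_eq_sum_range (fun k => F (N - 1 - k)) N, Finset.sum_range_reflect]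

theorem packed_eq {N : ℕ} (k : Fin N) : packed N k = -((N - 1 - k : ℕ) : ℤ) := by
  have := k.2
  rw [packed]
  omega

/-- The correlation kernel on the space-time lattice, in terms of the step parameters. -/
noncomputable def stepKernel (up : ℕ → Prop) [DecidablePred up] (c : ℕ → ℝ) (T : ℕ) (r₁ r₂ : ℝ)
    (p q : ℕ × ℤ) : ℂ :=
  doubleKernel up c T r₁ r₂ p.1 q.1 p.2 q.2 - transKernel (stepCoef up c) p.1 q.1 p.2 q.2

/-- Let `Q` be the matrix of the expansion coefficients of the double kernel. The expansion at the
final time, where the double kernel is the transition kernel, says `Q * A = C`; the expansion at the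
test points says that `Q * B` is `-q` times the double kernel. Elimination then leaves `1 + q K`. -/
theorem det_fromBlocks_eq_det_stepKernel (hc : ∀ t, 0 ≤ c t) (hc1 : ∀ t, c t < 1)
    (h₁ : Admissible up c r₁) (h₂ : Admissible up c r₂) (h12 : r₁ < r₂) {nn : ℕ → ℕ}
    (hnn : ∀ t, nn (t + 1) = nextCount up t (nn t)) {τ : ℕ → ℕ} (hτ0 : ∀ i < nn 0, τ i = 0)
    (hτ : ∀ t, up t → τ (nn t) = t) (T : ℕ) (hτlt : ∀ s, 1 ≤ s → ∀ i < nn s, τ i < s)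
    (hτge : ∀ s, ∀ i < nn T, nn s ≤ i → s ≤ τ i) (hT : 1 ≤ T)
    {ι : Type*} [Fintype ι] [DecidableEq ι] (z : ι → ℕ × ℤ) (hz : ∀ i, 1 ≤ (z i).1 ∧ (z i).1 < T)
    (hzy : ∀ i, 1 ≤ (z i).2 + nn (z i).1) (q : ℝ) :
    ((Matrix.det (Matrix.fromBlocks
      (Matrix.of fun k j : Fin (nn T) => convKernel (stepCoef up c) (T - τ (nn T - 1 - k))
        (τ (nn T - 1 - k)) (packed (nn T) j - packed (nn T) k))
      (Matrix.of fun (k : Fin (nn T)) i => -q * transKernel (stepCoef up c) (τ (nn T - 1 - k))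
        (z i).1 (packed (nn T) k) (z i).2)
      (Matrix.of fun i j => transKernel (stepCoef up c) (z i).1 T (z i).2 (packed (nn T) j))
      (1 - Matrix.of fun i i' => q * transKernel (stepCoef up c) (z i).1 (z i').1 (z i).2
        (z i').2)) : ℝ) : ℂ) =
    Matrix.det (Matrix.of fun k j : Fin (nn T) => (convKernel (stepCoef up c)
      (T - τ (nn T - 1 - k)) (τ (nn T - 1 - k)) (packed (nn T) j - packed (nn T) k) : ℂ)) *
    Matrix.det (1 + Matrix.of fun i i' => (q : ℂ) * stepKernel up c T r₁ r₂ (z i) (z i')) := by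
  set N := nn T with hN
  choose d hd using fun i => exists_doubleKernel_expansion hc hc1 h₁ h₂ h12 hnn hτ0 hτ T
    (z i).1 (z i).2
  have hτT : ∀ i < N, τ i < T := fun i hi => hτlt T hT i hi
  have hreal : ∀ M : Matrix (Fin N ⊕ ι) (Fin N ⊕ ι) ℝ, ((M.det : ℝ) : ℂ) =
      (M.map (fun x : ℝ => (x : ℂ))).det := fun M => Complex.ofRealHom.map_det M
  rw [hreal, Matrix.fromBlocks_map, det_fromBlocks_of_eq_mul _ _ _
    (Matrix.of fun i (k : Fin N) => d i (N - 1 - k))]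
  · congr 2
    ext i i'
    simp only [Matrix.sub_apply, Matrix.map_apply, Matrix.of_apply, Matrix.mul_apply,
      Matrix.add_apply]
    have hE := hd i (z i').1 (hz i').2.le (z i').2 (hzy i')
    have hsum : ∑ k : Fin N, d i (N - 1 - k) * (((-q * transKernel (stepCoef up c)
        (τ (N - 1 - k)) (z i').1 (packed N k) (z i').2 : ℝ)) : ℂ) =
        -q * doubleKernel up c T r₁ r₂ (z i).1 (z i').1 (z i).2 (z i').2 := by
      rw [hE]
      have hterm : ∀ k : Fin N, d i (N - 1 - k) * (((-q * transKernel (stepCoef up c)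
        (τ (N - 1 - k)) (z i').1 (packed N k) (z i').2 : ℝ)) : ℂ) =
        (fun j : ℕ => d i j * ((-q * transKernel (stepCoef up c)
          (τ j) (z i').1 (-(j : ℤ)) (z i').2 : ℝ) : ℂ)) (N - 1 - k) := by
        intro k
        rw [packed_eq]
      refine ((Finset.sum_congr rfl fun k _ => hterm k).trans (sum_fin_reflect N
        (fun j : ℕ => d i j * ((-q * transKernel (stepCoef up c)
          (τ j) (z i').1 (-(j : ℤ)) (z i').2 : ℝ) : ℂ)))).trans ?_
      rw [Finset.mul_sum]
      have hle : nn (z i').1 ≤ N := by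
        obtain ⟨j, hj⟩ := Nat.exists_eq_add_of_le (hz i').2.le
        rw [hN, hj]
        exact le_count_add up hnn _ j
      -- Particles entering at the time of the test point or later have zero kernel to it, so the
      -- expansion extends to all `N` particles.
      rw [← Finset.sum_subset (Finset.range_mono hle)]
      · refine Finset.sum_congr rfl fun j hj => ?_
        have hlt := hτlt _ (hz i').1 j (Finset.mem_range.1 hj)
        push_cast
        rw [transKernel_stepCoef hc hc1 h₁ hlt, sub_neg_eq_add]
        ring
      · intro j hj hj'
        rw [Finset.mem_range] at hj hj'
        have := hτge (z i').1 j hj (by omega)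
        rw [transKernel, if_neg (by omega)]
        simp
    rw [hsum]
    have h1 : (((1 : Matrix ι ι ℝ) i i' : ℝ) : ℂ) = (1 : Matrix ι ι ℂ) i i' := by
      simp only [Matrix.one_apply]
      split_ifs <;> simp
    push_cast
    rw [h1, stepKernel]
    ring
  · ext i j
    simp only [Matrix.map_apply, Matrix.of_apply, Matrix.mul_apply]
    have hp0 : packed N j ≤ 0 := by rw [packed_eq]; omega
    have hpN : 1 ≤ packed N j + nn T := by
      have := j.2
      rw [packed, ← hN]
      omega
    -- The transition kernel to a packed final site is recognised as a double kernel and then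
    -- expanded.
    rw [transKernel_stepCoef hc hc1 h₂ (hz i).2, ← doubleKernel_final hc hc1 h₁ h₂ h12
      (hz i).2.le _ hp0, hd i T le_rfl _ hpN]
    have hterm : ∀ k : Fin N, d i (N - 1 - k) * ((convKernel (stepCoef up c)
        (T - τ (N - 1 - k)) (τ (N - 1 - k)) (packed N j - packed N k) : ℝ) : ℂ) =
        (fun l : ℕ => d i l * ((convKernel (stepCoef up c) (T - τ l) (τ l)
          (packed N j - -(l : ℤ)) : ℝ) : ℂ)) (N - 1 - k) := by
      intro k
      rw [packed_eq k]
    refine ((Finset.sum_congr rfl fun k _ => hterm k).trans (sum_fin_reflect N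
      (fun l : ℕ => d i l * ((convKernel (stepCoef up c) (T - τ l) (τ l)
          (packed N j - -(l : ℤ)) : ℝ) : ℂ)))).trans ?_
    refine Finset.sum_congr rfl fun l hl => ?_
    have hlt := hτT l (Finset.mem_range.1 hl)
    rw [convKernel_stepCoef hc hc1, Nat.add_sub_cancel' hlt.le, sub_neg_eq_add,
      circleAverage_symbProd_eq hc (admissible_one hc1) h₁]

end KernelIdentity


/-! ## Iterated last passage -/

section Growth

/-- The last-passage values of the `k`-th derived array. -/
def iterPassage (w : ℕ → ℕ → ℕ) (k i j : ℕ) : ℕ := passage (derived^[k] w) i j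

@[simp] theorem passage_zero_left (w : ℕ → ℕ → ℕ) (j : ℕ) : passage w 0 j = 0 := by
  rw [passage]

@[simp] theorem passage_zero_right (w : ℕ → ℕ → ℕ) (i : ℕ) : passage w i 0 = 0 := by
  cases i <;> rw [passage]

theorem passage_succ (w : ℕ → ℕ → ℕ) (i j : ℕ) : passage w (i + 1) (j + 1) =
    max (passage w i (j + 1)) (passage w (i + 1) j) + w (i + 1) (j + 1) := by
  rw [passage]

theorem passage_derived_succ (w : ℕ → ℕ → ℕ) (i j : ℕ) : passage (derived w) (i + 1) (j + 1) =
    max (passage (derived w) i (j + 1)) (passage (derived w) (i + 1) j) +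
      (min (passage w i (j + 1)) (passage w (i + 1) j) - passage w i j) := by
  rw [passage_succ, derived]

theorem passage_le_succ_left (w : ℕ → ℕ → ℕ) (i j : ℕ) : passage w i j ≤ passage w (i + 1) j := by
  cases j with
  | zero => simp
  | succ j => rw [passage_succ]; omega

theorem passage_le_succ_right (w : ℕ → ℕ → ℕ) (i j : ℕ) :
    passage w i j ≤ passage w i (j + 1) := by
  cases i with
  | zero => simp
  | succ i => rw [passage_succ]; omega

/-- By induction the two competing values in the recursion for the derived array are at most G(i,
j), which the local rule subtracts again; what remains is at most the minimum of the two neighbours.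
-/
theorem passage_derived_succ_le (w : ℕ → ℕ → ℕ) (i j : ℕ) :
    passage (derived w) (i + 1) j ≤ passage w i j ∧
      passage (derived w) i (j + 1) ≤ passage w i j := by
  induction h : i + j using Nat.strong_induction_on generalizing i j with
  | _ n ih =>
    have key : ∀ i' j', i' + j' < n → passage (derived w) (i' + 1) (j' + 1) ≤
        min (passage w i' (j' + 1)) (passage w (i' + 1) j') := by
      intro i' j' hlt
      have := ih _ hlt i' j' rfl
      have h1 := passage_le_succ_left w i' j'
      have h2 := passage_le_succ_right w i' j'
      rw [passage_derived_succ]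
      omega
    constructor
    · cases j with
      | zero => simp
      | succ j => exact (key i j (by omega)).trans (min_le_left _ _)
    · cases i with
      | zero => simp
      | succ i => exact (key i j (by omega)).trans (min_le_right _ _)

section iterPassage

variable (w : ℕ → ℕ → ℕ) (k i j : ℕ)

@[simp] theorem iterPassage_zero_left : iterPassage w k 0 j = 0 := passage_zero_left _ _

@[simp] theorem iterPassage_zero_right : iterPassage w k i 0 = 0 := passage_zero_right _ _

theorem iterPassage_zero_succ : iterPassage w 0 (i + 1) (j + 1) =
    max (iterPassage w 0 i (j + 1)) (iterPassage w 0 (i + 1) j) + w (i + 1) (j + 1) :=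
  passage_succ _ _ _

theorem iterPassage_succ : iterPassage w (k + 1) (i + 1) (j + 1) =
    max (iterPassage w (k + 1) i (j + 1)) (iterPassage w (k + 1) (i + 1) j) +
      (min (iterPassage w k i (j + 1)) (iterPassage w k (i + 1) j) - iterPassage w k i j) := by
  simp only [iterPassage, Function.iterate_succ_apply']
  exact passage_derived_succ _ _ _

theorem iterPassage_le_succ_left : iterPassage w k i j ≤ iterPassage w k (i + 1) j :=
  passage_le_succ_left _ _ _

theorem iterPassage_le_succ_right : iterPassage w k i j ≤ iterPassage w k i (j + 1) :=
  passage_le_succ_right _ _ _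

theorem iterPassage_succ_left_le : iterPassage w (k + 1) (i + 1) j ≤ iterPassage w k i j := by
  rw [iterPassage, Function.iterate_succ_apply']
  exact (passage_derived_succ_le _ _ _).1

theorem iterPassage_succ_right_le : iterPassage w (k + 1) i (j + 1) ≤ iterPassage w k i j := by
  rw [iterPassage, Function.iterate_succ_apply']
  exact (passage_derived_succ_le _ _ _).2

variable {k i} in
-- In RSK terms the partition at `(i, j)` has at most `i` rows: the shift inequality lowers `k` and
-- `i` together.
theorem iterPassage_eq_zero (h : i ≤ k) : iterPassage w k i j = 0 := by
  induction k generalizing i with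
  | zero => obtain rfl : i = 0 := by omega
            simp
  | succ k ih =>
    cases i with
    | zero => simp
    | succ i => exact Nat.le_zero.1 ((iterPassage_succ_left_le w k i j).trans (ih (by omega)).le)

end iterPassage

theorem passage_congr {w w' : ℕ → ℕ → ℕ} {i j : ℕ}
    (h : ∀ i' ≤ i, ∀ j' ≤ j, w i' j' = w' i' j') : passage w i j = passage w' i j := by
  induction hn : i + j using Nat.strong_induction_on generalizing i j with
  | _ n ih =>
    cases i with
    | zero => simp
    | succ i =>
      cases j with
      | zero => simp
      | succ j =>
        rw [passage_succ, passage_succ, h _ le_rfl _ le_rfl,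
          ih (i + (j + 1)) (by omega) (fun i' hi' j' hj' => h i' (by omega) j' hj') rfl,
          ih (i + 1 + j) (by omega) (fun i' hi' j' hj' => h i' hi' j' (by omega)) rfl]

theorem derived_congr {w w' : ℕ → ℕ → ℕ} {i j : ℕ}
    (h : ∀ i' ≤ i, ∀ j' ≤ j, w i' j' = w' i' j') : derived w i j = derived w' i j := by
  cases i with
  | zero => simp [derived]
  | succ i =>
    cases j with
    | zero => simp [derived]
    | succ j =>
      rw [derived, derived,
        passage_congr fun i' (hi' : i' ≤ i) j' (hj' : j' ≤ j) => h i' (by omega) j' (by omega),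
        passage_congr fun i' (hi' : i' ≤ i) j' (hj' : j' ≤ j + 1) => h i' (by omega) j' hj',
        passage_congr fun i' (hi' : i' ≤ i + 1) j' (hj' : j' ≤ j) => h i' hi' j' (by omega)]

theorem iterate_derived_congr {w w' : ℕ → ℕ → ℕ} {i j : ℕ}
    (h : ∀ i' ≤ i, ∀ j' ≤ j, w i' j' = w' i' j') (k : ℕ) :
    ∀ i' ≤ i, ∀ j' ≤ j, derived^[k] w i' j' = derived^[k] w' i' j' := by
  induction k with
  | zero => exact h
  | succ k ih =>
    intro i' hi' j' hj'
    rw [Function.iterate_succ_apply', Function.iterate_succ_apply']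
    exact derived_congr fun a ha b hb => ih a (ha.trans hi') b (hb.trans hj')

/-- Locality, which allows the entry of a corner cell to be prescribed without disturbing the values
on the rest of the path. -/
theorem iterPassage_congr {w w' : ℕ → ℕ → ℕ} {i j : ℕ}
    (h : ∀ i' ≤ i, ∀ j' ≤ j, w i' j' = w' i' j') (k : ℕ) :
    iterPassage w k i j = iterPassage w' k i j :=
  passage_congr (iterate_derived_congr h k)

end Growth

/-! ## Down-right paths -/

section DownRight

/-- A path of `T` unit steps to the right or down, from the vertical to the horizontal axis. -/
structure IsDownRight (p : ℕ → ℕ × ℕ) (T : ℕ) : Prop where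
  start : (p 0).1 = 0
  finish : (p T).2 = 0
  step : ∀ t < T, p (t + 1) = ((p t).1 + 1, (p t).2) ∨ p t = ((p (t + 1)).1, (p (t + 1)).2 + 1)

/-- The unit squares below the path, labelled by their upper right corners. -/
def cells (p : ℕ → ℕ × ℕ) (T : ℕ) : Finset (ℕ × ℕ) :=
  (Finset.range (T + 1)).biUnion fun t => Finset.Icc 1 (p t).1 ×ˢ Finset.Icc 1 (p t).2

theorem mem_cells {p : ℕ → ℕ × ℕ} {T : ℕ} {q : ℕ × ℕ} : q ∈ cells p T ↔
    (1 ≤ q.1 ∧ 1 ≤ q.2) ∧ ∃ t ≤ T, q.1 ≤ (p t).1 ∧ q.2 ≤ (p t).2 := by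
  simp only [cells, Finset.mem_biUnion, Finset.mem_range, Finset.mem_product, Finset.mem_Icc,
    Nat.lt_succ_iff]
  constructor
  · rintro ⟨t, ht, h⟩
    exact ⟨⟨h.1.1, h.2.1⟩, t, ht, h.1.2, h.2.2⟩
  · rintro ⟨h, t, ht, h'⟩
    exact ⟨t, ht, ⟨h.1, h'.1⟩, h.2, h'.2⟩

namespace IsDownRight

variable {p : ℕ → ℕ × ℕ} {T : ℕ}

theorem mono (hp : IsDownRight p T) {s t : ℕ} (hst : s ≤ t) (ht : t ≤ T) :
    (p s).1 ≤ (p t).1 ∧ (p t).2 ≤ (p s).2 := by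
  induction t, hst using Nat.le_induction with
  | base => simp
  | succ t hst ih =>
    have := ih (by omega)
    rcases hp.step t (by omega) with h | h
    · rw [h]; exact ⟨by simp; omega, this.2⟩
    · rw [h] at this; simp at this; omega

/-- A path either runs along the axes or has a corner in the interior of the quadrant. -/
theorem axes_or_corner (hp : IsDownRight p T) :
    (∀ t ≤ T, (p t).1 = 0 ∨ (p t).2 = 0) ∨
      ∃ n i j, n + 2 ≤ T ∧ p n = (i, j + 1) ∧ p (n + 1) = (i + 1, j + 1) ∧ p (n + 2) = (i + 1, j) := by
  by_contra! hcon
  obtain ⟨⟨t, ht, hx, hy⟩, hno⟩ := hcon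
  -- Without corners, a right-step at positive height is followed by right-steps only, and the path
  -- never comes down to the axis.
  have hfin : ∀ s, s ≤ T → (p s).2 ≠ 0 → ∀ i, p s = (i, (p s).2) → ∀ u, s = u + 1 →
      p (u + 1) = ((p u).1 + 1, (p u).2) → False := by
    intro s hs
    induction hd : T - s generalizing s with
    | zero =>
      intro h0
      obtain rfl : s = T := by omega
      exact absurd hp.finish h0
    | succ d ih =>
      intro h0 i hi u hu hr
      subst hu
      rcases hp.step (u + 1) (by omega) with h | h
      · exact ih (u + 2) (by omega) (by omega) (by rw [h]; exact h0) _ rfl (u + 1) rfl h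
      · refine hno u (p u).1 (p (u + 2)).2 (by omega) ?_ ?_ ?_
        · have h2 := congrArg Prod.snd (hr.symm.trans h)
          exact Prod.ext rfl h2
        · have h2 := congrArg Prod.snd (hr.symm.trans h)
          rw [hr]
          exact Prod.ext rfl h2
        · have h1 := congrArg Prod.fst (hr.symm.trans h)
          exact Prod.ext h1.symm rfl
  -- Hence only down-steps lead to the point at time `t`, and its positive first coordinate persists
  -- back to time 0.
  have hall : ∀ s ≤ t, (p s).1 ≠ 0 := by
    intro s hs
    induction hd : t - s generalizing s with
    | zero => obtain rfl : s = t := by omega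
              exact hx
    | succ d ih =>
      have h1 := ih (s + 1) (by omega) (by omega)
      rcases hp.step s (by omega) with h | h
      · exact (hfin (s + 1) (by omega) (by have := (hp.mono (show s + 1 ≤ t by omega) ht).2; omega)
          _ rfl s rfl h).elim
      · rw [h]; exact h1
  exact hall 0 (by omega) hp.start

theorem update (hp : IsDownRight p T) {n i j : ℕ} (hn : n + 2 ≤ T) (h0 : p n = (i, j + 1))
    (h2 : p (n + 2) = (i + 1, j)) : IsDownRight (Function.update p (n + 1) (i, j)) T where
  start := by
    rw [Function.update_of_ne (by omega)]
    exact hp.start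
  finish := by
    rw [Function.update_of_ne (by omega)]
    exact hp.finish
  step := by
    intro t ht
    by_cases ht1 : t = n
    · subst ht1
      right
      rw [Function.update_of_ne (by omega), Function.update_self, h0]
    · by_cases ht2 : t = n + 1
      · subst ht2
        left
        rw [Function.update_of_ne (by omega), Function.update_self, h2]
      · rw [Function.update_of_ne (by omega), Function.update_of_ne (by omega)]
        exact hp.step t ht

theorem cells_eq_insert (hp : IsDownRight p T) {n i j : ℕ} (hn : n + 2 ≤ T) (h0 : p n = (i, j + 1))
    (h1 : p (n + 1) = (i + 1, j + 1)) (h2 : p (n + 2) = (i + 1, j)) :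
    cells p T = insert (i + 1, j + 1) (cells (Function.update p (n + 1) (i, j)) T) ∧
      (i + 1, j + 1) ∉ cells (Function.update p (n + 1) (i, j)) T := by
  constructor
  · ext q
    rw [Finset.mem_insert, mem_cells, mem_cells]
    constructor
    · rintro ⟨hq, t, ht, hqt⟩
      by_cases htn : t = n + 1
      · subst htn
        rw [h1] at hqt
        simp only at hqt
        by_cases hi : q.1 ≤ i
        · refine Or.inr ⟨hq, n, by omega, ?_⟩
          rw [Function.update_of_ne (by omega), h0]
          exact ⟨hi, hqt.2⟩
        · by_cases hj : q.2 ≤ j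
          · refine Or.inr ⟨hq, n + 2, by omega, ?_⟩
            rw [Function.update_of_ne (by omega), h2]
            exact ⟨hqt.1, hj⟩
          · exact Or.inl (Prod.ext (by simp; omega) (by simp; omega))
      · refine Or.inr ⟨hq, t, ht, ?_⟩
        rwa [Function.update_of_ne htn]
    · rintro (rfl | ⟨hq, t, ht, hqt⟩)
      · exact ⟨by simp, n + 1, by omega, by rw [h1]; simp⟩
      · refine ⟨hq, ?_⟩
        by_cases htn : t = n + 1
        · subst htn
          rw [Function.update_self] at hqt
          exact ⟨n + 1, ht, by rw [h1]; simp only at hqt ⊢; omega⟩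
        · rw [Function.update_of_ne htn] at hqt
          exact ⟨t, ht, hqt⟩
  · rw [mem_cells]
    rintro ⟨-, t, ht, hqt⟩
    simp only at hqt
    rcases lt_trichotomy t (n + 1) with h | h | h
    · rw [Function.update_of_ne (by omega)] at hqt
      have := (hp.mono (show t ≤ n by omega) (by omega)).1
      rw [h0] at this
      simp only at this
      omega
    · rw [h, Function.update_self] at hqt
      simp only at hqt
      omega
    · rw [Function.update_of_ne (by omega)] at hqt
      have := (hp.mono (show n + 2 ≤ t by omega) ht).2
      rw [h2] at this
      simp only at this
      omega

/-- Induction by removing corners. -/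
theorem corner_induction {P : (ℕ → ℕ × ℕ) → Prop} {T : ℕ}
    (base : ∀ p, IsDownRight p T → (∀ t ≤ T, (p t).1 = 0 ∨ (p t).2 = 0) → P p)
    (corner : ∀ p n i j, IsDownRight p T → n + 2 ≤ T → p n = (i, j + 1) →
      p (n + 1) = (i + 1, j + 1) → p (n + 2) = (i + 1, j) →
      P (Function.update p (n + 1) (i, j)) → P p) :
    ∀ p, IsDownRight p T → P p := by
  intro p
  induction h : (cells p T).card using Nat.strong_induction_on generalizing p with
  | _ N ih =>
    intro hp
    rcases hp.axes_or_corner with hax | ⟨n, i, j, hn, h0, h1, h2⟩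
    · exact base p hp hax
    · refine corner p n i j hp hn h0 h1 h2 (ih _ ?_ _ rfl (hp.update hn h0 h2))
      have := hp.cells_eq_insert hn h0 h1 h2
      rw [← h, this.1, Finset.card_insert_of_notMem this.2]
      exact Nat.lt_succ_self _

end IsDownRight

end DownRight


/-! ## The correspondence between arrays and interlacing sequences -/

section Correspondence

/-- Two sequences interlace: `ν 0 ≥ α 0 ≥ ν 1 ≥ α 1 ≥ ⋯`. -/
def Interlace (α ν : ℕ → ℕ) : Prop := ∀ k, α k ≤ ν k ∧ ν (k + 1) ≤ α k

/-- A family of sequences along a down-right path that interlaces in the direction of the steps. -/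
structure IsInterlaced (p : ℕ → ℕ × ℕ) (T : ℕ) (σ : ℕ → ℕ → ℕ) : Prop where
  start : ∀ k, σ 0 k = 0
  finish : ∀ k, σ T k = 0
  right : ∀ t < T, p (t + 1) = ((p t).1 + 1, (p t).2) → Interlace (σ t) (σ (t + 1))
  down : ∀ t < T, p t = ((p (t + 1)).1, (p (t + 1)).2 + 1) → Interlace (σ (t + 1)) (σ t)

variable {p : ℕ → ℕ × ℕ} {T : ℕ}

/-- Starting from the empty sequence, a right-step frees at most one more entry and a down-step
none. -/
theorem IsInterlaced.eq_zero_of_fst_le {σ : ℕ → ℕ → ℕ} (hσ : IsInterlaced p T σ)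
    (hp : IsDownRight p T) {t k : ℕ} (ht : t ≤ T) (hk : (p t).1 ≤ k) : σ t k = 0 := by
  induction t generalizing k with
  | zero => exact hσ.start k
  | succ t ih =>
    rcases hp.step t (by omega) with h | h
    · rw [h] at hk
      simp only at hk
      obtain ⟨k, rfl⟩ : ∃ l, k = l + 1 := ⟨k - 1, by omega⟩
      have := (hσ.right t (by omega) h k).2
      have := ih (by omega) (show (p t).1 ≤ k by omega)
      omega
    · have h1 := congrArg Prod.fst h
      simp only at h1
      have := (hσ.down t (by omega) h k).1
      have := ih (by omega) (show (p t).1 ≤ k by omega)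
      omega

theorem IsInterlaced.eq_zero_of_snd_le {σ : ℕ → ℕ → ℕ} (hσ : IsInterlaced p T σ)
    (hp : IsDownRight p T) {t k : ℕ} (ht : t ≤ T) (hk : (p t).2 ≤ k) : σ t k = 0 := by
  induction hd : T - t generalizing t k with
  | zero =>
    obtain rfl : t = T := by omega
    exact hσ.finish k
  | succ d ih =>
    rcases hp.step t (by omega) with h | h
    · have h1 := congrArg Prod.snd h
      simp only at h1
      have := (hσ.right t (by omega) h k).1
      have := ih (show t + 1 ≤ T by omega) (show (p (t + 1)).2 ≤ k by omega) (by omega)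
      omega
    · have h1 := congrArg Prod.snd h
      simp only at h1
      obtain ⟨k, rfl⟩ : ∃ l, k = l + 1 := ⟨k - 1, by omega⟩
      have := (hσ.down t (by omega) h k).2
      have := ih (show t + 1 ≤ T by omega) (show (p (t + 1)).2 ≤ k by omega) (by omega)
      omega

theorem isInterlaced_iterPassage (hp : IsDownRight p T) (w : ℕ → ℕ → ℕ) :
    IsInterlaced p T fun t k => iterPassage w k (p t).1 (p t).2 where
  start k := by simp [hp.start]
  finish k := by simp [hp.finish]
  right t _ h k := by
    simp only [h]
    exact ⟨iterPassage_le_succ_left _ _ _ _, iterPassage_succ_left_le _ _ _ _⟩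
  down t _ h k := by
    simp only [h]
    exact ⟨iterPassage_le_succ_right _ _ _ _, iterPassage_succ_right_le _ _ _ _⟩

/-- Surjectivity of the correspondence: at a corner the inverse local rule produces the sequence on
the flipped path and the entry of the removed cell. -/
theorem exists_iterPassage_eq : ∀ p, IsDownRight p T → ∀ σ, IsInterlaced p T σ →
    ∃ w : ℕ → ℕ → ℕ, (∀ i j, (i, j) ∉ cells p T → w i j = 0) ∧
      ∀ t ≤ T, ∀ k, iterPassage w k (p t).1 (p t).2 = σ t k := by
  refine IsDownRight.corner_induction ?_ ?_
  · intro p hp hax σ hσ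
    refine ⟨0, fun _ _ _ => rfl, fun t ht k => ?_⟩
    rcases hax t ht with h | h
    · rw [hσ.eq_zero_of_fst_le hp ht (by omega), h, iterPassage_zero_left]
    · rw [hσ.eq_zero_of_snd_le hp ht (by omega), h, iterPassage_zero_right]
  · intro p n i j hp hn h0 h1 h2 ih σ hσ
    have hr := hσ.right n (by omega) (by rw [h0, h1])
    have hd : Interlace (σ (n + 2)) (σ (n + 1)) := hσ.down (n + 1) (by omega) (by rw [h2, h1])
    -- The local rule solved for γ_k. The subtraction is not truncated, as interlacing bounds
    -- ν_{k+1} by α_k and β_k.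
    set γ : ℕ → ℕ := fun k => min (σ n k) (σ (n + 2) k) + max (σ n (k + 1)) (σ (n + 2) (k + 1)) -
      σ (n + 1) (k + 1) with hγ
    have hp' := hp.update hn h0 h2
    have hσ' : IsInterlaced (Function.update p (n + 1) (i, j)) T
        (Function.update σ (n + 1) γ) := by
      refine ⟨fun k => ?_, fun k => ?_, fun t ht h => ?_, fun t ht h => ?_⟩
      · rw [Function.update_of_ne (by omega)]
        exact hσ.start k
      · rw [Function.update_of_ne (by omega)]
        exact hσ.finish k
      · by_cases ht1 : t = n
        · subst ht1
          rw [Function.update_self, Function.update_of_ne (by omega), h0] at h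
          simp at h
        · by_cases ht2 : t = n + 1
          · subst ht2
            rw [Function.update_self, Function.update_of_ne (by omega)]
            change Interlace γ (σ (n + 2))
            intro k
            have := hr k; have := hr (k + 1); have := hd k; have := hd (k + 1)
            simp only [hγ]
            omega
          · rw [Function.update_of_ne (by omega), Function.update_of_ne (by omega)] at h ⊢
            exact hσ.right t ht h
      · by_cases ht1 : t = n
        · subst ht1
          rw [Function.update_self, Function.update_of_ne (by omega)]
          intro k
          have := hr k; have := hr (k + 1); have := hd k; have := hd (k + 1)
          simp only [hγ]
          omega
        · by_cases ht2 : t = n + 1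
          · subst ht2
            rw [Function.update_self, Function.update_of_ne (by omega), h2] at h
            simp at h
          · rw [Function.update_of_ne (by omega), Function.update_of_ne (by omega)] at h ⊢
            exact hσ.down t ht h
    obtain ⟨w', hw', hG⟩ := ih _ hσ'
    have hcells := hp.cells_eq_insert hn h0 h1 h2
    -- The corner entry is what ν_0 exceeds the larger of α_0 and β_0 by.
    set w : ℕ → ℕ → ℕ := fun i' j' => if (i', j') = (i + 1, j + 1) then
      σ (n + 1) 0 - max (σ n 0) (σ (n + 2) 0) else w' i' j' with hw
    have hcongr : ∀ t ≤ T, ∀ k, iterPassage w k (Function.update p (n + 1) (i, j) t).1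
        (Function.update p (n + 1) (i, j) t).2 = Function.update σ (n + 1) γ t k := by
      intro t ht k
      rw [← hG t ht k]
      refine iterPassage_congr (fun i' hi' j' hj' => if_neg fun h => ?_) k
      obtain ⟨rfl, rfl⟩ := Prod.mk.inj h
      exact hcells.2 (mem_cells.2 ⟨by simp, t, ht, hi', hj'⟩)
    have hα : ∀ k, iterPassage w k i (j + 1) = σ n k := by
      intro k
      have := hcongr n (by omega) k
      rwa [Function.update_of_ne (by omega), Function.update_of_ne (by omega), h0] at this
    have hβ : ∀ k, iterPassage w k (i + 1) j = σ (n + 2) k := by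
      intro k
      have := hcongr (n + 2) (by omega) k
      rwa [Function.update_of_ne (by omega), Function.update_of_ne (by omega), h2] at this
    have hγ' : ∀ k, iterPassage w k i j = γ k := by
      intro k
      have := hcongr (n + 1) (by omega) k
      rwa [Function.update_self, Function.update_self] at this
    refine ⟨w, fun i' j' hij => ?_, fun t ht k => ?_⟩
    · rw [hcells.1, Finset.mem_insert, not_or] at hij
      rw [hw]
      simp only [if_neg hij.1]
      exact hw' _ _ hij.2
    · by_cases htn : t = n + 1
      · subst htn
        rw [h1]
        cases k with
        | zero =>
          have := hr 0; have := hd 0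
          rw [iterPassage_zero_succ, hα, hβ, hw]
          simp only [if_true]
          omega
        | succ k =>
          have := hr k; have := hr (k + 1); have := hd k; have := hd (k + 1)
          rw [iterPassage_succ, hα, hα, hβ, hβ, hγ']
          simp only [hγ]
          omega
      · have := hcongr t ht k
        rwa [Function.update_of_ne htn, Function.update_of_ne htn] at this

/-- Injectivity: the values at a corner and its two neighbours determine both the corner entry and
the values at the flipped corner. -/
theorem eq_on_cells_of_iterPassage_eq (w w' : ℕ → ℕ → ℕ) : ∀ p, IsDownRight p T →
    (∀ t ≤ T, ∀ k, iterPassage w k (p t).1 (p t).2 = iterPassage w' k (p t).1 (p t).2) →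
    ∀ q ∈ cells p T, w q.1 q.2 = w' q.1 q.2 := by
  refine IsDownRight.corner_induction ?_ ?_
  · intro p hp hax _ q hq
    obtain ⟨hq, t, ht, h⟩ := mem_cells.1 hq
    have := hax t ht
    omega
  · intro p n i j hp hn h0 h1 h2 ih h q hq
    have hα := h n (by omega)
    have hν := h (n + 1) (by omega)
    have hβ := h (n + 2) (by omega)
    rw [h0] at hα
    rw [h1] at hν
    rw [h2] at hβ
    simp only at hα hν hβ
    rw [(hp.cells_eq_insert hn h0 h1 h2).1, Finset.mem_insert] at hq
    rcases hq with rfl | hq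
    · have := hν 0
      rw [iterPassage_zero_succ, iterPassage_zero_succ, hα, hβ] at this
      simpa using this
    · refine ih (fun t ht k => ?_) q hq
      by_cases htn : t = n + 1
      · subst htn
        rw [Function.update_self]
        have h3 := hν (k + 1)
        rw [iterPassage_succ, iterPassage_succ, hα, hα, hβ, hβ] at h3
        have e1 := hα k
        have e2 := hβ k
        have a1 := iterPassage_le_succ_left w k i j
        have a2 := iterPassage_le_succ_right w k i j
        have a3 := iterPassage_le_succ_left w' k i j
        have a4 := iterPassage_le_succ_right w' k i j
        simp only
        omega
      · rw [Function.update_of_ne htn]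
        exact h t ht k

/-- The sum of the first `B` iterated last-passage values. -/
def iterSum (w : ℕ → ℕ → ℕ) (B i j : ℕ) : ℕ := ∑ k ∈ Finset.range B, iterPassage w k i j

theorem iterSum_le_succ_left (w : ℕ → ℕ → ℕ) (B i j : ℕ) :
    iterSum w B i j ≤ iterSum w B (i + 1) j :=
  Finset.sum_le_sum fun k _ => iterPassage_le_succ_left w k i j

theorem iterSum_le_succ_right (w : ℕ → ℕ → ℕ) (B i j : ℕ) :
    iterSum w B i j ≤ iterSum w B i (j + 1) :=
  Finset.sum_le_sum fun k _ => iterPassage_le_succ_right w k i j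

/-- Summing the local rule over `k` combines each maximum with the minimum of the same index into
the sum of the two neighbours. -/
theorem iterSum_corner (w : ℕ → ℕ → ℕ) {B i j : ℕ} (hB : i + 1 ≤ B) :
    iterSum w B (i + 1) (j + 1) + iterSum w B i j =
      iterSum w B i (j + 1) + iterSum w B (i + 1) j + w (i + 1) (j + 1) := by
  -- Finite partial sums leave one unmatched minimum, of index `n`. It vanishes for `n ≥ i`, whence
  -- the hypothesis on `B`.
  have key : ∀ n, iterSum w (n + 1) (i + 1) (j + 1) + iterSum w n i j +
      min (iterPassage w n i (j + 1)) (iterPassage w n (i + 1) j) =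
      iterSum w (n + 1) i (j + 1) + iterSum w (n + 1) (i + 1) j + w (i + 1) (j + 1) := by
    intro n
    induction n with
    | zero =>
      simp only [iterSum, Finset.sum_range_succ, Finset.range_zero, Finset.sum_empty,
        iterPassage_zero_succ]
      omega
    | succ n ih =>
      have a1 := iterPassage_le_succ_left w n i j
      have a2 := iterPassage_le_succ_right w n i j
      have h1 : iterSum w (n + 1 + 1) (i + 1) (j + 1) = iterSum w (n + 1) (i + 1) (j + 1) +
        iterPassage w (n + 1) (i + 1) (j + 1) := Finset.sum_range_succ _ _
      have h2 : iterSum w (n + 1 + 1) i (j + 1) = iterSum w (n + 1) i (j + 1) +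
        iterPassage w (n + 1) i (j + 1) := Finset.sum_range_succ _ _
      have h3 : iterSum w (n + 1 + 1) (i + 1) j = iterSum w (n + 1) (i + 1) j +
        iterPassage w (n + 1) (i + 1) j := Finset.sum_range_succ _ _
      have h4 : iterSum w (n + 1) i j = iterSum w n i j + iterPassage w n i j :=
        Finset.sum_range_succ _ _
      rw [iterPassage_succ] at h1
      omega
  obtain ⟨n, rfl⟩ : ∃ n, B = n + 1 := ⟨B - 1, by omega⟩
  have := key n
  have h4 : iterSum w (n + 1) i j = iterSum w n i j + iterPassage w n i j :=
    Finset.sum_range_succ _ _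
  rw [iterPassage_eq_zero w j (by omega : i ≤ n)] at h4
  rw [iterPassage_eq_zero w (j + 1) (by omega : i ≤ n)] at this
  omega

/-- The weight of a step along the path. -/
noncomputable def stepWeight (a b : ℕ → ℝ) (w : ℕ → ℕ → ℕ) (B : ℕ) (p : ℕ → ℕ × ℕ) (t : ℕ) : ℝ :=
  if p (t + 1) = ((p t).1 + 1, (p t).2) then
    a (p (t + 1)).1 ^ (iterSum w B (p (t + 1)).1 (p (t + 1)).2 - iterSum w B (p t).1 (p t).2)
  else b (p t).2 ^ (iterSum w B (p t).1 (p t).2 - iterSum w B (p (t + 1)).1 (p (t + 1)).2)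

/-- Restoring a corner exchanges its two steps and, by `iterSum_corner`, raises the exponents of
both a_{i+1} and b_{j+1} by the entry of the new cell. -/
theorem prod_stepWeight (a b : ℕ → ℝ) (w : ℕ → ℕ → ℕ) (B : ℕ) : ∀ p, IsDownRight p T →
    (∀ t ≤ T, (p t).1 ≤ B) →
    ∏ t ∈ Finset.range T, stepWeight a b w B p t =
      ∏ q ∈ cells p T, (a q.1 * b q.2) ^ w q.1 q.2 := by
  refine IsDownRight.corner_induction ?_ ?_
  · intro p hp hax _
    have h0 : cells p T = ∅ := by
      refine Finset.eq_empty_of_forall_notMem fun q hq => ?_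
      obtain ⟨hq, t, ht, h⟩ := mem_cells.1 hq
      have := hax t ht
      omega
    have hz : ∀ t ≤ T, iterSum w B (p t).1 (p t).2 = 0 := by
      intro t ht
      refine Finset.sum_eq_zero fun k _ => ?_
      rcases hax t ht with h | h <;> simp [h]
    rw [h0, Finset.prod_empty]
    refine Finset.prod_eq_one fun t ht => ?_
    rw [Finset.mem_range] at ht
    rw [stepWeight, hz t (by omega), hz (t + 1) (by omega)]
    simp
  · intro p n i j hp hn h0 h1 h2 ih hB
    have hcells := hp.cells_eq_insert hn h0 h1 h2
    have hBi : i + 1 ≤ B := by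
      have := hB (n + 1) (by omega)
      rwa [h1] at this
    have ih' := ih fun t ht => by
      by_cases htn : t = n + 1
      · subst htn
        rw [Function.update_self]
        simp only
        omega
      · rw [Function.update_of_ne htn]
        exact hB t ht
    rw [hcells.1, Finset.prod_insert hcells.2, ← ih']
    have hm : ∀ f : ℕ → ℝ, ∏ t ∈ Finset.range T, f t =
        f n * (f (n + 1) * ∏ t ∈ ((Finset.range T).erase n).erase (n + 1), f t) := by
      intro f
      rw [Finset.mul_prod_erase _ _ (by simp; omega), Finset.mul_prod_erase _ _ (by simp; omega)]
    rw [hm, hm (stepWeight a b w B (Function.update p (n + 1) (i, j)))]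
    have hrest : ∀ t ∈ ((Finset.range T).erase n).erase (n + 1), stepWeight a b w B p t =
        stepWeight a b w B (Function.update p (n + 1) (i, j)) t := by
      intro t ht
      simp only [Finset.mem_erase] at ht
      rw [stepWeight, stepWeight, Function.update_of_ne (by omega),
        Function.update_of_ne (by omega)]
    rw [Finset.prod_congr rfl hrest]
    have e1 : stepWeight a b w B p n =
        a (i + 1) ^ (iterSum w B (i + 1) (j + 1) - iterSum w B i (j + 1)) := by
      rw [stepWeight, h0, h1, if_pos rfl]
    have e2 : stepWeight a b w B p (n + 1) =
        b (j + 1) ^ (iterSum w B (i + 1) (j + 1) - iterSum w B (i + 1) j) := by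
      rw [stepWeight, h1, h2, if_neg (by simp)]
    have e3 : stepWeight a b w B (Function.update p (n + 1) (i, j)) n =
        b (j + 1) ^ (iterSum w B i (j + 1) - iterSum w B i j) := by
      rw [stepWeight, Function.update_self, Function.update_of_ne (by omega), h0,
        if_neg (by simp)]
    have e4 : stepWeight a b w B (Function.update p (n + 1) (i, j)) (n + 1) =
        a (i + 1) ^ (iterSum w B (i + 1) j - iterSum w B i j) := by
      rw [stepWeight, Function.update_self, Function.update_of_ne (by omega), h2, if_pos rfl]
    have hc := iterSum_corner w (j := j) hBi
    have l1 := iterSum_le_succ_left w B i j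
    have l2 := iterSum_le_succ_right w B i j
    have l3 := iterSum_le_succ_left w B i (j + 1)
    have l4 := iterSum_le_succ_right w B (i + 1) j
    rw [e1, e2, e3, e4,
      show iterSum w B (i + 1) (j + 1) - iterSum w B i (j + 1) =
        (iterSum w B (i + 1) j - iterSum w B i j) + w (i + 1) (j + 1) by omega,
      show iterSum w B (i + 1) (j + 1) - iterSum w B (i + 1) j =
        (iterSum w B i (j + 1) - iterSum w B i j) + w (i + 1) (j + 1) by omega]
    simp only
    ring

end Correspondence


/-! ## The boundary path of a partition -/

section Boundary

variable (lam : YoungDiagram)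

theorem part_anti {i j : ℕ} (h : i ≤ j) : part lam j ≤ part lam i :=
  lam.rowLen_anti _ _ (by omega)

theorem part_len_succ : part lam (len lam + 1) = 0 := by
  by_contra h
  have h1 : (len lam, 0) ∈ lam := YoungDiagram.mem_iff_lt_rowLen.2 (Nat.pos_of_ne_zero h)
  exact lt_irrefl _ (YoungDiagram.mem_iff_lt_colLen.1 h1)

theorem mem_shape {q : ℕ × ℕ} : q ∈ shape lam ↔ (1 ≤ q.1 ∧ 1 ≤ q.2) ∧ q.1 ≤ part lam q.2 := by
  simp only [shape, Finset.mem_filter, Finset.mem_product, Finset.mem_Icc]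
  constructor
  · rintro ⟨h, h'⟩
    exact ⟨⟨h.1.1, h.2.1⟩, h'⟩
  · rintro ⟨h, h'⟩
    refine ⟨⟨⟨h.1, h'.trans (part_anti lam h.2)⟩, h.2, ?_⟩, h'⟩
    by_contra hlt
    have := part_anti lam (show len lam + 1 ≤ q.2 by omega)
    rw [part_len_succ] at this
    omega

theorem path_succ (n : ℕ) : path lam (n + 1) =
    if ((path lam n).1 + 1, (path lam n).2) ∈ shape lam then
      ((path lam n).1 + 1, (path lam n).2)
    else ((path lam n).1, (path lam n).2 - 1) := by
  rw [path]

theorem path_spec {n : ℕ} (hn : n ≤ width lam + len lam) :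
    (path lam n).2 ≤ len lam ∧ (path lam n).1 + len lam = n + (path lam n).2 ∧
      (path lam n).1 ≤ width lam ∧ (1 ≤ (path lam n).2 → (path lam n).1 ≤ part lam (path lam n).2) ∧
      part lam ((path lam n).2 + 1) ≤ (path lam n).1 := by
  induction n with
  | zero => simp [path, part_len_succ]
  | succ n ih =>
    obtain ⟨h1, h2, h3, h4, h5⟩ := ih (by omega)
    rw [path_succ]
    split_ifs with h
    · obtain ⟨⟨-, hy⟩, hx⟩ := (mem_shape lam).1 h
      simp only at hx hy ⊢
      exact ⟨h1, by omega, hx.trans (part_anti lam hy), fun _ => hx, by omega⟩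
    · rw [mem_shape] at h
      simp only at h ⊢
      -- At height 0 the path has already reached the full width, which happens only at the final
      -- index.
      have hy : 1 ≤ (path lam n).2 := by
        by_contra hy
        have hy0 : (path lam n).2 = 0 := by omega
        rw [hy0] at h5 h2
        have : width lam ≤ (path lam n).1 := h5
        omega
      have hlt : part lam (path lam n).2 ≤ (path lam n).1 := by
        by_contra hlt
        exact h ⟨⟨by omega, hy⟩, by omega⟩
      refine ⟨by omega, by omega, h3, fun _ => (h4 hy).trans (part_anti lam (by omega)), ?_⟩
      rwa [Nat.sub_add_cancel hy]

theorem isRightStep_iff (n : ℕ) :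
    IsRightStep lam n ↔ ((path lam n).1 + 1, (path lam n).2) ∈ shape lam := by
  rw [IsRightStep, path_succ]
  split_ifs with h
  · simp [h]
  · simp [h, Prod.ext_iff]

theorem path_of_isRightStep {n : ℕ} (h : IsRightStep lam n) :
    path lam (n + 1) = ((path lam n).1 + 1, (path lam n).2) := h

theorem path_fst_of_not_isRightStep {n : ℕ} (h : ¬ IsRightStep lam n) :
    (path lam (n + 1)).1 = (path lam n).1 := by
  rw [isRightStep_iff] at h
  rw [path_succ, if_neg h]

theorem path_of_not_isRightStep {n : ℕ} (hn : n < width lam + len lam)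
    (h : ¬ IsRightStep lam n) :
    path lam n = ((path lam (n + 1)).1, (path lam (n + 1)).2 + 1) := by
  rw [isRightStep_iff] at h
  have e : path lam (n + 1) = ((path lam n).1, (path lam n).2 - 1) := by
    rw [path_succ, if_neg h]
  have h1 := (path_spec lam hn.le).2.1
  have h2 := (path_spec lam (n := n + 1) hn).2.1
  rw [e] at h2 ⊢
  simp only at h2
  exact Prod.ext rfl (by simp only; omega)

theorem isDownRight_path : IsDownRight (path lam) (width lam + len lam) where
  start := rfl
  finish := by
    have := path_spec lam (le_refl (width lam + len lam))
    omega
  step t ht := by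
    by_cases h : IsRightStep lam t
    · exact Or.inl h
    · exact Or.inr (path_of_not_isRightStep lam ht h)

theorem cells_path : cells (path lam) (width lam + len lam) = shape lam := by
  ext q
  rw [mem_cells, mem_shape]
  refine and_congr_right fun hq => ⟨?_, fun h => ?_⟩
  · rintro ⟨t, ht, h1, h2⟩
    exact h1.trans (((path_spec lam ht).2.2.2.1 (by omega)).trans (part_anti lam h2))
  -- The cell is found under the point from which the path first drops below its row; there the path
  -- has passed the end of the row.
  · have hex : ∃ t, t ≤ width lam + len lam ∧ (path lam t).2 < q.2 :=
      ⟨_, le_rfl, by rw [(isDownRight_path lam).finish]; exact hq.2⟩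
    have hs := Nat.find_spec hex
    have hlen := ((Finset.mem_Icc.1 (Finset.mem_product.1 (Finset.mem_filter.1
      ((mem_shape lam).2 ⟨hq, h⟩)).1).2)).2
    obtain ⟨t, ht⟩ : ∃ t, Nat.find hex = t + 1 := by
      refine Nat.exists_eq_succ_of_ne_zero fun h0 => ?_
      rw [h0] at hs
      have : (path lam 0).2 = len lam := rfl
      omega
    have hmin := Nat.find_min hex (m := t) (by omega)
    rw [ht] at hs
    have hy : q.2 ≤ (path lam t).2 := by
      by_contra hy
      exact hmin ⟨by omega, by omega⟩
    refine ⟨t, by omega, ?_, hy⟩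
    have hnr : ¬ IsRightStep lam t := by
      intro hr
      rw [path_of_isRightStep lam hr] at hs
      simp only at hs
      omega
    have e := path_of_not_isRightStep lam (by omega) hnr
    have h5 := (path_spec lam hs.1).2.2.2.2
    have e2 := congrArg Prod.snd e
    simp only at e2
    rw [show (path lam (t + 1)).2 + 1 = q.2 by omega, path_fst_of_not_isRightStep lam hnr] at h5
    exact h.trans h5

theorem fst_path_mem_Icc {t : ℕ} (ht : t < width lam + len lam) (h : IsRightStep lam t) :
    (path lam (t + 1)).1 ∈ Finset.Icc 1 (width lam) := by
  have h3 := (path_spec lam (n := t + 1) ht).2.2.1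
  rw [Finset.mem_Icc]
  refine ⟨?_, h3⟩
  rw [path_of_isRightStep lam h]
  simp

theorem snd_path_mem_Icc {t : ℕ} (ht : t < width lam + len lam) (h : ¬ IsRightStep lam t) :
    (path lam t).2 ∈ Finset.Icc 1 (len lam) := by
  have h3 := (path_spec lam ht.le).1
  rw [Finset.mem_Icc]
  refine ⟨?_, h3⟩
  rw [path_of_not_isRightStep lam ht h]
  simp

/-- The parameter of the step `t` of the boundary path. -/
noncomputable def stepParam (a b : ℕ → ℝ) (t : ℕ) : ℝ :=
  if t < width lam + len lam then
    if IsRightStep lam t then a (path lam (t + 1)).1 else b (path lam t).2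
  -- Beyond the path the value 0 keeps all parameters in [0, 1) and puts no constraint on the radii.
  else 0

variable {lam} {a b : ℕ → ℝ}

theorem stepParam_mem (ha : ∀ i ∈ Finset.Icc 1 (width lam), 0 ≤ a i ∧ a i < 1)
    (hb : ∀ j ∈ Finset.Icc 1 (len lam), 0 ≤ b j ∧ b j < 1) (t : ℕ) :
    0 ≤ stepParam lam a b t ∧ stepParam lam a b t < 1 := by
  rw [stepParam]
  split_ifs with ht hr
  · exact ha _ (fst_path_mem_Icc lam ht hr)
  · exact hb _ (snd_path_mem_Icc lam ht hr)
  · simp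

variable (lam) in
/-- The number of particles at time `t`, with `m` of them in the initial configuration. -/
def particleCount (m t : ℕ) : ℕ := m + (path lam t).1

theorem particleCount_succ (m t : ℕ) : particleCount lam m (t + 1) =
    nextCount (IsRightStep lam) t (particleCount lam m t) := by
  rw [particleCount, particleCount, nextCount]
  split_ifs with h
  · rw [path_of_isRightStep lam h, Nat.add_assoc]
  · rw [path_fst_of_not_isRightStep lam h]

theorem particleCount_mono (m : ℕ) : Monotone (particleCount lam m) := by
  refine monotone_nat_of_le_succ fun t => ?_
  rw [particleCount_succ, nextCount]
  split_ifs <;> omega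

variable (lam) in
/-- The time at which the particle `i` enters. -/
noncomputable def birthTime (m i : ℕ) : ℕ := sInf {t | i < particleCount lam m (t + 1)}

theorem birthTime_of_lt {m i : ℕ} (hi : i < particleCount lam m 0) : birthTime lam m i = 0 :=
  Nat.sInf_eq_zero.2 (Or.inl (hi.trans_le (particleCount_mono m (Nat.zero_le _))))

theorem birthTime_particleCount {m t : ℕ} (h : IsRightStep lam t) :
    birthTime lam m (particleCount lam m t) = t := by
  have hmem : t ∈ {s | particleCount lam m t < particleCount lam m (s + 1)} := by
    simp only [Set.mem_ofPred_eq]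
    rw [particleCount_succ, nextCount, if_pos h]
    omega
  refine le_antisymm (Nat.sInf_le hmem) (le_csInf ⟨t, hmem⟩ fun s hs => ?_)
  by_contra hlt
  exact absurd (particleCount_mono (lam := lam) m (show s + 1 ≤ t by omega)) (not_le.2 hs)

theorem birthTime_lt {m s i : ℕ} (hs : 1 ≤ s) (hi : i < particleCount lam m s) :
    birthTime lam m i < s := by
  have : birthTime lam m i ≤ s - 1 := by
    refine Nat.sInf_le ?_
    simp only [Set.mem_ofPred_eq]
    rwa [Nat.sub_add_cancel hs]
  omega

theorem le_birthTime {m T s i : ℕ} (hT : 1 ≤ T) (hi : i < particleCount lam m T)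
    (hs : particleCount lam m s ≤ i) : s ≤ birthTime lam m i := by
  -- Nonemptiness matters: the infimum of the empty set would be 0.
  refine le_csInf ⟨T - 1, ?_⟩ fun u hu => ?_
  · simp only [Set.mem_ofPred_eq]
    rwa [Nat.sub_add_cancel hT]
  · simp only [Set.mem_ofPred_eq] at hu
    by_contra hlt
    have := particleCount_mono (lam := lam) m (show u + 1 ≤ s by omega)
    omega

end Boundary

/-! ## Geometric weights -/

section ArrayMeasure

variable {lam : YoungDiagram} {a b : ℕ → ℝ}

theorem arrayMeasure_singleton (ha : ∀ i ∈ Finset.Icc 1 (width lam), 0 ≤ a i ∧ a i < 1)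
    (hb : ∀ j ∈ Finset.Icc 1 (len lam), 0 ≤ b j ∧ b j < 1) (W : Arrays lam) :
    arrayMeasure lam a b {W} = ENNReal.ofReal ((∏ q ∈ shape lam, (1 - a q.1 * b q.2)) *
      ∏ q ∈ shape lam, (a q.1 * b q.2) ^ extend W q.1 q.2) := by
  have hq : ∀ q : shape lam, 0 ≤ a q.1.1 * b q.1.2 ∧ a q.1.1 * b q.1.2 < 1 := by
    intro q
    have h := Finset.mem_product.1 (Finset.mem_filter.1 q.2).1
    have h1 := ha _ h.1
    have h2 := hb _ h.2
    exact ⟨mul_nonneg h1.1 h2.1, mul_lt_one_of_nonneg_of_lt_one_left h1.1 h1.2 h2.2.le⟩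
  rw [arrayMeasure, ← Set.univ_pi_singleton, Measure.pi_pi, ← Finset.prod_mul_distrib,
    ← Finset.prod_coe_sort (shape lam)
      fun q => (1 - a q.1 * b q.2) * (a q.1 * b q.2) ^ extend W q.1 q.2,
    ENNReal.ofReal_prod_of_nonneg]
  · refine Finset.prod_congr rfl fun q _ => ?_
    have hmem : 1 - a q.1.1 * b q.1.2 ∈ Set.Icc (0 : ℝ) 1 :=
      ⟨by linarith [(hq q).2], by linarith [(hq q).1]⟩
    rw [Set.projIcc_of_mem zero_le_one hmem, geometricMeasure_singleton]
    · simp only [sub_sub_cancel, extend, dif_pos q.2]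
      rw [mul_comm]
    · intro h0
      have := congrArg Subtype.val h0
      simp only [Set.Icc.coe_zero] at this
      linarith [(hq q).2]
  · intro q _
    exact mul_nonneg (by linarith [(hq q).2]) (pow_nonneg (hq q).1 _)

end ArrayMeasure


/-! ## Particle configurations -/

section Profile

/-- The positions `σ k - k`, `k < N`, in increasing order. -/
def profile (N : ℕ) (σ : ℕ → ℕ) (j : Fin N) : ℤ := σ (N - 1 - j) + packed N j

/-- The set of positions `σ k - k`, `k < N`. -/
def profileSet (N : ℕ) (σ : ℕ → ℕ) : Finset ℤ := Finset.univ.image (profile N σ)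

variable {N : ℕ} {σ σ' : ℕ → ℕ}

theorem profile_strictMono (hσ : Antitone σ) : StrictMono (profile N σ) := by
  intro i j hij
  have h1 : σ (N - 1 - i) ≤ σ (N - 1 - j) := hσ (by have : (i : ℕ) < j := hij; omega)
  have h2 : (i : ℕ) < j := hij
  simp only [profile, packed]
  omega

theorem profile_mem (j : Fin N) : profile N σ j ∈ profileSet N σ :=
  Finset.mem_image_of_mem _ (Finset.mem_univ _)

theorem mem_profileSet {y : ℤ} : y ∈ profileSet N σ ↔ ∃ k < N, y = (σ k : ℤ) - k := by
  simp only [profileSet, Finset.mem_image, Finset.mem_univ, true_and]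
  constructor
  · rintro ⟨j, rfl⟩
    refine ⟨N - 1 - j, by have := j.2; omega, ?_⟩
    rw [profile, packed_eq]
    ring
  · rintro ⟨k, hk, rfl⟩
    refine ⟨⟨N - 1 - k, by omega⟩, ?_⟩
    have : N - 1 - (N - 1 - k) = k := by omega
    rw [profile, packed_eq]
    simp only [this]
    ring

theorem card_profileSet (hσ : Antitone σ) : (profileSet N σ).card = N := by
  rw [profileSet, Finset.card_image_of_injective _ (profile_strictMono hσ).injective,
    Finset.card_univ, Fintype.card_fin]

theorem sortedTuple_profileSet (hσ : Antitone σ) :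
    sortedTuple N (profileSet N σ) = profile N σ :=
  sortedTuple_eq (card_profileSet hσ) (profile_strictMono hσ) profile_mem

theorem prod_profileSet (hσ : Antitone σ) (f : ℤ → ℝ) :
    ∏ y ∈ profileSet N σ, f y = ∏ j, f (profile N σ j) :=
  Finset.prod_image fun _ _ _ _ h => (profile_strictMono hσ).injective h

theorem profile_zero : profile N 0 = packed N := by
  funext j
  simp [profile]

/-- The entering particle is simply the next height -N of the same configuration, so an up-step
compares two profiles of equal length. -/
theorem cons_profile (h0 : σ N = 0) :
    (Fin.cons (-(N : ℤ)) (profile N σ) : Fin (N + 1) → ℤ) = profile (N + 1) σ := by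
  funext i
  refine Fin.cases ?_ (fun i => ?_) i
  · simp [profile, packed, h0]
  · have : N + 1 - 1 - (i + 1) = N - 1 - (i : ℕ) := by omega
    simp only [Fin.cons_succ, profile, packed, Fin.val_succ, this]
    push_cast
    ring

theorem profileSet_injective (hσ : Antitone σ) (hσ' : Antitone σ') (h0 : ∀ k, N ≤ k → σ k = 0)
    (h0' : ∀ k, N ≤ k → σ' k = 0) (h : profileSet N σ = profileSet N σ') : σ = σ' := by
  have h1 : profile N σ = profile N σ' := by
    rw [← sortedTuple_profileSet hσ, h, sortedTuple_profileSet hσ']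
  funext k
  by_cases hk : k < N
  · have := congrFun h1 ⟨N - 1 - k, by omega⟩
    have hk' : N - 1 - (N - 1 - k) = k := by omega
    simp only [profile, hk'] at this
    omega
  · rw [h0 k (by omega), h0' k (by omega)]

/-- The gaps between distinct integers are at least 1, so the differences between the sorted
positions and the packed ones are nonnegative and monotone. -/
theorem exists_profileSet_eq {S : Finset ℤ} (hS : S.card = N) (hpos : ∀ y ∈ S, -(N : ℤ) < y) :
    ∃ σ : ℕ → ℕ, Antitone σ ∧ (∀ k, N ≤ k → σ k = 0) ∧ profileSet N σ = S := by
  set x := sortedTuple N S with hx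
  have hmono := sortedTuple_strictMono hS
  have hlow : ∀ j : Fin N, packed N j ≤ x j := by
    intro j
    obtain ⟨j, hj⟩ := j
    induction j with
    | zero =>
      have := hpos _ (sortedTuple_mem hS ⟨0, hj⟩)
      simp only [packed]
      rw [← hx] at this
      push_cast
      omega
    | succ j ih =>
      have h1 := ih (by omega)
      have h2 : x ⟨j, by omega⟩ < x ⟨j + 1, hj⟩ := hmono (by simp)
      simp only [packed] at h1 ⊢
      push_cast at h1 ⊢
      omega
  have hstep : ∀ k (hk : k + 1 < N), x ⟨N - 1 - (k + 1), by omega⟩ - packed N ⟨N - 1 - (k + 1),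
      by omega⟩ ≤ x ⟨N - 1 - k, by omega⟩ - packed N ⟨N - 1 - k, by omega⟩ := by
    intro k hk
    have h2 : x ⟨N - 1 - (k + 1), by omega⟩ < x ⟨N - 1 - k, by omega⟩ :=
      hmono (by rw [Fin.mk_lt_mk]; omega)
    simp only [packed]
    omega
  refine ⟨fun k => if hk : k < N then (x ⟨N - 1 - k, by omega⟩ - packed N ⟨N - 1 - k,
    by omega⟩).toNat else 0, antitone_nat_of_succ_le fun k => ?_, fun k hk => dif_neg (by omega), ?_⟩
  · by_cases hk : k + 1 < N
    · rw [dif_pos hk, dif_pos (by omega)]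
      exact Int.toNat_le_toNat (hstep k hk)
    · rw [dif_neg hk]
      exact Nat.zero_le _
  · refine Finset.eq_of_subset_of_card_le ?_ ?_
    · intro y hy
      obtain ⟨k, hk, rfl⟩ := mem_profileSet.1 hy
      rw [dif_pos hk, Int.toNat_of_nonneg (sub_nonneg.2 (hlow _))]
      convert sortedTuple_mem hS ⟨N - 1 - k, by omega⟩ using 1
      have : N - 1 - (N - 1 - k) = k := by omega
      rw [packed_eq]
      simp only [this]
      rw [← hx]
      ring
    · rw [card_profileSet, hS]
      refine antitone_nat_of_succ_le fun k => ?_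
      by_cases hk : k + 1 < N
      · rw [dif_pos hk, dif_pos (by omega)]
        exact Int.toNat_le_toNat (hstep k hk)
      · rw [dif_neg hk]
        exact Nat.zero_le _

/-- The shift by `k` turns one of the two weak inequalities of interlacing into a strict one, as it
appears in `det_geometric_step`. -/
theorem profile_interlace_iff {α ν : ℕ → ℕ} (hν : Antitone ν)
    (hα0 : ∀ k, N ≤ k → α k = 0) (hν0 : ∀ k, N ≤ k → ν k = 0) :
    ((∀ i, profile N α i ≤ profile N ν i) ∧
      ∀ i j : Fin N, i < j → profile N ν i < profile N α j) ↔ Interlace α ν := by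
  constructor
  · rintro ⟨h1, h2⟩ k
    constructor
    · by_cases hk : k < N
      · have := h1 ⟨N - 1 - k, by omega⟩
        have hk' : N - 1 - (N - 1 - k) = k := by omega
        simp only [profile, hk'] at this
        omega
      · rw [hα0 k (by omega)]
        exact Nat.zero_le _
    · by_cases hk : k + 1 < N
      · have := h2 ⟨N - 1 - (k + 1), by omega⟩ ⟨N - 1 - k, by omega⟩
          (by rw [Fin.mk_lt_mk]; omega)
        have hk1 : N - 1 - (N - 1 - k) = k := by omega
        have hk2 : N - 1 - (N - 1 - (k + 1)) = k + 1 := by omega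
        simp only [profile, packed, hk1, hk2] at this
        omega
      · rw [hν0 (k + 1) (by omega)]
        exact Nat.zero_le _
  · intro h
    refine ⟨fun i => ?_, fun i j hij => ?_⟩
    · have := (h (N - 1 - i)).1
      simp only [profile]
      omega
    · have hij' : (i : ℕ) < j := hij
      have h1 := (h (N - 1 - j)).2
      have h2 := hν (show N - 1 - (j : ℕ) + 1 ≤ N - 1 - i by omega)
      simp only [profile, packed]
      omega

theorem prod_pow_profile {α ν : ℕ → ℕ} (h : ∀ k, α k ≤ ν k) (q : ℝ) :
    ∏ i : Fin N, q ^ (profile N ν i - profile N α i).toNat =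
      q ^ (∑ k ∈ Finset.range N, ν k - ∑ k ∈ Finset.range N, α k) := by
  rw [Finset.prod_pow_eq_pow_sum, ← Finset.sum_tsub_distrib _ fun k _ => h k,
    ← sum_fin_reflect N fun k => ν k - α k]
  congr 1
  refine Finset.sum_congr rfl fun i _ => ?_
  have := h (N - 1 - i)
  simp only [profile]
  omega

end Profile

/-! ## One-step weights -/

section StepWeights

variable {up : ℕ → Prop} [DecidablePred up] {c : ℕ → ℝ} {t n : ℕ}

theorem det_stepCoef_of_up (hup : up t) {x y : Fin n → ℤ} (hx : StrictMono x)
    (hy : StrictMono y) : Matrix.det (Matrix.of fun i j => stepCoef up c t (y j - x i)) =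
    (1 - c t) ^ n * if (∀ i, x i ≤ y i) ∧ (∀ i j : Fin n, i < j → y i < x j) then
      ∏ i, c t ^ (y i - x i).toNat else 0 := by
  rw [← det_geometric_step (c t) n x y hx hy]
  refine Eq.trans ?_ ((Matrix.det_smul _ (1 - c t)).trans (by rw [Fintype.card_fin]))
  congr 1
  ext i j
  simp only [Matrix.of_apply, Matrix.smul_apply, smul_eq_mul, stepCoef, if_pos hup, sub_nonneg,
    mul_ite, mul_zero]

/-- A down-step is an up-step run backwards: transpose and exchange `x` and `y`. -/
theorem det_stepCoef_of_not_up (hup : ¬ up t) {x y : Fin n → ℤ} (hx : StrictMono x)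
    (hy : StrictMono y) : Matrix.det (Matrix.of fun i j => stepCoef up c t (y j - x i)) =
    (1 - c t) ^ n * if (∀ i, y i ≤ x i) ∧ (∀ i j : Fin n, i < j → x i < y j) then
      ∏ i, c t ^ (x i - y i).toNat else 0 := by
  rw [← det_geometric_step (c t) n y x hy hx, ← Matrix.det_transpose]
  refine Eq.trans ?_ ((Matrix.det_smul _ (1 - c t)).trans (by rw [Fintype.card_fin]))
  congr 1
  ext i j
  simp only [Matrix.of_apply, Matrix.smul_apply, smul_eq_mul, stepCoef, if_neg hup, sub_nonpos,
    mul_ite, mul_zero, neg_sub, Matrix.transpose_apply]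

/-- An up-step is impossible if a particle does not lie above the entering one. -/
theorem det_stepCoef_cons_eq_zero (hup : up t) {x : Fin n → ℤ} {y : Fin (n + 1) → ℤ} (i : Fin n)
    (hx : x i ≤ -n) (hy : ∀ j, -(n : ℤ) ≤ y j) :
    Matrix.det (Matrix.of fun k j => stepCoef up c t
      (y j - (Fin.cons (-(n : ℤ)) x : Fin (n + 1) → ℤ) k)) = 0 := by
  -- Since all targets lie above both starting points, the row of `x i` is a power of `c t` times
  -- the row of the entering particle.
  refine Matrix.exists_vecMul_eq_zero_iff.1
    ⟨Pi.single i.succ 1 - c t ^ (-(n : ℤ) - x i).toNat • Pi.single 0 1, fun h => ?_, ?_⟩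
  · have := congrFun h i.succ
    simp [Fin.succ_ne_zero] at this
  · rw [Matrix.sub_vecMul, Matrix.smul_vecMul, Matrix.single_one_vecMul, Matrix.single_one_vecMul]
    funext j
    have hj := hy j
    have e : (y j - x i).toNat = (-(n : ℤ) - x i).toNat + (y j - -(n : ℤ)).toNat := by omega
    simp only [Pi.sub_apply, Pi.smul_apply, Matrix.row_apply, Matrix.of_apply, Fin.cons_succ,
      Fin.cons_zero, stepCoef, if_pos hup, smul_eq_mul, Pi.zero_apply]
    rw [if_pos (by omega), if_pos (by omega), e, pow_add]
    ring

variable {φ : ℕ → ℤ → ℤ → ℝ} {h : ℕ → ℤ → ℝ} {X : Finset ℤ} {s s' : Finset ℤ}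

theorem stepDet_of_up (hup : up t) (hX : -(n : ℤ) ∈ X) (hs : s ∈ X.powersetCard n)
    (hs' : s' ∈ X.powersetCard (n + 1)) : stepDet up φ h X t n s s' =
      (∏ j, h (t + 1) (sortedTuple (n + 1) s' j)) * Matrix.det (Matrix.of fun i j =>
        φ t ((Fin.cons (-(n : ℤ)) (sortedTuple n s) : Fin (n + 1) → ℤ) i)
          (sortedTuple (n + 1) s' j)) := by
  rw [Finset.mem_powersetCard] at hs hs'
  rw [stepDet, if_pos hup, ← Matrix.det_mul_row]
  congr 1
  ext i j
  simp only [Matrix.of_apply]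
  have hy := hs'.1 (sortedTuple_mem hs'.2 j)
  refine Fin.cases ?_ (fun i => ?_) i
  · rw [Matrix.cons_val_zero, stepMap_single _ _ _ hX hy, Fin.cons_zero, mul_comm]
  · rw [Matrix.cons_val_succ, stepMap_single _ _ _ (hs.1 (sortedTuple_mem hs.2 i)) hy,
      Fin.cons_succ, mul_comm]

theorem stepDet_of_not_up (hup : ¬ up t) (hs : s ∈ X.powersetCard n)
    (hs' : s' ∈ X.powersetCard n) : stepDet up φ h X t n s s' =
      (∏ j, h (t + 1) (sortedTuple n s' j)) * Matrix.det (Matrix.of fun i j =>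
        φ t (sortedTuple n s i) (sortedTuple n s' j)) := by
  rw [Finset.mem_powersetCard] at hs hs'
  rw [stepDet, if_neg hup, ← Matrix.det_mul_row]
  congr 1
  ext i j
  simp only [Matrix.of_apply]
  rw [stepMap_single _ _ _ (hs.1 (sortedTuple_mem hs.2 i)) (hs'.1 (sortedTuple_mem hs'.2 j)),
    mul_comm]

open Classical in
theorem stepDet_profileSet_of_up (hup : up t) {n' : ℕ} (hn : n' = n + 1) {α ν : ℕ → ℕ} (hX : -(n : ℤ) ∈ X)
    (hα : Antitone α) (hν : Antitone ν) (hα0 : ∀ k, n ≤ k → α k = 0)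
    (hν0 : ∀ k, n' ≤ k → ν k = 0) (hs : profileSet n α ⊆ X) (hs' : profileSet n' ν ⊆ X) :
    stepDet up (fun t x y => stepCoef up c t (y - x)) h X t n (profileSet n α)
      (profileSet n' ν) = (∏ y ∈ profileSet n' ν, h (t + 1) y) * ((1 - c t) ^ n' *
        if Interlace α ν then c t ^ (∑ k ∈ Finset.range n', ν k -
          ∑ k ∈ Finset.range n', α k) else 0) := by
  subst hn
  rw [stepDet_of_up hup hX (Finset.mem_powersetCard.2 ⟨hs, card_profileSet hα⟩)
    (Finset.mem_powersetCard.2 ⟨hs', card_profileSet hν⟩), prod_profileSet hν,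
    sortedTuple_profileSet hα, sortedTuple_profileSet hν, cons_profile (hα0 n le_rfl),
    det_stepCoef_of_up hup (profile_strictMono hα) (profile_strictMono hν)]
  have hiff := profile_interlace_iff (N := n + 1) hν (fun k hk => hα0 k (by omega)) hν0
  congr 2
  by_cases hI : Interlace α ν
  · rw [if_pos (hiff.2 hI), if_pos hI, prod_pow_profile fun k => (hI k).1]
  · rw [if_neg (fun h' => hI (hiff.1 h')), if_neg hI]

open Classical in
theorem stepDet_profileSet_of_not_up (hup : ¬ up t) {n' : ℕ} (hn : n' = n) {α ν : ℕ → ℕ}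
    (hα : Antitone α) (hν : Antitone ν) (hα0 : ∀ k, n ≤ k → α k = 0)
    (hν0 : ∀ k, n' ≤ k → ν k = 0) (hs : profileSet n α ⊆ X) (hs' : profileSet n' ν ⊆ X) :
    stepDet up (fun t x y => stepCoef up c t (y - x)) h X t n (profileSet n α)
      (profileSet n' ν) = (∏ y ∈ profileSet n' ν, h (t + 1) y) * ((1 - c t) ^ n' *
        if Interlace ν α then c t ^ (∑ k ∈ Finset.range n', α k -
          ∑ k ∈ Finset.range n', ν k) else 0) := by
  subst hn
  rw [stepDet_of_not_up hup (Finset.mem_powersetCard.2 ⟨hs, card_profileSet hα⟩)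
    (Finset.mem_powersetCard.2 ⟨hs', card_profileSet hν⟩), prod_profileSet hν,
    sortedTuple_profileSet hα, sortedTuple_profileSet hν,
    det_stepCoef_of_not_up hup (profile_strictMono hα) (profile_strictMono hν)]
  have hiff := profile_interlace_iff (N := n') hα hν0 hα0
  congr 2
  by_cases hI : Interlace ν α
  · rw [if_pos (hiff.2 hI), if_pos hI, prod_pow_profile fun k => (hI k).1]
  · rw [if_neg (fun h' => hI (hiff.1 h')), if_neg hI]

/-- If a transition has non-zero weight and the new configuration is not below the densely packed
one, then neither is the old one. -/
theorem neg_lt_of_stepDet_ne_zero {n' : ℕ} (hn' : n' = nextCount up t n) (hX : -(n : ℤ) ∈ X)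
    (hs : s ∈ X.powersetCard n) (hs' : s' ∈ X.powersetCard n')
    (hne : stepDet up (fun t x y => stepCoef up c t (y - x)) h X t n s s' ≠ 0)
    (hpos : ∀ y ∈ s', -(n' : ℤ) < y) : ∀ y ∈ s, -(n : ℤ) < y := by
  intro x hx
  by_cases hup : up t
  · rw [nextCount, if_pos hup] at hn'
    subst hn'
    rw [stepDet_of_up hup hX hs hs'] at hne
    by_contra hcon
    rw [Finset.mem_powersetCard] at hs hs'
    obtain ⟨i, hi⟩ := exists_sortedTuple_eq hs.2 hx
    refine hne (mul_eq_zero_of_right _ (det_stepCoef_cons_eq_zero hup i (by omega) fun j => ?_))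
    have := hpos _ (sortedTuple_mem hs'.2 j)
    push_cast at this
    omega
  · rw [nextCount, if_neg hup] at hn'
    subst hn'
    rw [stepDet_of_not_up hup hs hs'] at hne
    rw [Finset.mem_powersetCard] at hs hs'
    rw [det_stepCoef_of_not_up hup (sortedTuple_strictMono hs.2)
      (sortedTuple_strictMono hs'.2)] at hne
    obtain ⟨i, hi⟩ := exists_sortedTuple_eq hs.2 hx
    have hle : ∀ i, sortedTuple n' s' i ≤ sortedTuple n' s i := by
      by_contra hcon
      rw [if_neg fun h' => hcon h'.1] at hne
      simp at hne
    have := hpos _ (sortedTuple_mem hs'.2 i)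
    have := hle i
    omega

/-- A particle outside the packed sites produces a zero row. -/
theorem eq_profileSet_of_finalWeight_ne_zero (hs : s.card = n) (hne : finalWeight n s ≠ 0) :
    s = profileSet n 0 := by
  refine Finset.eq_of_subset_of_card_le (fun x hx => ?_) ?_
  · obtain ⟨i, rfl⟩ := exists_sortedTuple_eq hs hx
    by_contra hcon
    refine hne (Matrix.det_eq_zero_of_row_eq_zero i fun j => ?_)
    rw [Matrix.of_apply, Pi.single_apply, if_neg]
    intro h
    apply hcon
    rw [← h, ← profile_zero]
    exact profile_mem j
  · rw [hs, card_profileSet (fun _ _ _ => le_rfl)]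

theorem finalWeight_profileSet_zero : finalWeight n (profileSet n 0) = 1 := by
  rw [finalWeight, sortedTuple_profileSet (fun _ _ _ => le_rfl)]
  refine Eq.trans (congrArg Matrix.det ?_) Matrix.det_one
  ext i j
  rw [profile_zero, Matrix.of_apply, Pi.single_apply, Matrix.one_apply]
  have : packed n j = packed n i ↔ i = j := by
    rw [Fin.ext_iff]
    simp only [packed]
    omega
  simp only [this]

end StepWeights


/-! ## Total weights as sums over arrays -/

section ArraySums

variable {lam : YoungDiagram}

/-- The iterated last-passage values at the point `t` of the boundary path. -/
def boundarySeq (W : Arrays lam) (t k : ℕ) : ℕ := passageIter W k (path lam t).1 (path lam t).2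

theorem boundarySeq_eq (W : Arrays lam) (t k : ℕ) :
    boundarySeq W t k = iterPassage (extend W) k (path lam t).1 (path lam t).2 := rfl

theorem iterPassage_antitone (w : ℕ → ℕ → ℕ) (i j : ℕ) :
    Antitone fun k => iterPassage w k i j :=
  antitone_nat_of_succ_le fun k =>
    (iterPassage_le_succ_left w (k + 1) i j).trans (iterPassage_succ_left_le w k i j)

theorem boundarySeq_antitone (W : Arrays lam) (t : ℕ) : Antitone (boundarySeq W t) :=
  iterPassage_antitone _ _ _

theorem boundarySeq_eq_zero (W : Arrays lam) {m t k : ℕ} (hk : particleCount lam m t ≤ k) :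
    boundarySeq W t k = 0 :=
  iterPassage_eq_zero _ _ (by rw [particleCount] at hk; omega)

/-- The first `m + x` heights at the point `(x, y)` of the boundary path. -/
def heightSet (m : ℕ) (W : Arrays lam) (t : ℕ) : Finset ℤ :=
  profileSet (particleCount lam m t) (boundarySeq W t)

theorem card_heightSet (m : ℕ) (W : Arrays lam) (t : ℕ) :
    (heightSet m W t).card = particleCount lam m t :=
  card_profileSet (boundarySeq_antitone W t)

theorem isInterlaced_boundarySeq (W : Arrays lam) :
    IsInterlaced (path lam) (width lam + len lam) (boundarySeq W) :=
  isInterlaced_iterPassage (isDownRight_path lam) (extend W)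

theorem exists_boundarySeq_eq {σ : ℕ → ℕ → ℕ}
    (hσ : IsInterlaced (path lam) (width lam + len lam) σ) :
    ∃ W : Arrays lam, ∀ t ≤ width lam + len lam, boundarySeq W t = σ t := by
  obtain ⟨w, hw, hG⟩ := exists_iterPassage_eq _ (isDownRight_path lam) σ hσ
  rw [cells_path] at hw
  have hext : extend (fun q : shape lam => w q.1.1 q.1.2) = w := by
    funext i j
    rw [extend]
    split_ifs with h
    · rfl
    · exact (hw i j h).symm
  refine ⟨fun q => w q.1.1 q.1.2, fun t ht => ?_⟩
  funext k
  rw [boundarySeq_eq, hext]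
  exact hG t ht k

theorem arrays_ext_of_boundarySeq {W W' : Arrays lam}
    (h : ∀ t ≤ width lam + len lam, boundarySeq W t = boundarySeq W' t) : W = W' := by
  funext q
  have := eq_on_cells_of_iterPassage_eq (extend W) (extend W') _ (isDownRight_path lam)
    (fun t ht k => congrFun (h t ht) k) q.1 (by rw [cells_path]; exact q.2)
  simpa [extend] using this

theorem sum_boundarySeq (W : Arrays lam) {m t N B : ℕ} (hN : particleCount lam m t ≤ N)
    (hB : N ≤ B) : ∑ k ∈ Finset.range N, boundarySeq W t k =
      iterSum (extend W) B (path lam t).1 (path lam t).2 := by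
  refine Finset.sum_subset (Finset.range_mono hB) fun k _ hk => ?_
  rw [Finset.mem_range] at hk
  exact boundarySeq_eq_zero W (m := m) (by omega)

/-- The configurations at times `0, …, T`, from the ones at times `1, …, T`. -/
def trajectory (s : Finset ℤ) {T : ℕ} (f : Fin T → Finset ℤ) (t : ℕ) : Finset ℤ :=
  if ht : t < T + 1 then (Fin.cons s f : Fin (T + 1) → Finset ℤ) ⟨t, ht⟩ else ∅

theorem trajectory_zero (s : Finset ℤ) {T : ℕ} (f : Fin T → Finset ℤ) :
    trajectory s f 0 = s := by
  rw [trajectory, dif_pos (Nat.succ_pos T)]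
  rfl

theorem trajectory_succ (s : Finset ℤ) {T : ℕ} (f : Fin T → Finset ℤ) {t : ℕ} (ht : t < T) :
    trajectory s f (t + 1) = f ⟨t, ht⟩ := by
  rw [trajectory, dif_pos (Nat.succ_lt_succ ht)]
  rfl

theorem configForm_eq_sum_trajectory (up : ℕ → Prop) [DecidablePred up] (φ : ℕ → ℤ → ℤ → ℝ)
    (h : ℕ → ℤ → ℝ) (X : Finset ℤ) {nn : ℕ → ℕ} (hnn : ∀ t, nn (t + 1) = nextCount up t (nn t))
    (T : ℕ) (s : Finset ℤ) :
    configForm up φ h X T 0 (nn 0) (fun i => Pi.single (sortedTuple (nn 0) s i) 1) =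
      ∑ f ∈ Fintype.piFinset (fun i : Fin T => X.powersetCard (nn (i + 1))),
        (∏ i : Fin T, stepDet up φ h X i (nn i) (trajectory s f i) (trajectory s f (i + 1))) *
          finalWeight (nn T) (trajectory s f T) := by
  rw [configForm_eq_sum up φ h X hnn]
  simp only [zero_add]
  refine Finset.sum_congr rfl fun f _ => ?_
  congr 1
  · refine Finset.prod_congr rfl fun i _ => ?_
    rw [trajectory_succ s f i.2, trajectory, dif_pos (i.2.trans (Nat.lt_succ_self T))]
    rfl
  · rw [trajectory, dif_pos (Nat.lt_succ_self T)]
    rfl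

variable {a b : ℕ → ℝ} {m : ℕ}

/-- The trajectory of the height sets of an array. -/
def heightPath (m : ℕ) (W : Arrays lam) (i : Fin (width lam + len lam)) : Finset ℤ :=
  heightSet m W (i + 1)

theorem heightSet_zero (W : Arrays lam) :
    heightSet m W 0 = profileSet (particleCount lam m 0) 0 := by
  rw [heightSet]
  congr 1
  funext k
  exact (isInterlaced_boundarySeq W).start k

theorem heightSet_last (W : Arrays lam) : heightSet m W (width lam + len lam) =
    profileSet (particleCount lam m (width lam + len lam)) 0 := by
  rw [heightSet]
  congr 1
  funext k
  exact (isInterlaced_boundarySeq W).finish k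

theorem trajectory_heightPath (W : Arrays lam) {t : ℕ} (ht : t ≤ width lam + len lam) :
    trajectory (profileSet (particleCount lam m 0) 0) (heightPath m W) t = heightSet m W t := by
  cases t with
  | zero => rw [trajectory_zero, heightSet_zero]
  | succ t =>
    rw [trajectory_succ _ _ (by omega : t < width lam + len lam)]
    rfl

theorem heightPath_injective : Function.Injective (heightPath (lam := lam) m) := by
  intro W W' h
  refine arrays_ext_of_boundarySeq fun t ht => ?_
  cases t with
  | zero =>
    funext k
    rw [(isInterlaced_boundarySeq W).start k, (isInterlaced_boundarySeq W').start k]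
  | succ t =>
    exact profileSet_injective (boundarySeq_antitone W _) (boundarySeq_antitone W' _)
      (fun k hk => boundarySeq_eq_zero W hk) (fun k hk => boundarySeq_eq_zero W' hk)
      (congrFun h ⟨t, ht⟩)

variable {h : ℕ → ℤ → ℝ} {X : Finset ℤ}

theorem stepDet_heightSet (hX : ∀ k ≤ particleCount lam m (width lam + len lam), -(k : ℤ) ∈ X)
    (W : Arrays lam) {t : ℕ} (ht : t < width lam + len lam) (hs : heightSet m W t ⊆ X)
    (hs' : heightSet m W (t + 1) ⊆ X) :
    stepDet (IsRightStep lam) (fun t x y => stepCoef (IsRightStep lam) (stepParam lam a b) t (y - x))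
      h X t (particleCount lam m t) (heightSet m W t) (heightSet m W (t + 1)) =
      (1 - stepParam lam a b t) ^ particleCount lam m (t + 1) *
        stepWeight a b (extend W) (particleCount lam m (width lam + len lam)) (path lam) t *
        ∏ y ∈ heightSet m W (t + 1), h (t + 1) y := by
  have hW := isInterlaced_boundarySeq W
  have hle := particleCount_mono (lam := lam) m (show t + 1 ≤ width lam + len lam from ht)
  have hle' := particleCount_mono (lam := lam) m (show t ≤ t + 1 by omega)
  have hsum := sum_boundarySeq W (t := t) hle' hle
  have hsum' := sum_boundarySeq W (t := t + 1) le_rfl hle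
  have hn := particleCount_succ (lam := lam) m t
  rw [nextCount] at hn
  by_cases hr : IsRightStep lam t
  · rw [if_pos hr] at hn
    rw [heightSet, heightSet, stepDet_profileSet_of_up hr hn (hX _ (by omega))
      (boundarySeq_antitone W _) (boundarySeq_antitone W _)
      (fun k hk => boundarySeq_eq_zero W hk) (fun k hk => boundarySeq_eq_zero W hk) hs hs',
      if_pos (hW.right t ht hr), hsum, hsum', stepWeight, if_pos (path_of_isRightStep lam hr),
      stepParam, if_pos ht, if_pos hr]
    ring
  · rw [if_neg hr] at hn
    rw [heightSet, heightSet, stepDet_profileSet_of_not_up hr hn (boundarySeq_antitone W _)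
      (boundarySeq_antitone W _) (fun k hk => boundarySeq_eq_zero W hk)
      (fun k hk => boundarySeq_eq_zero W hk) hs hs',
      if_pos (hW.down t ht (path_of_not_isRightStep lam ht hr)), hsum, hsum', stepWeight,
      if_neg (fun h : _ = _ => hr h), stepParam, if_pos ht, if_neg hr]
    ring

/-- A trajectory of non-zero weight is the trajectory of an array. -/
theorem exists_heightPath_eq
    (hX : ∀ k ≤ particleCount lam m (width lam + len lam), -(k : ℤ) ∈ X)
    {f : Fin (width lam + len lam) → Finset ℤ}
    (hf : f ∈ Fintype.piFinset fun i : Fin (width lam + len lam) =>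
      X.powersetCard (particleCount lam m (i + 1)))
    (hne : (∏ i : Fin (width lam + len lam), stepDet (IsRightStep lam)
      (fun t x y => stepCoef (IsRightStep lam) (stepParam lam a b) t (y - x)) h X i
      (particleCount lam m i) (trajectory (profileSet (particleCount lam m 0) 0) f i)
      (trajectory (profileSet (particleCount lam m 0) 0) f (i + 1))) *
      finalWeight (particleCount lam m (width lam + len lam))
        (trajectory (profileSet (particleCount lam m 0) 0) f (width lam + len lam)) ≠ 0) :
    ∃ W, heightPath m W = f := by
  set nn := particleCount lam m with hnn
  set S := trajectory (profileSet (nn 0) 0) f with hS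
  have hmem : ∀ t ≤ (width lam + len lam), S t ∈ X.powersetCard (nn t) := by
    intro t ht
    cases t with
    | zero =>
      rw [hS, trajectory_zero, Finset.mem_powersetCard]
      refine ⟨fun y hy => ?_, card_profileSet fun _ _ _ => le_rfl⟩
      obtain ⟨k, hk, rfl⟩ := mem_profileSet.1 hy
      have := hX k (hk.le.trans (particleCount_mono m (Nat.zero_le _)))
      simpa using this
    | succ t =>
      rw [hS, trajectory_succ _ _ ht]
      exact Fintype.mem_piFinset.1 hf ⟨t, ht⟩
  have hstep : ∀ t < (width lam + len lam), stepDet (IsRightStep lam)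
      (fun t x y => stepCoef (IsRightStep lam) (stepParam lam a b) t (y - x)) h X t
      (nn t) (S t) (S (t + 1)) ≠ 0 := fun t ht =>
    Finset.prod_ne_zero_iff.1 (left_ne_zero_of_mul hne) ⟨t, ht⟩ (Finset.mem_univ _)
  have hlast : S (width lam + len lam) = profileSet (nn (width lam + len lam)) 0 :=
    eq_profileSet_of_finalWeight_ne_zero (Finset.mem_powersetCard.1 (hmem (width lam + len lam) le_rfl)).2
      (right_ne_zero_of_mul hne)
  have hXt : ∀ t ≤ (width lam + len lam), -(nn t : ℤ) ∈ X := fun t ht => hX _ (particleCount_mono m ht)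
  -- The lower bound holds for the packed final configuration and is carried backwards in time
  -- through transitions of nonzero weight.
  have hpos : ∀ t ≤ (width lam + len lam), ∀ y ∈ S t, -(nn t : ℤ) < y := by
    intro t ht
    induction hd : (width lam + len lam) - t generalizing t with
    | zero =>
      obtain rfl : t = width lam + len lam := by omega
      intro y hy
      rw [hlast] at hy
      obtain ⟨k, hk, rfl⟩ := mem_profileSet.1 hy
      simp only [Pi.zero_apply]
      push_cast
      omega
    | succ d ih =>
      exact neg_lt_of_stepDet_ne_zero (particleCount_succ m t) (hXt t ht) (hmem t ht)
        (hmem (t + 1) (by omega)) (hstep t (by omega)) (ih (t + 1) (by omega) (by omega))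
  have hex : ∀ t, ∃ σ : ℕ → ℕ, t ≤ (width lam + len lam) →
      (Antitone σ ∧ (∀ k, nn t ≤ k → σ k = 0) ∧ profileSet (nn t) σ = S t) := by
    intro t
    by_cases ht : t ≤ (width lam + len lam)
    · obtain ⟨σ, hσ⟩ := exists_profileSet_eq (Finset.mem_powersetCard.1 (hmem t ht)).2 (hpos t ht)
      exact ⟨σ, fun _ => hσ⟩
    · exact ⟨0, fun h => absurd h ht⟩
  choose σ hσ using hex
  have hsub : ∀ t ≤ (width lam + len lam), profileSet (nn t) (σ t) ⊆ X := by
    intro t ht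
    rw [(hσ t ht).2.2]
    exact (Finset.mem_powersetCard.1 (hmem t ht)).1
  have hz : ∀ t ≤ (width lam + len lam), S t = profileSet (nn t) 0 → σ t = 0 := fun t ht h0 =>
    profileSet_injective (hσ t ht).1 (fun _ _ _ => le_rfl) (hσ t ht).2.1 (fun _ _ => rfl)
      ((hσ t ht).2.2.trans h0)
  have hint : IsInterlaced (path lam) (width lam + len lam) σ := by
    refine ⟨fun k => ?_, fun k => ?_, fun t ht hr => ?_, fun t ht hd => ?_⟩
    · rw [hz 0 (Nat.zero_le _) (trajectory_zero _ _)]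
      rfl
    · rw [hz (width lam + len lam) le_rfl hlast]
      rfl
    · have hr' : IsRightStep lam t := hr
      have hn : nn (t + 1) = nn t + 1 := by
        have := particleCount_succ (lam := lam) m t
        rwa [nextCount, if_pos hr'] at this
      have h1 := hσ t ht.le
      have h2 := hσ (t + 1) ht
      have h3 := hsub t ht.le
      have h4 := hsub (t + 1) ht
      have hs := hstep t ht
      rw [← h1.2.2, ← h2.2.2] at hs
      rw [stepDet_profileSet_of_up hr' hn (hXt t ht.le) h1.1 h2.1 h1.2.1 h2.2.1 h3 h4] at hs
      by_contra hI
      rw [if_neg hI] at hs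
      simp at hs
    · have hr' : ¬ IsRightStep lam t := by
        intro hr
        have e1 := congrArg Prod.fst (path_of_isRightStep lam hr)
        have e2 := congrArg Prod.fst hd
        simp only at e1 e2
        omega
      have hn : nn (t + 1) = nn t := by
        have := particleCount_succ (lam := lam) m t
        rwa [nextCount, if_neg hr'] at this
      have h1 := hσ t ht.le
      have h2 := hσ (t + 1) ht
      have h3 := hsub t ht.le
      have h4 := hsub (t + 1) ht
      have hs := hstep t ht
      rw [← h1.2.2, ← h2.2.2] at hs
      rw [stepDet_profileSet_of_not_up hr' hn h1.1 h2.1 h1.2.1 h2.2.1 h3 h4] at hs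
      by_contra hI
      rw [if_neg hI] at hs
      simp at hs
  obtain ⟨W, hW⟩ := exists_boundarySeq_eq hint
  refine ⟨W, funext fun i => ?_⟩
  rw [heightPath, heightSet, hW _ i.2]
  refine (hσ _ i.2).2.2.trans ?_
  rw [hS, trajectory_succ _ _ i.2]

open Classical in
/-- The total weight of the non-intersecting configurations is a sum over arrays. -/
theorem hasSum_configForm
    (hX : ∀ k ≤ particleCount lam m (width lam + len lam), -(k : ℤ) ∈ X) :
    HasSum (fun W : Arrays lam => if ∀ i, heightPath m W i ⊆ X then
      (∏ i : Fin (width lam + len lam),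
        (1 - stepParam lam a b i) ^ particleCount lam m (i + 1)) *
      (∏ q ∈ shape lam, (a q.1 * b q.2) ^ extend W q.1 q.2) *
      ∏ i : Fin (width lam + len lam), ∏ y ∈ heightPath m W i, h (i + 1) y else 0)
    (configForm (IsRightStep lam)
      (fun t x y => stepCoef (IsRightStep lam) (stepParam lam a b) t (y - x)) h X
      (width lam + len lam) 0 (particleCount lam m 0)
      fun i => Pi.single (packed (particleCount lam m 0) i) 1) := by
  have hform := configForm_eq_sum_trajectory (IsRightStep lam)
    (fun t x y => stepCoef (IsRightStep lam) (stepParam lam a b) t (y - x)) h X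
    (particleCount_succ (lam := lam) m) (width lam + len lam)
    (profileSet (particleCount lam m 0) 0)
  rw [sortedTuple_profileSet (fun _ _ _ => le_rfl), profile_zero] at hform
  rw [hform]
  set P := Fintype.piFinset fun i : Fin (width lam + len lam) =>
    X.powersetCard (particleCount lam m (i + 1)) with hP
  set F : (Fin (width lam + len lam) → Finset ℤ) → ℝ := fun f =>
    (∏ i : Fin (width lam + len lam), stepDet (IsRightStep lam)
      (fun t x y => stepCoef (IsRightStep lam) (stepParam lam a b) t (y - x)) h X i
      (particleCount lam m i) (trajectory (profileSet (particleCount lam m 0) 0) f i)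
      (trajectory (profileSet (particleCount lam m 0) 0) f (i + 1))) *
      finalWeight (particleCount lam m (width lam + len lam))
        (trajectory (profileSet (particleCount lam m 0) 0) f (width lam + len lam)) with hF
  have hsumF : HasSum (fun f => if f ∈ P then F f else 0) (∑ f ∈ P, F f) := by
    rw [← Finset.sum_congr rfl fun f (hf : f ∈ P) => if_pos hf]
    exact hasSum_sum_of_ne_finset_zero fun f hf => if_neg hf
  -- Trajectories that do not come from an array have weight zero, so the finite sum over
  -- trajectories becomes a sum over arrays.
  have hzero : ∀ f ∉ Set.range (heightPath (lam := lam) m), (if f ∈ P then F f else 0) = 0 := by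
    intro f hf
    by_contra hne
    have hfP : f ∈ P := by
      by_contra hfP
      exact hne (if_neg hfP)
    rw [if_pos hfP] at hne
    exact hf (exists_heightPath_eq hX hfP hne)
  refine (((heightPath_injective (lam := lam)).hasSum_iff hzero).2 hsumF).congr_fun ?_
  intro W
  have hmem : heightPath m W ∈ P ↔ ∀ i, heightPath m W i ⊆ X := by
    rw [hP, Fintype.mem_piFinset]
    refine forall_congr' fun i => ?_
    rw [Finset.mem_powersetCard]
    exact and_iff_left (card_heightSet m W _)
  simp only [Function.comp_apply, hmem]
  split_ifs with hsub
  · have hsub' : ∀ t ≤ width lam + len lam, heightSet m W t ⊆ X := by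
      intro t ht
      cases t with
      | zero =>
        rw [heightSet_zero]
        intro y hy
        obtain ⟨k, hk, rfl⟩ := mem_profileSet.1 hy
        have := hX k (hk.le.trans (particleCount_mono m (Nat.zero_le _)))
        simpa using this
      | succ t => exact hsub ⟨t, ht⟩
    simp only [hF]
    rw [trajectory_heightPath W le_rfl, heightSet_last, finalWeight_profileSet_zero, mul_one]
    have hterm : ∀ i : Fin (width lam + len lam), stepDet (IsRightStep lam)
        (fun t x y => stepCoef (IsRightStep lam) (stepParam lam a b) t (y - x)) h X i
        (particleCount lam m i)
        (trajectory (profileSet (particleCount lam m 0) 0) (heightPath m W) i)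
        (trajectory (profileSet (particleCount lam m 0) 0) (heightPath m W) (i + 1)) =
        (1 - stepParam lam a b i) ^ particleCount lam m (i + 1) *
        stepWeight a b (extend W) (particleCount lam m (width lam + len lam)) (path lam) i *
        ∏ y ∈ heightSet m W (i + 1), h (i + 1) y := by
      intro i
      rw [trajectory_heightPath W i.2.le, trajectory_heightPath W i.2,
        stepDet_heightSet hX W i.2 (hsub' _ i.2.le) (hsub' _ i.2)]
    simp only [hterm]
    rw [Finset.prod_mul_distrib, Finset.prod_mul_distrib, ← cells_path,
      ← prod_stepWeight a b (extend W) (particleCount lam m (width lam + len lam)) _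
        (isDownRight_path lam) fun t ht =>
          (Nat.le_add_left _ m).trans (particleCount_mono m ht)]
    congr 2
    exact (Fin.prod_univ_eq_prod_range _ _).symm
  · rfl

end ArraySums


/-! ## The generating functional of the occupied points -/

section Expectation

open Classical Filter Topology

variable {lam : YoungDiagram} {a b : ℕ → ℝ} {ι : Type*} [Fintype ι] {m : ℕ}

/-- The factor of the generating functional of the occupied points. -/
noncomputable def occupation (m : ℕ) (z : ι → ℕ × ℤ) (u v : ℝ) (W : Arrays lam) : ℝ :=
  ∏ i, if (z i).2 ∈ heightSet m W (z i).1 then u else v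

theorem pointWeight_eq_prod {z : ι → ℕ × ℤ} (hz : Function.Injective z) (q : ℝ) (t : ℕ) (y : ℤ) :
    pointWeight z q t y = ∏ i, if z i = (t, y) then 1 + q else 1 := by
  rw [pointWeight]
  by_cases h : ∃ i, z i = (t, y)
  · obtain ⟨i, hi⟩ := h
    have hj : ∀ j, z j = (t, y) ↔ j = i := fun j => by rw [← hi, hz.eq_iff]
    simp only [hj, Finset.sum_ite_eq', Finset.prod_ite_eq', Finset.mem_univ, if_true, mul_one]
  · push Not at h
    simp [h]

theorem prod_pointWeight_heightPath {z : ι → ℕ × ℤ} (hz : Function.Injective z)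
    (hz1 : ∀ i, 1 ≤ (z i).1 ∧ (z i).1 < width lam + len lam) (q : ℝ) (W : Arrays lam) :
    ∏ j : Fin (width lam + len lam), ∏ y ∈ heightPath m W j, pointWeight z q (j + 1) y =
      occupation m z (1 + q) 1 W := by
  simp only [pointWeight_eq_prod hz, occupation]
  simp_rw [Finset.prod_comm (t := Finset.univ (α := ι))]
  refine Finset.prod_congr rfl fun i _ => ?_
  have ht : (z i).1 - 1 < width lam + len lam := by have := hz1 i; omega
  have ht' : (z i).1 - 1 + 1 = (z i).1 := by have := hz1 i; omega
  rw [Finset.prod_eq_single (⟨(z i).1 - 1, ht⟩ : Fin (width lam + len lam))]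
  · have he : ∀ y : ℤ, z i = ((z i).1 - 1 + 1, y) ↔ (z i).2 = y := by
      intro y
      rw [ht', Prod.ext_iff]
      simp
    simp only [heightPath, he]
    rw [Finset.prod_ite_eq, ht']
  · intro j _ hj
    refine Finset.prod_eq_one fun y _ => if_neg fun h => hj ?_
    rw [Fin.ext_iff]
    simp [h]
  · intro h
    exact absurd (Finset.mem_univ _) h

theorem abs_occupation_le (m : ℕ) (z : ι → ℕ × ℤ) {u v C : ℝ} (hu : 0 ≤ u) (huC : u ≤ C)
    (hv : 0 ≤ v) (hvC : v ≤ C) (W : Arrays lam) :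
    ‖occupation m z u v W‖ ≤ C ^ Fintype.card ι := by
  rw [occupation, Real.norm_of_nonneg (Finset.prod_nonneg fun i _ => by split_ifs <;> assumption)]
  refine (Finset.prod_le_prod (fun i _ => by split_ifs <;> assumption)
    (fun i _ => show _ ≤ C by split_ifs <;> assumption)).trans ?_
  rw [Finset.prod_const, Finset.card_univ]

instance : IsProbabilityMeasure (arrayMeasure lam a b) := by
  unfold arrayMeasure
  infer_instance

variable (ha : ∀ i ∈ Finset.Icc 1 (width lam), 0 ≤ a i ∧ a i < 1)
  (hb : ∀ j ∈ Finset.Icc 1 (len lam), 0 ≤ b j ∧ b j < 1)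

theorem integrable_of_norm_le {f : Arrays lam → ℝ} {C : ℝ} (hf : ∀ W, ‖f W‖ ≤ C) :
    Integrable f (arrayMeasure lam a b) :=
  Integrable.of_bound Measurable.of_discrete.aestronglyMeasurable C (ae_of_all _ hf)

include ha hb in
theorem weight_mem_Ico {q : ℕ × ℕ} (hq : q ∈ shape lam) :
    0 ≤ a q.1 * b q.2 ∧ a q.1 * b q.2 < 1 := by
  have h := Finset.mem_product.1 (Finset.mem_filter.1 hq).1
  have h1 := ha _ h.1
  have h2 := hb _ h.2
  exact ⟨mul_nonneg h1.1 h2.1, mul_lt_one_of_nonneg_of_lt_one_left h1.1 h1.2 h2.2.le⟩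

include ha hb in
theorem prod_one_sub_pos : 0 < ∏ q ∈ shape lam, (1 - a q.1 * b q.2) :=
  Finset.prod_pos fun q hq => by linarith [(weight_mem_Ico ha hb hq).2]

include ha hb in
theorem arrayMeasure_real_singleton (W : Arrays lam) :
    (arrayMeasure lam a b).real {W} = (∏ q ∈ shape lam, (1 - a q.1 * b q.2)) *
      ∏ q ∈ shape lam, (a q.1 * b q.2) ^ extend W q.1 q.2 := by
  rw [measureReal_def, arrayMeasure_singleton ha hb, ENNReal.toReal_ofReal]
  exact mul_nonneg (prod_one_sub_pos ha hb).le
    (Finset.prod_nonneg fun q hq => pow_nonneg (weight_mem_Ico ha hb hq).1 _)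

variable (lam a b m) in
/-- The ratio of the total weight of the non-intersecting configurations and of the arrays. -/
noncomputable def pathConst : ℝ := (∏ i : Fin (width lam + len lam),
    (1 - stepParam lam a b i) ^ particleCount lam m (i + 1)) /
  ∏ q ∈ shape lam, (1 - a q.1 * b q.2)

include ha hb in
theorem pathConst_pos : 0 < pathConst lam a b m :=
  div_pos (Finset.prod_pos fun i _ => pow_pos (by linarith [(stepParam_mem ha hb i).2]) _)
    (prod_one_sub_pos ha hb)

include ha hb in
theorem configForm_eq_integral {z : ι → ℕ × ℤ} (hz : Function.Injective z)
    (hz1 : ∀ i, 1 ≤ (z i).1 ∧ (z i).1 < width lam + len lam) {q : ℝ} (hq : 0 ≤ q) {X : Finset ℤ}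
    (hX : ∀ k ≤ particleCount lam m (width lam + len lam), -(k : ℤ) ∈ X) :
    configForm (IsRightStep lam)
      (fun t x y => stepCoef (IsRightStep lam) (stepParam lam a b) t (y - x)) (pointWeight z q) X
      (width lam + len lam) 0 (particleCount lam m 0)
      (fun i => Pi.single (packed (particleCount lam m 0) i) 1) =
    pathConst lam a b m * ∫ W, (if ∀ i, heightPath m W i ⊆ X then
      occupation m z (1 + q) 1 W else 0) ∂(arrayMeasure lam a b) := by
  rw [integral_countable, ← tsum_mul_left, ← (hasSum_configForm (a := a) (b := b)
    (h := pointWeight z q) hX).tsum_eq]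
  · refine tsum_congr fun W => ?_
    rw [arrayMeasure_real_singleton ha hb, pathConst, prod_pointWeight_heightPath hz hz1, smul_eq_mul]
    have := (prod_one_sub_pos ha hb).ne'
    split_ifs
    · field_simp
    · simp
  · refine integrable_of_norm_le (C := (1 + q) ^ Fintype.card ι) fun W => ?_
    split_ifs
    · exact abs_occupation_le m z (by linarith) le_rfl zero_le_one (by linarith) W
    · rw [norm_zero]
      exact pow_nonneg (by linarith) _

theorem eventually_heightPath_subset (W : Arrays lam) :
    ∀ᶠ M in atTop, ∀ i, heightPath m W i ⊆ window M := by
  refine eventually_all.2 fun i => ?_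
  exact (eventually_all_finset _).2 fun y _ => eventually_mem_window y

theorem eventually_neg_mem_window (N : ℕ) : ∀ᶠ M in atTop, ∀ k ≤ N, -(k : ℤ) ∈ window M := by
  filter_upwards [eventually_ge_atTop N] with M hM k hk
  rw [window, Finset.mem_Icc]
  omega

/-- The initial particles are point masses at packed sites with birth time 0, so their rows have the
same form as those of the later ones. -/
theorem configForm_packed_eq_det {h : ℕ → ℤ → ℝ} {φ : ℕ → ℤ → ℤ → ℝ} {X : Finset ℤ}
    (hX : ∀ k ≤ particleCount lam m (width lam + len lam), -(k : ℤ) ∈ X) :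
    configForm (IsRightStep lam) φ h X (width lam + len lam) 0 (particleCount lam m 0)
      (fun i => Pi.single (packed (particleCount lam m 0) i) 1) =
    Matrix.det (Matrix.of fun k j : Fin (particleCount lam m (width lam + len lam)) =>
      pathKernel φ h X (width lam + len lam - birthTime lam m
        (particleCount lam m (width lam + len lam) - 1 - k))
        (birthTime lam m (particleCount lam m (width lam + len lam) - 1 - k))
        (packed _ k) (packed _ j)) := by
  have hXp : ∀ j : Fin (particleCount lam m (width lam + len lam)), packed _ j ∈ X := by
    intro j
    rw [packed_eq]
    exact hX _ (by omega)
  rw [configForm_eq_det (IsRightStep lam) φ h X (particleCount_succ m) (birthTime lam m)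
    (particleCount lam m (width lam + len lam)) hXp (width lam + len lam) 0 (by rw [zero_add])
    (fun s _ _ hs => birthTime_particleCount hs) _ rfl]
  congr 1
  ext k j
  simp only [Matrix.of_apply, zero_add]
  split_ifs with hk
  · have hk2 := k.2
    have hp : packed (particleCount lam m 0) ⟨k + particleCount lam m 0 -
        particleCount lam m (width lam + len lam), by omega⟩ =
        packed (particleCount lam m (width lam + len lam)) k := by
      simp only [packed]
      omega
    rw [hp, Finset.sum_eq_single (packed _ k)]
    · rw [Pi.single_eq_same, one_mul, birthTime_of_lt (by omega), Nat.sub_zero]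
    · intro x _ hx
      rw [Pi.single_eq_of_ne hx, zero_mul]
    · intro h
      exact absurd (hXp k) h
  · rfl

variable {r₁ r₂ : ℝ}

include ha hb in
/-- The generating functional of the occupied points, up to a constant. -/
theorem pathConst_mul_integral [DecidableEq ι] (h₁ : Admissible (IsRightStep lam) (stepParam lam a b) r₁)
    (h₂ : Admissible (IsRightStep lam) (stepParam lam a b) r₂) (h12 : r₁ < r₂)
    (hT : 1 ≤ width lam + len lam) {z : ι → ℕ × ℤ} (hz : Function.Injective z)
    (hz1 : ∀ i, 1 ≤ (z i).1 ∧ (z i).1 < width lam + len lam)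
    (hzy : ∀ i, 1 ≤ (z i).2 + particleCount lam m (z i).1) : ∃ D : ℂ, ∀ q : ℝ, 0 ≤ q →
    ((pathConst lam a b m * ∫ W, occupation m z (1 + q) 1 W ∂(arrayMeasure lam a b) : ℝ) : ℂ) =
      D * Matrix.det (1 + Matrix.of fun i i' => (q : ℂ) *
        stepKernel (IsRightStep lam) (stepParam lam a b) (width lam + len lam) r₁ r₂ (z i) (z i')) := by
  have hc := fun t => (stepParam_mem ha hb t).1
  have hc1 := fun t => (stepParam_mem ha hb t).2
  refine ⟨_, fun q hq => (congrArg _ ?_).trans (det_fromBlocks_eq_det_stepKernel hc hc1 h₁ h₂ h12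
    (particleCount_succ m) (fun i hi => birthTime_of_lt hi) (fun t ht => birthTime_particleCount ht)
    (width lam + len lam) (fun s hs i hi => birthTime_lt hs hi)
    (fun s i hi hs => le_birthTime hT hi hs) hT z hz1 hzy q)⟩
  -- Both sides are limits, as the window exhausts ℤ, of the same total weight: once as an
  -- expectation over arrays, once as a determinant.
  refine tendsto_nhds_unique (f := fun M => configForm (IsRightStep lam)
      (fun t x y => stepCoef (IsRightStep lam) (stepParam lam a b) t (y - x)) (pointWeight z q)
      (window M) (width lam + len lam) 0 (particleCount lam m 0)
      (fun i => Pi.single (packed (particleCount lam m 0) i) 1)) (l := atTop) ?_ ?_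
  · have hlim : Tendsto (fun M => pathConst lam a b m * ∫ W,
        (if ∀ i, heightPath m W i ⊆ window M then occupation m z (1 + q) 1 W else 0)
          ∂(arrayMeasure lam a b)) atTop
        (𝓝 (pathConst lam a b m * ∫ W, occupation m z (1 + q) 1 W ∂(arrayMeasure lam a b))) := by
      refine Tendsto.const_mul _ (tendsto_integral_of_dominated_convergence
        (fun _ => (1 + q) ^ Fintype.card ι) (fun M => Measurable.of_discrete.aestronglyMeasurable)
        (integrable_const _) (fun M => ae_of_all _ fun W => ?_) (ae_of_all _ fun W => ?_))
      · split_ifs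
        · exact abs_occupation_le m z (by linarith) le_rfl zero_le_one (by linarith) W
        · rw [norm_zero]
          exact pow_nonneg (by linarith) _
      · refine tendsto_const_nhds.congr' ?_
        filter_upwards [eventually_heightPath_subset (m := m) W] with M hM
        rw [if_pos hM]
    refine hlim.congr' ?_
    filter_upwards [eventually_neg_mem_window (particleCount lam m (width lam + len lam))] with M hM
    rw [configForm_eq_integral ha hb hz hz1 hq hM]
  · refine Tendsto.congr' ?_ (tendsto_det_pathKernel_pointWeight
      (g := stepCoef (IsRightStep lam) (stepParam lam a b)) ?_ ?_ z q
      (packed (particleCount lam m (width lam + len lam)))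
      (fun k => birthTime lam m (particleCount lam m (width lam + len lam) - 1 - k))
      (width lam + len lam) (fun k => ?_) fun i => (hz1 i).2)
    · filter_upwards [eventually_neg_mem_window (particleCount lam m (width lam + len lam))] with M hM
      rw [configForm_packed_eq_det hM]
    · exact stepCoef_nonneg hc hc1
    · exact summable_convKernel_stepCoef hc hc1
    · exact (birthTime_lt hT (by have := k.2; omega)).le

include ha hb in
/-- The probability that given points are occupied is a determinant. -/
theorem measureReal_occupied [DecidableEq ι] (h₁ : Admissible (IsRightStep lam) (stepParam lam a b) r₁)
    (h₂ : Admissible (IsRightStep lam) (stepParam lam a b) r₂) (h12 : r₁ < r₂)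
    (hT : 1 ≤ width lam + len lam) {z : ι → ℕ × ℤ} (hz : Function.Injective z)
    (hz1 : ∀ i, 1 ≤ (z i).1 ∧ (z i).1 < width lam + len lam)
    (hzy : ∀ i, 1 ≤ (z i).2 + particleCount lam m (z i).1) :
    (((arrayMeasure lam a b).real {W | ∀ i, (z i).2 ∈ heightSet m W (z i).1} : ℝ) : ℂ) =
      Matrix.det (Matrix.of fun i i' => stepKernel (IsRightStep lam) (stepParam lam a b)
        (width lam + len lam) r₁ r₂ (z i) (z i')) := by
  set μ := arrayMeasure lam a b with hμ
  set A : Matrix ι ι ℂ := Matrix.of fun i i' => stepKernel (IsRightStep lam) (stepParam lam a b)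
    (width lam + len lam) r₁ r₂ (z i) (z i') with hA
  obtain ⟨D, hD⟩ := pathConst_mul_integral ha hb h₁ h₂ h12 hT hz hz1 hzy
  have hκ := (pathConst_pos (m := m) ha hb).ne'
  -- For `q = 0` the functional is 1 and the determinant is 1, which identifies the constant without
  -- evaluating it.
  have hD0 : (pathConst lam a b m : ℂ) = D := by
    have h0 := hD 0 le_rfl
    have e : (1 : Matrix ι ι ℂ) + Matrix.of (fun i i' => ((0 : ℝ) : ℂ) *
        stepKernel (IsRightStep lam) (stepParam lam a b) (width lam + len lam) r₁ r₂ (z i) (z i')) =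
        1 := by
      ext i i'
      simp
    rw [e, Matrix.det_one, mul_one] at h0
    rw [← h0]
    simp [occupation]
  -- Put `q = 1/u` and multiply by `u` for every point: the factor becomes `u + 1` at occupied and
  -- `u` at empty points.
  have hgen : ∀ u : ℝ, 0 < u → ((∫ W, occupation m z (1 + u) u W ∂μ : ℝ) : ℂ) =
      Matrix.det ((u : ℂ) • (1 : Matrix ι ι ℂ) + A) := by
    intro u hu
    have h0 := hD u⁻¹ (inv_nonneg.2 hu.le)
    rw [Complex.ofReal_mul, hD0] at h0
    have h1 := mul_left_cancel₀ (hD0 ▸ Complex.ofReal_ne_zero.2 hκ) h0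
    have h2 : (u : ℂ) • (1 : Matrix ι ι ℂ) + A = (u : ℂ) • (1 + Matrix.of fun i i' =>
        ((u⁻¹ : ℝ) : ℂ) * stepKernel (IsRightStep lam) (stepParam lam a b) (width lam + len lam)
          r₁ r₂ (z i) (z i')) := by
      ext i i'
      have hu' : (u : ℂ) ≠ 0 := Complex.ofReal_ne_zero.2 hu.ne'
      simp only [Matrix.add_apply, Matrix.smul_apply, Matrix.of_apply, smul_eq_mul, hA]
      push_cast
      field_simp
    rw [h2, Matrix.det_smul, ← h1, ← Complex.ofReal_pow, ← Complex.ofReal_mul,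
      ← integral_const_mul]
    congr 2
    funext W
    rw [occupation, occupation, ← Finset.card_univ, ← Finset.prod_const, ← Finset.prod_mul_distrib]
    refine Finset.prod_congr rfl fun i _ => ?_
    split_ifs
    · field_simp
      ring
    · rw [mul_one]
  have hocc : ∀ W, occupation m z 1 0 W =
      {W : Arrays lam | ∀ i, (z i).2 ∈ heightSet m W (z i).1}.indicator 1 W := by
    intro W
    by_cases h : ∀ i, (z i).2 ∈ heightSet m W (z i).1
    · refine Eq.trans ?_ (Set.indicator_of_mem (Set.mem_ofPred_eq ▸ h) _).symm
      exact Finset.prod_eq_one fun i _ => if_pos (h i)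
    · refine Eq.trans ?_ (Set.indicator_of_notMem (Set.mem_ofPred_eq ▸ h) _).symm
      push Not at h
      obtain ⟨i, hi⟩ := h
      exact Finset.prod_eq_zero (Finset.mem_univ i) (if_neg hi)
  -- As `u` decreases to 0 the product tends to the indicator that all points are occupied.
  have hlim1 : Tendsto (fun u : ℝ => ((∫ W, occupation m z (1 + u) u W ∂μ : ℝ) : ℂ)) (𝓝[>] 0)
      (𝓝 ((∫ W, occupation m z 1 0 W ∂μ : ℝ) : ℂ)) := by
    refine (Complex.continuous_ofReal.tendsto _).comp
      (tendsto_integral_filter_of_dominated_convergence (fun _ => 2 ^ Fintype.card ι)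
      (Eventually.of_forall fun u => Measurable.of_discrete.aestronglyMeasurable) ?_
      (integrable_const _) (ae_of_all _ fun W => ?_))
    · filter_upwards [Ioc_mem_nhdsGT (zero_lt_one (α := ℝ))] with u hu
      exact ae_of_all _ fun W => abs_occupation_le m z (by linarith [hu.1]) (by linarith [hu.2])
        hu.1.le (by linarith [hu.2]) W
    · have hcont : Continuous fun u : ℝ => occupation m z (1 + u) u W := by
        unfold occupation
        refine continuous_finsetProd _ fun i _ => ?_
        split_ifs <;> fun_prop
      have := hcont.tendsto 0
      rw [add_zero] at this
      exact this.mono_left nhdsWithin_le_nhds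
  have hlim2 : Tendsto (fun u : ℝ => Matrix.det ((u : ℂ) • (1 : Matrix ι ι ℂ) + A)) (𝓝[>] 0)
      (𝓝 (Matrix.det A)) := by
    have hcont : Continuous fun u : ℝ => Matrix.det ((u : ℂ) • (1 : Matrix ι ι ℂ) + A) :=
      Continuous.matrix_det (by fun_prop)
    have := hcont.tendsto 0
    rw [Complex.ofReal_zero, zero_smul, zero_add] at this
    exact this.mono_left nhdsWithin_le_nhds
  have hfin := tendsto_nhds_unique (hlim1.congr' (by
    filter_upwards [self_mem_nhdsWithin] with u hu
    exact hgen u hu)) hlim2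
  rw [← hfin]
  simp only [hocc]
  rw [integral_indicator_one MeasurableSet.of_discrete]

end Expectation


/-! ## The correlation kernel -/

section KernelFormula

open Real Metric

variable {lam : YoungDiagram} {a b : ℕ → ℝ} {r₁ r₂ : ℝ}

theorem prod_Ico_pathIndex (f : ℕ → ℂ) {u : ℤ} (hu : -(len lam : ℤ) ≤ u) (v : ℤ) :
    ∏ t ∈ Finset.Ico u v, f (pathIndex lam t) =
      ∏ n ∈ Finset.Ico (pathIndex lam u) (pathIndex lam v), f n := by
  refine Finset.prod_nbij' (pathIndex lam) (fun n => (n : ℤ) - len lam) ?_ ?_ ?_ ?_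
    fun _ _ => rfl <;> simp only [Finset.mem_Ico, pathIndex] <;> intros <;> omega

theorem fPlus_eq_upSymb {t : ℤ} (ht : pathIndex lam t < width lam + len lam) (z : ℂ) :
    fPlus lam a t (1 / z) = upSymb (IsRightStep lam) (stepParam lam a b) (pathIndex lam t) z := by
  rw [fPlus, upSymb]
  split_ifs with h
  · rw [stepParam, if_pos ht, if_pos h, mul_one_div]
  · rfl

theorem fMinus_eq_downSymb {t : ℤ} (ht : pathIndex lam t < width lam + len lam) (z : ℂ) :
    fMinus lam b t (1 / z) = downSymb (IsRightStep lam) (stepParam lam a b) (pathIndex lam t) z := by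
  rw [fMinus, downSymb]
  split_ifs with h
  · rfl
  · rw [stepParam, if_pos ht, if_neg h, div_div_eq_mul_div, div_one]

theorem pathIndex_lt {t : ℤ} (h : -(len lam : ℤ) ≤ t) (h' : t < width lam) :
    pathIndex lam t < width lam + len lam := by
  rw [pathIndex]
  omega

theorem bigF_eq_outerSymb_mul_innerSymb {r s : ℤ} (hr : r ∈ Set.Ioo (-(len lam : ℤ)) (width lam))
    (hs : s ∈ Set.Ioo (-(len lam : ℤ)) (width lam)) (z w : ℂ) : bigF lam a b r s z w =
    outerSymb (IsRightStep lam) (stepParam lam a b) (width lam + len lam) (pathIndex lam r) z *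
      innerSymb (IsRightStep lam) (stepParam lam a b) (width lam + len lam) (pathIndex lam s) w := by
  have hK : pathIndex lam (width lam) = width lam + len lam := by
    rw [pathIndex]
    omega
  have hL : pathIndex lam (-(len lam : ℤ)) = 0 := by
    rw [pathIndex]
    omega
  obtain ⟨hr1, hr2⟩ := hr
  obtain ⟨hs1, hs2⟩ := hs
  have e1 : ∏ t ∈ Finset.Ico r (width lam : ℤ), fMinus lam b t (1 / z) =
      ∏ n ∈ Finset.Ico (pathIndex lam r) (width lam + len lam),
        downSymb (IsRightStep lam) (stepParam lam a b) n z := by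
    rw [← hK, ← prod_Ico_pathIndex _ hr1.le]
    refine Finset.prod_congr rfl fun t ht => fMinus_eq_downSymb ?_ z
    rw [Finset.mem_Ico] at ht
    exact pathIndex_lt (by omega) ht.2
  have e2 : ∏ t ∈ Finset.Ico s (width lam : ℤ), (fMinus lam b t (1 / w))⁻¹ =
      ∏ n ∈ Finset.Ico (pathIndex lam s) (width lam + len lam),
        (downSymb (IsRightStep lam) (stepParam lam a b) n w)⁻¹ := by
    rw [← hK, ← prod_Ico_pathIndex (fun n => (downSymb _ _ n w)⁻¹) hs1.le]
    refine Finset.prod_congr rfl fun t ht => congrArg _ (fMinus_eq_downSymb ?_ w)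
    rw [Finset.mem_Ico] at ht
    exact pathIndex_lt (by omega) ht.2
  have e3 : ∏ t ∈ Finset.Ico (-(len lam : ℤ)) s, fPlus lam a t (1 / w) =
      ∏ n ∈ Finset.Ico 0 (pathIndex lam s),
        upSymb (IsRightStep lam) (stepParam lam a b) n w := by
    rw [← hL, ← prod_Ico_pathIndex _ le_rfl]
    refine Finset.prod_congr rfl fun t ht => fPlus_eq_upSymb ?_ w
    rw [Finset.mem_Ico] at ht
    exact pathIndex_lt ht.1 (by omega)
  have e4 : ∏ t ∈ Finset.Ico (-(len lam : ℤ)) r, (fPlus lam a t (1 / z))⁻¹ =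
      ∏ n ∈ Finset.Ico 0 (pathIndex lam r),
        (upSymb (IsRightStep lam) (stepParam lam a b) n z)⁻¹ := by
    rw [← hL, ← prod_Ico_pathIndex (fun n => (upSymb _ _ n z)⁻¹) le_rfl]
    refine Finset.prod_congr rfl fun t ht => congrArg _ (fPlus_eq_upSymb ?_ z)
    rw [Finset.mem_Ico] at ht
    exact pathIndex_lt ht.1 (by omega)
  rw [bigF, e1, e2, e3, e4, outerSymb, innerSymb]
  ring

theorem circleAverage_one_eq_integral (f : ℂ → ℂ) : circleAverage f 0 1 =
    (1 / (2 * (π : ℂ))) * ∫ θ in (-π)..π, f (Complex.exp (Complex.I * θ)) := by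
  have hper : Function.Periodic (fun θ : ℝ => f (circleMap 0 1 θ)) (2 * π) := fun θ => by
    simp only [periodic_circleMap 0 1 θ]
  have := hper.intervalIntegral_add_eq 0 (-π)
  rw [zero_add, show -π + 2 * π = π by ring] at this
  rw [circleAverage_def, this, Complex.real_smul]
  congr 1
  · push_cast
    rw [one_div]
  · simp only [circleMap, Complex.ofReal_one, one_mul, zero_add, mul_comm Complex.I]

variable (ha : ∀ i ∈ Finset.Icc 1 (width lam), 0 ≤ a i ∧ a i < 1)
  (hb : ∀ j ∈ Finset.Icc 1 (len lam), 0 ≤ b j ∧ b j < 1)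

include ha hb in
-- The integral over θ is a circle average over the unit circle, which is admissible since all
-- parameters are below 1, and there the diagonal integrand is the symbol of the transition.
theorem phi_eq_transKernel {r s : ℤ} (hr : r ∈ Set.Ioo (-(len lam : ℤ)) (width lam))
    (hs : s ∈ Set.Ioo (-(len lam : ℤ)) (width lam)) (x y : ℤ) : phi lam a b r s x y =
    transKernel (stepCoef (IsRightStep lam) (stepParam lam a b)) (pathIndex lam r)
      (pathIndex lam s) x y := by
  have hc := fun t => (stepParam_mem ha hb t).1
  have hc1 := fun t => (stepParam_mem ha hb t).2
  have hiff : r < s ↔ pathIndex lam r < pathIndex lam s := by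
    have h1 := hr.1
    have h2 := hs.1
    rw [pathIndex, pathIndex]
    omega
  by_cases h : r < s
  · have hlt := hiff.1 h
    have hsT := (pathIndex_lt hs.1.le hs.2).le
    rw [phi, if_pos h, transKernel_stepCoef hc hc1 (admissible_one hc1) hlt,
      circleAverage_one_eq_integral]
    congr 2
    funext θ
    have hn : ‖Complex.exp (Complex.I * θ)‖ = 1 := by
      rw [mul_comm, Complex.norm_exp_ofReal_mul_I]
    rw [bigF_eq_outerSymb_mul_innerSymb hr hs, outerSymb_mul_innerSymb hc hc1
      (by rw [hn]; exact admissible_one hc1) hlt.le hsT, ← Complex.exp_int_mul]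
    congr 2
    ring
  · rw [phi, if_neg h, transKernel, if_neg (fun h' => h (hiff.2 h')), Complex.ofReal_zero]

include ha hb in
-- The measures dz/z and dw/w together with the factor (2πi)⁻² make the contour integrals circle
-- averages.
theorem kernel_eq_stepKernel (h₁ : 0 < r₁) (h₂ : 0 < r₂) (p q : Lines lam × ℤ) :
    kernel lam a b r₁ r₂ p q = stepKernel (IsRightStep lam) (stepParam lam a b)
      (width lam + len lam) r₁ r₂ (pathIndex lam p.1, p.2) (pathIndex lam q.1, q.2) := by
  rw [kernel, stepKernel, phi_eq_transKernel ha hb p.1.2 q.1.2, doubleKernel, neg_add_eq_sub]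
  congr 1
  rw [circleAverage_eq_circleIntegral h₂.ne']
  simp only [circleAverage_eq_circleIntegral h₁.ne', bigF_eq_outerSymb_mul_innerSymb p.1.2 q.1.2,
    sub_zero, smul_eq_mul, one_div, ← circleIntegral.integral_const_mul]
  congr 1
  funext z
  congr 1
  funext w
  ring

theorem admissible_stepParam {ρ : ℝ} (hρ : 0 < ρ) (har : ∀ i ∈ Finset.Icc 1 (width lam), a i < ρ)
    (hbr : ∀ j ∈ Finset.Icc 1 (len lam), b j * ρ < 1) :
    Admissible (IsRightStep lam) (stepParam lam a b) ρ where
  pos := hρ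
  up_lt t ht := by
    rw [stepParam]
    split_ifs with hlt
    · exact har _ (fst_path_mem_Icc lam hlt ht)
    · exact hρ
  down_lt t ht := by
    rw [stepParam]
    split_ifs with hlt
    · exact hbr _ (snd_path_mem_Icc lam hlt ht)
    · rw [zero_mul]
      exact one_pos

end KernelFormula

end LastPassage

namespace PointProcess

/-! ### Falling factorials and injective tuples -/

section Counting

theorem fallingFactorial_natCast (n k : ℕ) :
    fallingFactorial (n : ℝ≥0∞) k = (n.descFactorial k : ℝ≥0∞) := by
  rw [fallingFactorial, Nat.descFactorial_eq_prod_range, Nat.cast_prod]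
  exact Finset.prod_congr rfl fun l _ => (ENNReal.natCast_sub n l).symm

/-- Injective tuples with the `k`-th entry in the class `c k` correspond to families of embeddings,
one for every class. -/
noncomputable def injectiveTupleEquiv {Λ : Type*} {n m : ℕ} (c : Fin n → Fin m)
    (B : Fin m → Finset Λ) (hB : Pairwise fun i j => Disjoint (B i) (B j)) :
    {z : Fin n → Λ // Function.Injective z ∧ ∀ k, z k ∈ B (c k)} ≃
      ((j : Fin m) → ({k // c k = j} ↪ B j)) where
  toFun z j := ⟨fun k => ⟨z.1 k, by simpa only [k.2] using z.2.2 k⟩, fun k k' h =>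
    Subtype.ext (z.2.1 (congrArg Subtype.val h))⟩
  invFun e := ⟨fun k => (e (c k) ⟨k, rfl⟩ : Λ), by
    constructor
    · intro k k' h
      have hmove : ∀ j (hj : c k' = j), (e (c k') ⟨k', rfl⟩ : Λ) = e j ⟨k', hj⟩ := by
        rintro j rfl
        rfl
      have hc : c k' = c k := by
        by_contra hne
        exact Finset.disjoint_left.1 (hB hne) (e (c k') ⟨k', rfl⟩).2 
          ((show (e (c k) ⟨k, rfl⟩ : Λ) = e (c k') ⟨k', rfl⟩ from h) ▸ (e (c k) ⟨k, rfl⟩).2)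
      have h' : (e (c k) ⟨k, rfl⟩ : Λ) = e (c k) ⟨k', hc⟩ := h.trans (hmove _ hc)
      exact congrArg Subtype.val ((e (c k)).injective (Subtype.ext h'))
    · exact fun k => (e (c k) ⟨k, rfl⟩).2⟩
  left_inv z := rfl
  right_inv e := by
    funext j
    ext ⟨k, hk⟩
    subst hk
    rfl

theorem encard_injective_tuples {Λ : Type*} {n m : ℕ} (c : Fin n → Fin m)
    (B : Fin m → Finset Λ) (hB : Pairwise fun i j => Disjoint (B i) (B j)) :
    {z : Fin n → Λ | Function.Injective z ∧ ∀ k, z k ∈ B (c k)}.encard =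
      ((∏ j, (B j).card.descFactorial (multiplicity c j) : ℕ) : ℕ∞) := by
  classical
  rw [Set.encard, ENat.card_congr ((Equiv.subtypeEquivRight fun z => by
    rw [Set.mem_ofPred_eq]).trans (injectiveTupleEquiv c B hB)), ENat.card_eq_coe_fintype_card,
    Fintype.card_pi]
  congr 2
  funext j
  rw [Fintype.card_embedding_eq, Fintype.card_coe, Fintype.card_subtype, multiplicity]

theorem pi_count {Λ : Type*} [MeasurableSpace Λ] [Countable Λ] [MeasurableSingletonClass Λ]
    (n : ℕ) : Measure.pi (fun _ : Fin n => (Measure.count : Measure Λ)) = Measure.count := by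
  refine Measure.ext_of_singleton fun z => ?_
  rw [← Set.univ_pi_singleton, Measure.pi_pi, Set.univ_pi_singleton]
  simp

end Counting

/-! ## Simple point processes on countable spaces -/

section Simple

variable {Λ : Type*} [MeasurableSpace Λ] [Countable Λ] [MeasurableSingletonClass Λ]
  {Ω : Type*} [MeasurableSpace Ω] [Countable Ω]
  [MeasurableSingletonClass Ω]

/-- The correlation functions of a simple point process on a countable space. -/
noncomputable def simpleCorrelation (μ : Measure Ω) (S : Ω → Set Λ) (n : ℕ) (z : Fin n → Λ) :
    ℝ≥0 := (μ {ω | Function.Injective z ∧ ∀ k, z k ∈ S ω}).toNNReal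

theorem factorialMoment_map (μ : Measure Ω) {ξ : Ω → Measure Λ} {n m : ℕ} (A : Fin m → Set Λ)
    (c : Fin n → Fin m) :
    factorialMoment (μ.map ξ) A c =
      ∫⁻ ω, ∏ j, fallingFactorial (ξ ω (A j)) (multiplicity c j) ∂μ := by
  rw [factorialMoment, lintegral_map _ Measurable.of_discrete]
  refine Finset.measurable_fun_prod _ fun j _ => ?_
  unfold fallingFactorial
  refine Finset.measurable_fun_prod _ fun l _ => ?_
  exact (Measure.measurable_coe MeasurableSet.of_discrete).sub_const _

variable [MetricSpace Λ]

/-- For a simple configuration the product of falling factorials counts the injective tuples of its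
points with entries in the prescribed sets. Exchanging this count with the expectation gives as
density the probability that all entries are occupied. -/
theorem isCorrelationFunction_simple (hfin : ∀ A : Set Λ, Bornology.IsBounded A → A.Finite)
    (μ : Measure Ω) [IsProbabilityMeasure μ] (S : Ω → Set Λ) (n : ℕ) :
    IsCorrelationFunction (μ.map fun ω => Measure.count.restrict (S ω)) Measure.count n
      (simpleCorrelation μ S n) := by
  have key : ∀ (m : ℕ) (A : Fin m → Set Λ) (c : Fin n → Fin m),
      (∀ j, Bornology.IsBounded (A j)) → Pairwise (fun i j => Disjoint (A i) (A j)) →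
      factorialMoment (μ.map fun ω => Measure.count.restrict (S ω)) A c =
      ∫⁻ z in {z : Fin n → Λ | ∀ k, z k ∈ A (c k)}, (simpleCorrelation μ S n z : ℝ≥0∞)
        ∂(Measure.pi fun _ => Measure.count) := by
    intro m A c hA hdisj
    have hρ : ∀ z, (simpleCorrelation μ S n z : ℝ≥0∞) =
        ∫⁻ ω, {ω | Function.Injective z ∧ ∀ k, z k ∈ S ω}.indicator 1 ω ∂μ := by
      intro z
      rw [simpleCorrelation, ENNReal.coe_toNNReal (measure_ne_top _ _),
        lintegral_indicator_one MeasurableSet.of_discrete]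
    simp only [hρ]
    rw [lintegral_lintegral_swap Measurable.of_discrete.aemeasurable, factorialMoment_map]
    refine lintegral_congr fun ω => ?_
    have hBfin : ∀ j, (A j ∩ S ω).Finite := fun j => (hfin _ (hA j)).inter_of_left _
    have hB : Pairwise fun i j => Disjoint (hBfin i).toFinset (hBfin j).toFinset := by
      intro i j hij
      rw [Set.Finite.disjoint_toFinset]
      exact (hdisj hij).mono Set.inter_subset_left Set.inter_subset_left
    have hset : ∀ z : Fin n → Λ, {ω | Function.Injective z ∧ ∀ k, z k ∈ S ω}.indicator
        (1 : Ω → ℝ≥0∞) ω =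
        {z : Fin n → Λ | Function.Injective z ∧ ∀ k, z k ∈ S ω}.indicator 1 z := fun z => rfl
    simp only [hset]
    rw [lintegral_indicator_one MeasurableSet.of_discrete, Measure.restrict_apply
      MeasurableSet.of_discrete, pi_count, Measure.count_apply MeasurableSet.of_discrete]
    have he : {z : Fin n → Λ | Function.Injective z ∧ ∀ k, z k ∈ S ω} ∩
        {z | ∀ k, z k ∈ A (c k)} = {z | Function.Injective z ∧
          ∀ k, z k ∈ (fun j => (hBfin j).toFinset) (c k)} := by
      ext z
      simp only [Set.mem_inter_iff, Set.mem_ofPred_eq, Set.Finite.mem_toFinset]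
      constructor
      · rintro ⟨⟨h1, h2⟩, h3⟩
        exact ⟨h1, fun k => ⟨h3 k, h2 k⟩⟩
      · rintro ⟨h1, h2⟩
        exact ⟨⟨h1, fun k => (h2 k).2⟩, fun k => (h2 k).1⟩
    rw [he, encard_injective_tuples c _ hB]
    rw [ENat.toENNReal_coe, Nat.cast_prod]
    refine Finset.prod_congr rfl fun j _ => ?_
    rw [Measure.restrict_apply MeasurableSet.of_discrete,
      Measure.count_apply_finite _ (hBfin j), fallingFactorial_natCast]
  refine ⟨Measurable.of_discrete, fun m A c _ hA hdisj => ?_, fun m A c _ hA hdisj =>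
    key m A c hA hdisj⟩
  rw [key m A c hA hdisj]
  have hle : ∀ z, (simpleCorrelation μ S n z : ℝ≥0∞) ≤ 1 := fun z => by
    rw [simpleCorrelation, ENNReal.coe_toNNReal (measure_ne_top _ _)]
    exact prob_le_one
  refine (lintegral_mono hle).trans_lt ?_
  have hS : {z : Fin n → Λ | ∀ k, z k ∈ A (c k)}.Finite := by
    have := Set.Finite.pi (fun k => hfin _ (hA (c k)))
    refine this.subset fun z hz k _ => hz k
  rw [lintegral_one, Measure.restrict_apply_univ, pi_count]
  exact Measure.count_apply_lt_top.2 hS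

theorem isPointProcess_simple (hfin : ∀ A : Set Λ, Bornology.IsBounded A → A.Finite)
    (μ : Measure Ω) [IsProbabilityMeasure μ] (S : Ω → Set Λ) :
    IsPointProcess (μ.map fun ω => Measure.count.restrict (S ω)) where
  isProbabilityMeasure := Measure.isProbabilityMeasure_map Measurable.of_discrete.aemeasurable
  ae_isCountingMeasure := by
    -- Bounded sets are finite, so the counting property follows from countably many measurable
    -- conditions, one for each finite set.
    have hmeas : MeasurableSet {ξ : Measure Λ | ∀ s : Finset Λ,
        ξ s ∈ Set.range (Nat.cast : ℕ → ℝ≥0∞)} := by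
      rw [Set.ofPred_forall]
      exact MeasurableSet.iInter fun s => Measure.measurable_coe MeasurableSet.of_discrete
        (Set.countable_range _).measurableSet
    have hall : ∀ᵐ ξ ∂(μ.map fun ω => Measure.count.restrict (S ω)), ∀ s : Finset Λ,
        ξ s ∈ Set.range (Nat.cast : ℕ → ℝ≥0∞) := by
      rw [ae_map_iff Measurable.of_discrete.aemeasurable hmeas]
      refine ae_of_all _ fun ω s => ?_
      have hs : ((s : Set Λ) ∩ S ω).Finite := s.finite_toSet.inter_of_left _
      refine ⟨hs.toFinset.card, ?_⟩
      rw [Measure.restrict_apply MeasurableSet.of_discrete, Measure.count_apply_finite _ hs]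
    filter_upwards [hall] with ξ hξ B _ hB
    obtain ⟨n, hn⟩ := hξ (hfin B hB).toFinset
    rw [Set.Finite.coe_toFinset] at hn
    exact ⟨n, hn.symm⟩

end Simple

end PointProcess

namespace LastPassage

/-! ## The point configuration -/

section PointConfiguration

variable {lam : YoungDiagram}

/-- The points of the configuration of an array. -/
def occupiedSet (W : Arrays lam) : Set (Lines lam × ℤ) := {p | ∃ k, height W p.1 k = p.2}

theorem height_eq (W : Arrays lam) (r : ℤ) (k : ℕ) :
    height W r k = (boundarySeq W (pathIndex lam r) k : ℤ) - k := rfl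

theorem height_strictAnti (W : Arrays lam) (r : ℤ) : StrictAnti (height W r) := by
  intro k l hkl
  have := boundarySeq_antitone W (pathIndex lam r) hkl.le
  rw [height_eq, height_eq]
  omega

/-- The heights on a line strictly decrease, so no point has multiplicity above one. -/
theorem configuration_eq (W : Arrays lam) :
    configuration W = Measure.count.restrict (occupiedSet W) := by
  refine Measure.ext_of_singleton fun p => ?_
  rw [configuration, Measure.sum_apply _ (measurableSet_singleton p),
    Measure.restrict_apply (measurableSet_singleton p)]
  by_cases hp : p ∈ occupiedSet W
  · obtain ⟨k, hk⟩ := hp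
    rw [tsum_eq_single (p.1, k)]
    · rw [Set.inter_eq_left.2 (Set.singleton_subset_iff.2 (show p ∈ occupiedSet W from ⟨k, hk⟩)), Measure.count_singleton,
        Measure.dirac_apply_of_mem]
      exact Prod.ext rfl hk
    · intro q hq
      rw [Measure.dirac_apply, Set.indicator_of_notMem]
      intro h
      apply hq
      have h1 : q.1 = p.1 := congrArg Prod.fst (Set.mem_singleton_iff.1 h)
      have h2 : height W q.1 q.2 = p.2 := congrArg Prod.snd (Set.mem_singleton_iff.1 h)
      rw [h1, ← hk] at h2
      exact Prod.ext h1 ((height_strictAnti W _).injective h2)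
  · rw [Set.singleton_inter_eq_empty.2 hp, measure_empty, ENNReal.tsum_eq_zero]
    intro q
    rw [Measure.dirac_apply, Set.indicator_of_notMem]
    intro h
    rw [Set.mem_singleton_iff] at h
    apply hp
    rw [← h]
    exact ⟨q.2, rfl⟩

/-- The particles left out of the truncated set sit at the heights -k with k at least the particle
count, hence below the points considered. -/
theorem mem_occupiedSet_iff (W : Arrays lam) (m : ℕ) {p : Lines lam × ℤ}
    (hp : 1 ≤ p.2 + particleCount lam m (pathIndex lam p.1)) :
    p ∈ occupiedSet W ↔ p.2 ∈ heightSet m W (pathIndex lam p.1) := by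
  rw [heightSet, mem_profileSet]
  constructor
  · rintro ⟨k, hk⟩
    rw [height_eq] at hk
    refine ⟨k, ?_, hk.symm⟩
    by_contra hle
    rw [boundarySeq_eq_zero W (m := m) (by omega)] at hk
    push_cast at hk
    omega
  · rintro ⟨k, -, hk⟩
    exact ⟨k, hk.symm⟩

theorem finite_of_isBounded {A : Set (Lines lam × ℤ)} (hA : Bornology.IsBounded A) :
    A.Finite := by
  have h2 : (Prod.snd '' A).Finite :=
    ((Bornology.IsBounded.image_snd hA).isCompact_closure.finite_of_discrete).subset subset_closure
  refine ((Set.toFinite (Set.univ : Set (Lines lam))).prod h2).subset fun p hp => ?_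
  exact ⟨Set.mem_univ _, Set.mem_image_of_mem _ hp⟩

variable (lam) in
open PointProcess in
/-- The probability that given points are occupied by particles is given by the kernel. -/
theorem simpleCorrelation_eq_det (a b : ℕ → ℝ)
    (ha : ∀ i ∈ Finset.Icc 1 (width lam), 0 ≤ a i ∧ a i < 1)
    (hb : ∀ j ∈ Finset.Icc 1 (len lam), 0 ≤ b j ∧ b j < 1)
    (r₁ r₂ : ℝ) (hr₁ : 0 < r₁) (hr : r₁ < r₂)
    (har : ∀ i ∈ Finset.Icc 1 (width lam), a i < r₁)
    (hbr : ∀ j ∈ Finset.Icc 1 (len lam), b j * r₂ < 1) {n : ℕ} (hn : 1 ≤ n)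
    (z : Fin n → Lines lam × ℤ) :
    ((simpleCorrelation (arrayMeasure lam a b) occupiedSet n z : ℝ) : ℂ) =
      Matrix.det (Matrix.of fun i j => kernel lam a b r₁ r₂ (z i) (z j)) := by
  by_cases hz : Function.Injective z
  -- The number of additional particles is chosen so large that all the given points lie in the
  -- range seen by the truncated system.
  · obtain ⟨m, hm⟩ : ∃ m : ℕ, ∀ i, 1 ≤ (z i).2 + m := by
      refine ⟨∑ i, (1 - (z i).2).toNat, fun i => ?_⟩
      have : (1 - (z i).2).toNat ≤ ∑ i, (1 - (z i).2).toNat :=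
        Finset.single_le_sum (f := fun i => (1 - (z i).2).toNat) (fun i _ => Nat.zero_le _)
          (Finset.mem_univ i)
      omega
    have hzy : ∀ i, 1 ≤ (z i).2 + particleCount lam m (pathIndex lam (z i).1) := by
      intro i
      have := hm i
      rw [particleCount]
      push_cast
      omega
    have hz1 : ∀ i, 1 ≤ pathIndex lam (z i).1 ∧ pathIndex lam (z i).1 < width lam + len lam := by
      intro i
      obtain ⟨h1, h2⟩ := (z i).1.2
      refine ⟨?_, pathIndex_lt h1.le h2⟩
      rw [pathIndex]
      omega
    have hinj : Function.Injective fun i => (pathIndex lam (z i).1, (z i).2) := by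
      intro i j hij
      obtain ⟨h1, h2⟩ := Prod.mk.inj hij
      refine hz (Prod.ext (Subtype.ext ?_) h2)
      have := (z i).1.2.1
      have := (z j).1.2.1
      rw [pathIndex, pathIndex] at h1
      omega
    have hbr₁ : ∀ j ∈ Finset.Icc 1 (len lam), b j * r₁ < 1 := fun j hj =>
      (mul_le_mul_of_nonneg_left hr.le (hb j hj).1).trans_lt (hbr j hj)
    have hmain := measureReal_occupied ha hb (m := m) (admissible_stepParam hr₁ har hbr₁)
      (admissible_stepParam (hr₁.trans hr) (fun i hi => (har i hi).trans hr) hbr) hr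
      (by have := hz1 ⟨0, hn⟩; omega) hinj hz1 hzy
    simp only [kernel_eq_stepKernel ha hb hr₁ (hr₁.trans hr)]
    rw [← hmain, simpleCorrelation, ← ENNReal.toReal, ← measureReal_def]
    congr 3
    ext W
    simp only [hz, true_and, mem_occupiedSet_iff W m (hzy _)]
  -- If a point is repeated, both sides vanish: the correlation by its definition, the determinant
  -- by two equal rows.
  · have h0 : simpleCorrelation (arrayMeasure lam a b) (occupiedSet (lam := lam)) n z = 0 := by
      rw [simpleCorrelation]
      simp [hz]
    rw [Function.Injective] at hz
    push Not at hz
    obtain ⟨i, j, hij, hne⟩ := hz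
    rw [h0, Matrix.det_zero_of_row_eq hne]
    · simp
    · funext k
      simp only [Matrix.of_apply, hij]

end PointConfiguration

end LastPassage

theorem theorem4p2 (lam : YoungDiagram) (a b : ℕ → ℝ)
    (ha : ∀ i ∈ Finset.Icc 1 (LastPassage.width lam), 0 ≤ a i ∧ a i < 1)
    (hb : ∀ j ∈ Finset.Icc 1 (LastPassage.len lam), 0 ≤ b j ∧ b j < 1)
    (r₁ r₂ : ℝ) (hr₁ : 0 < r₁) (hr : r₁ < r₂)
    (har : ∀ i ∈ Finset.Icc 1 (LastPassage.width lam), a i < r₁)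
    (hbr : ∀ j ∈ Finset.Icc 1 (LastPassage.len lam), b j * r₂ < 1) :
    PointProcess.IsDeterminantal
      ((LastPassage.arrayMeasure lam a b).map LastPassage.configuration)
      MeasureTheory.Measure.count
      (LastPassage.kernel lam a b r₁ r₂) := by
  have hconf : (LastPassage.configuration (lam := lam)) =
      fun W => Measure.count.restrict (LastPassage.occupiedSet W) :=
    funext LastPassage.configuration_eq
  rw [hconf]
  exact ⟨PointProcess.isPointProcess_simple (fun _ => LastPassage.finite_of_isBounded) _ _,
    fun n hn => ⟨_, PointProcess.isCorrelationFunction_simple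
      (fun _ => LastPassage.finite_of_isBounded) _ _ n,
      LastPassage.simpleCorrelation_eq_det lam a b ha hb r₁ r₂ hr₁ hr har hbr hn⟩⟩
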